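/- Let $\mathbb D$ be the open unit disk, $\mathbb T$ the unit circle, $dA$ normalized area measure on $\mathbb D$, and let $\mu\neq 0$ be a finite positive Borel measure on $\overline{\mathbb D}$. Let $\omega_\mu$ be the superharmonic weight \[ \omega_\mu(z)=\int_{\mathbb D}\log\Bigl|\frac{1-\overline\zeta z}{\zeta-z}\Bigr|\frac{2}{1-|\zeta|^2}\,d\mu(\zeta)+\int_{\mathbb T}\frac{1-|z|^2}{|\zeta-z|^2}\,d\mu(\zeta)\qquad(z\in\mathbb D), \] let $\mathcal D_\mu$ be the space of holomorphic functions $f$ on $\mathbb D$ with $\mathcal D_\mu(f):=\int_{\mathbb D}|f'|^2\omega_\mu\,dA<\infty$ (then $\mathcal D_\mu\subset H^2$), and put $\|f\|_{\mathcal D_\mu}^2:=\|f\|_{H^2}^2+\mathcal D_\mu(f)$. Let $(b,a)$ be a pair, that is, $b$ belongs to the closed unit ball of $H^\infty$, and $a\in H^\infty$ is an outer function with $a(0)>0$ and $|a|^2+|b|^2=1$ a.e. on $\mathbb T$; put $\phi:=b/a$. Let $\mathcal H(b)$ be the de Branges--Rovnyak space, that is, the image of $H^2$ under $(I-T_bT_{\overline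 b})^{1/2}$, where $T_\psi f=P_+(\psi f)$ are the Toeplitz operators on $H^2$, with the norm that makes $(I-T_bT_{\overline b})^{1/2}$ a partial isometry of $H^2$ onto $\mathcal H(b)$. Then $\mathcal D_\mu=\mathcal H(b)$ with equality of norms if and only if there exist $\zeta\in\overline{\mathbb D}$ and $\alpha\in\mathbb C\setminus\{0\}$ such that \[ \mu=|\alpha|^2\delta_\zeta\qquad\text{and}\qquad \phi(z)=\frac{\alpha z}{1-\overline\zeta z}\quad(z\in\mathbb D). \] -/

import Mathlib

open MeasureTheory Metric Set
open scoped ENNReal ComplexConjugate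

noncomputable section

namespace DBR

/-! ### Weighted Dirichlet spaces on the unit disk -/

/-- The closed unit disk. -/
abbrev ClosedDisk : Type := closedBall (0 : ℂ) 1

/-- Normalized area measure on the open unit disk. -/
def diskArea : Measure ℂ :=
  (ENNReal.ofReal Real.pi)⁻¹ • (volume : Measure ℂ).restrict (ball (0 : ℂ) 1)

/-- The Dirichlet integral `𝒟_ω(f) = ∫_𝔻 |f'|² ω dA` of `f` with weight `ω`. -/
def dirichletIntegral (ω : ℂ → ℝ≥0∞) (f : ℂ → ℂ) : ℝ≥0∞ :=
  ∫⁻ z, ‖deriv f z‖ₑ ^ 2 * ω z ∂diskArea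

/-- The kernel of the representation of positive superharmonic functions on the disk:
`log |(1 - ζ̄ z) / (ζ - z)| · 2 / (1 - |ζ|²)` for `|ζ| < 1` (equal to `∞` at `z = ζ`), and the
Poisson kernel `(1 - |z|²) / |ζ - z|²` for `|ζ| = 1`. -/
def superharmonicKernel (ζ z : ℂ) : ℝ≥0∞ :=
  if ‖ζ‖ < 1 then
    if z = ζ then ∞
    else ENNReal.ofReal (Real.log ‖(1 - conj ζ * z) / (ζ - z)‖ * (2 / (1 - ‖ζ‖ ^ 2)))
  else ENNReal.ofReal ((1 - ‖z‖ ^ 2) / ‖ζ - z‖ ^ 2)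

/-- The superharmonic weight represented by the measure `μ` on the closed disk. -/
def weight (μ : Measure ClosedDisk) (z : ℂ) : ℝ≥0∞ :=
  ∫⁻ ζ, superharmonicKernel (ζ : ℂ) z ∂μ

/-- The space `𝒟_μ`: holomorphic functions on the open unit disk with finite Dirichlet integral.
(A function on the disk is represented by a function on `ℂ` whose values off the disk are
irrelevant.) -/
def dirichletSpace (μ : Measure ClosedDisk) : Set (ℂ → ℂ) :=
  {f | DifferentiableOn ℂ f (ball 0 1) ∧ dirichletIntegral (weight μ) f < ∞}

/-- The point `e^{2πit}` of the unit circle. -/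
def circlePt (t : UnitAddCircle) : ℂ := fourier 1 t

/-- The squared `H²` norm of a function on the disk,
`sup_{0 ≤ r < 1} (1/2π) ∫ |f(r e^{iθ})|² dθ`; the circle carries normalized arc length. -/
def hardyNormSq (f : ℂ → ℂ) : ℝ≥0∞ :=
  ⨆ r ∈ Ico (0 : ℝ) 1,
    ∫⁻ t : UnitAddCircle, ‖f ((r : ℂ) * circlePt t)‖ₑ ^ 2
      ∂AddCircle.haarAddCircle

/-- The squared norm of `𝒟_μ`. -/
def dirichletNormSq (μ : Measure ClosedDisk) (f : ℂ → ℂ) : ℝ≥0∞ :=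
  hardyNormSq f + dirichletIntegral (weight μ) f

/-! ### Hardy spaces on the circle -/

/-- `L^p` of the unit circle `{e^{2πit}}` with normalized arc length. -/
abbrev LpCircle (p : ℝ≥0∞) : Type :=
  Lp ℂ p (AddCircle.haarAddCircle : Measure UnitAddCircle)

/-- The Hardy space `H²`, as the subspace of `L²` of the circle of functions whose Fourier
coefficients of negative index vanish. -/
def H2 : Submodule ℂ (LpCircle 2) where
  carrier := {f | ∀ n : ℤ, n < 0 → fourierCoeff (f : UnitAddCircle → ℂ) n = 0}
  zero_mem' := fun n _ => by rw [← fourierBasis_repr]; simp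
  add_mem' := fun {f g} hf hg n hn => by
    have h1 := hf n hn
    have h2 := hg n hn
    rw [← fourierBasis_repr] at h1 h2 ⊢
    simp [h1, h2]
  smul_mem' := fun c f hf n hn => by
    have h1 := hf n hn
    rw [← fourierBasis_repr] at h1 ⊢
    simp [h1]

theorem isClosed_H2 : IsClosed (H2 : Set (LpCircle 2)) := by
  have h : (H2 : Set (LpCircle 2)) =
      ⋂ n : ℤ, ⋂ _ : n < 0, {f : LpCircle 2 | inner ℂ (fourierLp 2 n : LpCircle 2) f = 0} := by
    ext f
    simp only [mem_iInter, mem_ofPred_eq]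
    refine forall₂_congr fun n _ => ?_
    rw [← fourierBasis_repr, HilbertBasis.repr_apply_apply, coe_fourierBasis]
  rw [h]
  exact isClosed_iInter fun n => isClosed_iInter fun _ =>
    isClosed_eq (by fun_prop) continuous_const

instance : CompleteSpace H2 := isClosed_H2.completeSpace_coe

/-- Membership in `H^∞`, as a subspace of `L^∞` of the circle. -/
def IsHInf (ψ : LpCircle ∞) : Prop :=
  ∀ n : ℤ, n < 0 → fourierCoeff (ψ : UnitAddCircle → ℂ) n = 0

/-- The holomorphic function on the disk attached to a function in a Hardy space of the circle:
its Taylor coefficients are the Fourier coefficients of its boundary function. -/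
def diskExt (f : UnitAddCircle → ℂ) (z : ℂ) : ℂ :=
  ∑' n : ℕ, fourierCoeff f (n : ℤ) * z ^ n

/-- `a ∈ H^∞` is outer: `log |a|` is integrable on the circle and
`a(z) = c · exp (∫ (λ + z) / (λ - z) · log |a(λ)| dm(λ))` on the disk, with `|c| = 1`. -/
structure IsOuter (a : LpCircle ∞) : Prop where
  isHInf : IsHInf a
  ne_zero : ∀ᵐ t ∂(AddCircle.haarAddCircle : Measure UnitAddCircle), a t ≠ 0
  integrable_log :
    Integrable (fun t => Real.log ‖a t‖) (AddCircle.haarAddCircle : Measure UnitAddCircle)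
  eq_exp : ∃ c : ℂ, ‖c‖ = 1 ∧ ∀ z ∈ ball (0 : ℂ) 1,
    diskExt a z = c * Complex.exp (∫ t : UnitAddCircle,
      (circlePt t + z) / (circlePt t - z) *
        (Real.log ‖a t‖ : ℂ) ∂AddCircle.haarAddCircle)

/-- `(b, a)` is a pair: `b` is in the closed unit ball of `H^∞`, and `a` is outer with `a(0) > 0`
and `|a|² + |b|² = 1` almost everywhere on the circle. -/
structure IsPair (b a : LpCircle ∞) : Prop where
  isHInf : IsHInf b
  norm_le_one : ‖b‖ ≤ 1
  isOuter : IsOuter a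
  pos : 0 < (diskExt a 0).re ∧ (diskExt a 0).im = 0
  sq_add_sq : ∀ᵐ t ∂(AddCircle.haarAddCircle : Measure UnitAddCircle),
    ‖a t‖ ^ 2 + ‖b t‖ ^ 2 = 1

/-! ### De Branges-Rovnyak spaces -/

/-- Multiplication by `ψ ∈ L^∞` on `L²`. -/
def mulOp (ψ : LpCircle ∞) : LpCircle 2 →L[ℂ] LpCircle 2 :=
  (ContinuousLinearMap.mul ℂ ℂ).holderL AddCircle.haarAddCircle ∞ 2 2 ψ

/-- The Toeplitz operator `T_ψ f = P₊ (ψ f)` on `H²`. -/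
def toeplitz (ψ : LpCircle ∞) : H2 →L[ℂ] H2 :=
  H2.orthogonalProjectionOnto ∘L mulOp ψ ∘L H2.subtypeL

/-- The positive square root of a positive operator on a Hilbert space. -/
def opSqrt {H : Type*} [NormedAddCommGroup H] [InnerProductSpace ℂ H] [CompleteSpace H]
    (T : H →L[ℂ] H) : H →L[ℂ] H :=
  CFC.sqrt T

/-- The operator `(I - T_b T_{b̄})^{1/2}` on `H²`. -/
def defect (b : LpCircle ∞) : H2 →L[ℂ] H2 :=
  opSqrt (1 - toeplitz b ∘L toeplitz (star b))

/-- The de Branges-Rovnyak space `ℋ(b)`: the image of `H²` under `(I - T_b T_{b̄})^{1/2}`, as a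
space of functions on the disk. -/
def dbrSpace (b : LpCircle ∞) : Set (ℂ → ℂ) :=
  {f | ∃ g : H2, EqOn f (diskExt (defect b g : LpCircle 2)) (ball 0 1)}

/-- The squared norm of `ℋ(b)`: it is `‖g‖²` for the `g` orthogonal to the kernel of
`(I - T_b T_{b̄})^{1/2}` whose image is `f`, so that this operator is a partial isometry onto
`ℋ(b)`. The infimum is over a single `g` if `f ∈ ℋ(b)`. -/
def dbrNormSq (b : LpCircle ∞) (f : ℂ → ℂ) : ℝ≥0∞ :=
  ⨅ (g : H2) (_ : g ∈ (LinearMap.ker (defect b : H2 →ₗ[ℂ] H2))ᗮ)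
    (_ : EqOn f (diskExt (defect b g : LpCircle 2)) (ball 0 1)), ‖g‖ₑ ^ 2

end DBR

end

noncomputable section

namespace DBR

/-! Both norms are an `H²` norm plus a correction, and both corrections can be computed.

On the Dirichlet side, Tonelli (`dirichletIntegral_weight`) writes `𝒟_μ(f)` as the `μ`-integral of
the local integrals `𝒟_ζ(f)`, the case of a unit point mass at `ζ`. The local Douglas formula
(`local_douglas`, `exists_of_local_lt_top`) says that `𝒟_ζ(f)` is finite exactly when `f = a + (z -
ζ) g` with `g` in `H²`, and then `𝒟_ζ(f) = ‖g‖²`.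

On the de Branges-Rovnyak side, `T_b* T_b + T_a* T_a = 1` and a range argument for operators with `T
T* = S S*` show that `f` lies in `ℋ(b)` exactly when `T_b* f = T_a* f⁺` for some `f⁺` in `H²`
(`mem_dbrSpace_iff`). The mate `f⁺` is unique because `a` is outer, and `‖f‖_b² = ‖f‖² + ‖f⁺‖²`
(`dbrNormSq_eq`).

Sufficiency: if `φ = α z / (1 - ζ̄ z)`, the mate equation becomes `ᾱ S* f = (1 - ζ S*) f⁺` with `S`
the shift (`adjoint_toeplitz_eq_iff`). This says `f = a + (z - ζ) g` with `f⁺ = ᾱ g`, so spaces and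
norms agree (`dirichletSpace_eq_dbrSpace_of_dirac`).

Necessity: test the equality on `z ^ n + c z ^ m`. The local quotient of `z ^ n` is `∑_{i<n}
ζ^{n-1-i} z^i`, and its mate is `∑_{i≤n} conj (p_{n-i}) z^i`, where `φ = ∑ p_k z^k`. Comparing norms
gives `p_0 = 0` and, with `t_k = conj p_{k+1}`, the moments `μ(𝔻̄) = |t_0|²`, `∫ ζ^n dμ = conj (t_0)
t_n` and `∫ |ζ|² dμ = |t_1|²`. Hence `∫ |ζ - t_1/t_0|² dμ = 0`, so `μ` is a point mass, and the
moments then make `t_n` geometric (`exists_eq_smul_dirac`). -/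

/-! ### Power series on the unit disk -/

/-- `f` is the sum of the power series with coefficients `c` on the open unit disk. -/
def HasTaylor (f : ℂ → ℂ) (c : ℕ → ℂ) : Prop :=
  ∀ z ∈ ball (0 : ℂ) 1, HasSum (fun n => c n * z ^ n) (f z)

namespace HasTaylor

variable {f g : ℂ → ℂ} {c d : ℕ → ℂ}

theorem summable_norm (h : HasTaylor f c) {r : ℝ} (h0 : 0 ≤ r) (h1 : r < 1) :
    Summable fun n => ‖c n‖ * r ^ n := by
  have := (h (r : ℂ) (by simpa [abs_of_nonneg h0] using h1)).summable.norm
  simpa [abs_of_nonneg h0] using this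

theorem hasFPowerSeriesOnBall (h : HasTaylor f c) :
    HasFPowerSeriesOnBall f (FormalMultilinearSeries.ofScalars ℂ c) 0 1 where
  r_le := by
    refine ENNReal.le_of_forall_nnreal_lt fun r hr => ?_
    refine FormalMultilinearSeries.le_radius_of_summable_norm _ ?_
    have := h.summable_norm (r := r) r.2 (by exact_mod_cast hr)
    refine this.of_nonneg_of_le (fun n => by positivity) fun n => ?_
    gcongr
    simp
  r_pos := by simp
  hasSum := by
    intro y hy
    have := h y (by simpa [mem_eball, edist_zero_right, ← ofReal_norm] using hy)
    simpa [FormalMultilinearSeries.ofScalars_apply_eq, mul_comm] using this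

theorem differentiableOn (h : HasTaylor f c) : DifferentiableOn ℂ f (ball 0 1) := by
  have := h.hasFPowerSeriesOnBall.differentiableOn
  rwa [← ENNReal.ofReal_one, eball_ofReal] at this

theorem _root_.DifferentiableOn.hasTaylor (hf : DifferentiableOn ℂ f (ball 0 1)) :
    HasTaylor f fun n => (n.factorial : ℂ)⁻¹ * iteratedDeriv n f 0 := by
  intro z hz
  have := Complex.hasSum_taylorSeries_on_ball hf hz
  simp only [sub_zero, smul_eq_mul] at this
  convert! this using 2 with n
  ring

theorem unique (h : HasTaylor f c) (h' : HasTaylor f d) : c = d := by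
  have := h.hasFPowerSeriesOnBall.hasFPowerSeriesAt.eq_formalMultilinearSeries
    h'.hasFPowerSeriesOnBall.hasFPowerSeriesAt
  funext n
  have := congrArg (fun p => p.coeff n) this
  simpa [FormalMultilinearSeries.coeff_ofScalars] using this

theorem congr (h : HasTaylor f c) (hfg : EqOn g f (ball 0 1)) : HasTaylor g c := fun z hz => by
  rw [hfg hz]; exact h z hz

theorem eqOn (h : HasTaylor f c) (h' : HasTaylor g c) : EqOn f g (ball 0 1) := fun z hz =>
  (h z hz).unique (h' z hz)

theorem coeff_eq (h : HasTaylor f c) (n : ℕ) :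
    c n = (n.factorial : ℂ)⁻¹ * iteratedDeriv n f 0 :=
  congrFun (h.unique h.differentiableOn.hasTaylor) n

theorem deriv (h : HasTaylor f c) : HasTaylor (deriv f) fun n => (n + 1) * c (n + 1) := by
  have h1 := (h.differentiableOn.deriv isOpen_ball).hasTaylor
  convert h1 using 2 with n
  rw [h.coeff_eq, ← iteratedDeriv_succ', Nat.factorial_succ]
  have : (n.factorial : ℂ) ≠ 0 := by exact_mod_cast n.factorial_ne_zero
  have : (n + 1 : ℂ) ≠ 0 := by exact_mod_cast n.succ_ne_zero
  push_cast
  field_simp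

theorem add (h : HasTaylor f c) (h' : HasTaylor g d) :
    HasTaylor (fun z => f z + g z) fun n => c n + d n := fun z hz => by
  simpa [add_mul] using (h z hz).add (h' z hz)

theorem sub (h : HasTaylor f c) (h' : HasTaylor g d) :
    HasTaylor (fun z => f z - g z) fun n => c n - d n := fun z hz => by
  simpa [sub_mul] using (h z hz).sub (h' z hz)

theorem const_mul (h : HasTaylor f c) (a : ℂ) :
    HasTaylor (fun z => a * f z) fun n => a * c n := fun z hz => by
  simpa [mul_assoc] using (h z hz).mul_left a

theorem const (a : ℂ) : HasTaylor (fun _ => a) fun n => if n = 0 then a else 0 := fun z _ => by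
  convert hasSum_ite_eq 0 a using 2 with n
  split_ifs with h <;> simp [h]

theorem id_mul (h : HasTaylor f c) :
    HasTaylor (fun z => z * f z) fun n => if n = 0 then 0 else c (n - 1) := fun z hz => by
  rw [← hasSum_nat_add_iff' 1]
  simpa [pow_succ, mul_comm, mul_left_comm, mul_assoc] using (h z hz).mul_left z

theorem mul (h : HasTaylor f c) (h' : HasTaylor g d) :
    HasTaylor (fun z => f z * g z) fun n => ∑ k ∈ Finset.range (n + 1), c k * d (n - k) := by
  intro z hz
  have h1 := (h z hz).summable.norm
  have h2 := (h' z hz).summable.norm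
  have := hasSum_sum_range_mul_of_summable_norm h1 h2
  rw [(h z hz).tsum_eq, (h' z hz).tsum_eq] at this
  convert! this using 2 with n
  rw [Finset.sum_mul]
  refine Finset.sum_congr rfl fun k hk => ?_
  rw [mul_mul_mul_comm, ← pow_add, Nat.add_sub_cancel' (by simpa [Nat.lt_succ_iff] using hk)]

theorem exists_of_differentiableOn (hf : DifferentiableOn ℂ f (ball 0 1)) :
    ∃ c, HasTaylor f c := ⟨_, hf.hasTaylor⟩

end HasTaylor

/-! ### Parseval's identity -/

theorem Lp_enorm_sq {α : Type*} [MeasurableSpace α] {ν : Measure α} (F : Lp ℂ 2 ν) :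
    ‖F‖ₑ ^ 2 = ∫⁻ t, ‖F t‖ₑ ^ 2 ∂ν := by
  rw [Lp.enorm_def, eLpNorm_eq_lintegral_rpow_enorm_toReal (by simp) (by simp),
    ← ENNReal.rpow_natCast, ← ENNReal.rpow_mul]
  simp

theorem ofReal_norm_sq (z : ℂ) : ENNReal.ofReal (‖z‖ ^ 2) = ‖z‖ₑ ^ 2 := by
  rw [ENNReal.ofReal_pow (norm_nonneg _), ofReal_norm]

theorem tsum_enorm_fourierCoeff {T : ℝ} [hT : Fact (0 < T)]
    (F : Lp ℂ 2 (AddCircle.haarAddCircle : Measure (AddCircle T))) :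
    ∑' n, ‖fourierCoeff (F : AddCircle T → ℂ) n‖ₑ ^ 2 = ‖F‖ₑ ^ 2 := by
  have h1 := fourierBasis.repr.norm_map F
  have h2 := lp.norm_rpow_eq_tsum (p := 2) (by simp) (fourierBasis.repr F)
  have h3 := lp.memℓp (fourierBasis.repr F)
  rw [memℓp_gen_iff (by simp)] at h3
  simp only [fourierBasis_repr, ENNReal.toReal_ofNat, Real.rpow_ofNat, h1] at h2 h3
  simp_rw [← ofReal_norm_sq]
  rw [← ENNReal.ofReal_tsum_of_nonneg (fun n => by positivity) h3, ← h2,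
    ENNReal.ofReal_pow (norm_nonneg _), ofReal_norm]

theorem tsum_int_of_nonneg (u : ℤ → ℝ≥0∞) (hu : ∀ n < 0, u n = 0) :
    ∑' n, u n = ∑' n : ℕ, u n := by
  refine (Function.Injective.tsum_eq Nat.cast_injective ?_).symm
  intro n hn
  have : 0 ≤ n := by
    by_contra! h
    exact hn (hu n h)
  exact ⟨n.toNat, by simpa using this⟩

theorem norm_fourier_one {T : ℝ} (t : AddCircle T) : ‖(fourier 1 t : ℂ)‖ = 1 := by
  rw [fourier_apply]
  exact Circle.norm_coe _

/-- Parseval's identity on a circle of radius `r < 1`. -/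
theorem HasTaylor.lintegral_circle {f : ℂ → ℂ} {c : ℕ → ℂ} (h : HasTaylor f c)
    {T : ℝ} [hT : Fact (0 < T)] {r : ℝ} (h0 : 0 ≤ r) (h1 : r < 1) :
    ∫⁻ t : AddCircle T, ‖f (r * fourier 1 t)‖ₑ ^ 2 ∂AddCircle.haarAddCircle =
      ∑' n, ‖c n‖ₑ ^ 2 * ENNReal.ofReal r ^ (2 * n) := by
  have hs := h.summable_norm h0 h1
  let u : ℕ → C(AddCircle T, ℂ) := fun n => (c n * r ^ n) • fourier (n : ℤ)
  have hu : Summable u := by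
    refine Summable.of_norm ?_
    simpa [u, norm_smul, fourier_norm, abs_of_nonneg h0] using hs
  let F : C(AddCircle T, ℂ) := ∑' n, u n
  have hF : ∀ t, F t = f (r * fourier 1 t) := fun t => by
    have e1 := (ContinuousMap.evalCLM ℂ t).hasSum hu.hasSum
    refine HasSum.unique e1 ?_
    convert h (r * fourier 1 t) ?_ using 2 with n
    · simp only [u, ContinuousMap.evalCLM_apply, ContinuousMap.smul_apply, mul_pow,
        smul_eq_mul, ← mul_assoc]
      congr 1
      simp [fourier_apply, AddCircle.toCircle_nsmul]
    · simp only [mem_ball, dist_zero_right, norm_mul, Complex.norm_real, Real.norm_eq_abs,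
        abs_of_nonneg h0]
      rw [norm_fourier_one t, mul_one]
      exact h1
  let G := ContinuousMap.toLp (E := ℂ) 2 (AddCircle.haarAddCircle (T := T)) ℂ F
  have hG : ∫⁻ t : AddCircle T, ‖f (r * fourier 1 t)‖ₑ ^ 2 ∂AddCircle.haarAddCircle = ‖G‖ₑ ^ 2 := by
    rw [Lp_enorm_sq]
    refine lintegral_congr_ae ?_
    filter_upwards [ContinuousMap.coeFn_toLp (p := 2) (𝕜 := ℂ) AddCircle.haarAddCircle F] with t ht
    rw [ht, hF]
  have hc : ∀ m : ℤ, HasSum (fun n : ℕ => if (n : ℤ) = m then c n * r ^ n else 0)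
      (fourierCoeff (G : AddCircle T → ℂ) m) := fun m => by
    have e1 : HasSum (fun n => ContinuousMap.toLp (E := ℂ) 2 (AddCircle.haarAddCircle (T := T)) ℂ (u n)) G :=
      ContinuousLinearMap.hasSum _ hu.hasSum
    have e2 := (innerSL ℂ (fourierLp (T := T) 2 m)).hasSum e1
    rw [← fourierBasis_repr, HilbertBasis.repr_apply_apply, coe_fourierBasis]
    convert! e2 using 1
    funext n
    have e3 := orthonormal_iff_ite.1 (orthonormal_fourier (T := T)) m n
    have e4 : ContinuousMap.toLp (E := ℂ) 2 (AddCircle.haarAddCircle (T := T)) ℂ (u n) =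
        (c n * (r : ℂ) ^ n) • fourierLp 2 (n : ℤ) := map_smul _ _ _
    change _ = inner ℂ (fourierLp (T := T) 2 m)
      (ContinuousMap.toLp (E := ℂ) 2 (AddCircle.haarAddCircle (T := T)) ℂ (u n))
    rw [e4, inner_smul_right, e3]
    by_cases hm : (n : ℤ) = m
    · simp [hm]
    · simp [hm, Ne.symm hm]
  rw [hG, ← tsum_enorm_fourierCoeff, tsum_int_of_nonneg]
  · have e : ∀ n : ℕ, HasSum (fun k : ℕ => if (k : ℤ) = n then c k * (r : ℂ) ^ k else 0)
        (c n * (r : ℂ) ^ n) := fun n => by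
      convert! hasSum_ite_eq n (c n * (r : ℂ) ^ n) using 2 with k
      by_cases hk : k = n <;> simp [hk]
    refine tsum_congr fun n => ?_
    rw [(hc n).unique (e n)]
    rw [enorm_mul, mul_pow, enorm_pow, pow_mul', ← ofReal_norm (r : ℂ), Complex.norm_real, Real.norm_of_nonneg h0,
      ← pow_mul]
  · intro n hn
    have : fourierCoeff (G : AddCircle T → ℂ) n = 0 := by
      refine (hc n).unique ?_
      convert hasSum_zero (β := ℕ) using 2 with k
      rw [if_neg (by omega)]
    simp [this]

theorem HasTaylor.hardyNormSq_eq {f : ℂ → ℂ} {c : ℕ → ℂ} (h : HasTaylor f c) :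
    hardyNormSq f = ∑' n, ‖c n‖ₑ ^ 2 := by
  unfold hardyNormSq
  have e : ∀ r ∈ Ico (0 : ℝ) 1, ∫⁻ t : UnitAddCircle, ‖f ((r : ℂ) * circlePt t)‖ₑ ^ 2
      ∂AddCircle.haarAddCircle = ∑' n, ‖c n‖ₑ ^ 2 * ENNReal.ofReal r ^ (2 * n) := fun r hr =>
    h.lintegral_circle hr.1 hr.2
  have e' : (⨆ r ∈ Ico (0 : ℝ) 1, ∫⁻ t : UnitAddCircle, ‖f ((r : ℂ) * circlePt t)‖ₑ ^ 2
      ∂AddCircle.haarAddCircle) =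
      ⨆ r ∈ Ico (0 : ℝ) 1, ∑' n, ‖c n‖ₑ ^ 2 * ENNReal.ofReal r ^ (2 * n) :=
    iSup_congr fun r => iSup_congr fun hr => e r hr
  rw [e']
  apply le_antisymm
  · refine iSup₂_le fun r hr => ENNReal.tsum_le_tsum fun n => ?_
    refine mul_le_of_le_one_right' (pow_le_one' ?_ _)
    simpa using hr.2.le
  · rw [ENNReal.tsum_eq_iSup_sum]
    refine iSup_le fun s => ?_
    -- Each finite partial sum is a limit as `r → 1` of quantities below the supremum, so no
    -- interchange of limit and infinite sum is needed.
    have ht : Filter.Tendsto (fun r : ℝ => ∑ n ∈ s, ‖c n‖ₑ ^ 2 * ENNReal.ofReal r ^ (2 * n))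
        (nhdsWithin 1 (Iio 1)) (nhds (∑ n ∈ s, ‖c n‖ₑ ^ 2)) := by
      refine tendsto_finsetSum _ fun n _ => ?_
      have : Filter.Tendsto (fun r : ℝ => ‖c n‖ₑ ^ 2 * ENNReal.ofReal r ^ (2 * n))
        (nhds 1) (nhds (‖c n‖ₑ ^ 2 * ENNReal.ofReal 1 ^ (2 * n))) := by
        refine ENNReal.Tendsto.const_mul ?_ (by simp)
        exact ENNReal.Tendsto.pow (ENNReal.tendsto_ofReal Filter.tendsto_id)
      simp only [ENNReal.ofReal_one, one_pow, mul_one] at this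
      exact this.mono_left nhdsWithin_le_nhds
    refine le_of_tendsto ht ?_
    have : Ioo (0 : ℝ) 1 ∈ nhdsWithin (1 : ℝ) (Iio 1) := Ioo_mem_nhdsLT (by norm_num)
    filter_upwards [this] with r hr
    refine le_trans (ENNReal.sum_le_tsum s) ?_
    exact le_iSup₂_of_le r ⟨hr.1.le, hr.2⟩ le_rfl

/-! ### Radially weighted area integrals -/

theorem lintegral_diskArea (G : ℂ → ℝ≥0∞) :
    ∫⁻ z, G z ∂diskArea = (ENNReal.ofReal Real.pi)⁻¹ * ∫⁻ z in ball (0 : ℂ) 1, G z := by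
  rw [diskArea, lintegral_smul_measure, smul_eq_mul]

/-- Polar coordinates use the circle of length `2π`, whereas the `H²` norm uses the circle of length
`1`; Parseval's identity above allows any period for this reason. -/
instance fact_two_pi_pos : Fact (0 < 2 * Real.pi) := ⟨Real.two_pi_pos⟩

theorem lintegral_angle (F : ℂ → ℝ≥0∞) (r : ℝ) :
    ∫⁻ θ in Ioo (-Real.pi) Real.pi, F (Complex.polarCoord.symm (r, θ)) =
      ENNReal.ofReal (2 * Real.pi) *
        ∫⁻ t : AddCircle (2 * Real.pi), F (r * fourier 1 t) ∂AddCircle.haarAddCircle := by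
  have e := AddCircle.lintegral_preimage (2 * Real.pi) (-Real.pi) fun t => F (r * fourier 1 t)
  rw [AddCircle.volume_eq_smul_haarAddCircle, lintegral_smul_measure, smul_eq_mul] at e
  rw [← e, show -Real.pi + 2 * Real.pi = Real.pi by ring, Measure.restrict_congr_set Ioo_ae_eq_Ioc]
  refine lintegral_congr fun θ => ?_
  rw [Complex.polarCoord_symm_apply, fourier_coe_apply]
  congr 2
  rw [Complex.ofReal_cos, Complex.ofReal_sin, Complex.cos_add_sin_I]
  congr 1
  have : (Real.pi : ℂ) ≠ 0 := by exact_mod_cast Real.pi_ne_zero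
  push_cast
  field_simp

/-- Polar coordinates, then Parseval on each circle. Tonelli needs `h` measurable on the whole
plane; `HasTaylor.lintegral_radial` removes this assumption by replacing `h` with `0` off the disk.
-/
theorem lintegral_radial_of_measurable {h : ℂ → ℂ} {c : ℕ → ℂ} (hc : HasTaylor h c)
    (hm : Measurable h) {w : ℝ → ℝ≥0∞} (hw : Measurable w) :
    ∫⁻ z, ‖h z‖ₑ ^ 2 * w ‖z‖ ∂diskArea =
      ∑' n, ‖c n‖ₑ ^ 2 * ∫⁻ r in Ioo (0 : ℝ) 1, w r * ENNReal.ofReal (2 * r ^ (2 * n + 1)) := by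
  rw [lintegral_diskArea, ← lintegral_indicator measurableSet_ball,
    ← Complex.lintegral_comp_polarCoord_symm]
  have hmG : Measurable ((ball (0 : ℂ) 1).indicator fun z => ‖h z‖ₑ ^ 2 * w ‖z‖) :=
    ((hm.enorm.pow_const 2).mul (hw.comp measurable_norm)).indicator measurableSet_ball
  have hmp : Measurable fun p : ℝ × ℝ => Complex.polarCoord.symm p := by
    simp_rw [Complex.polarCoord_symm_apply]
    fun_prop
  rw [show polarCoord.target = Ioi (0 : ℝ) ×ˢ Ioo (-Real.pi) Real.pi from rfl,
    Measure.volume_eq_prod, ← Measure.prod_restrict, lintegral_prod]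
  swap
  · exact (Measurable.mul (by fun_prop) (hmG.comp hmp)).aemeasurable
  have e1 : ∀ r ∈ Ioi (0 : ℝ), ∫⁻ θ in Ioo (-Real.pi) Real.pi, ENNReal.ofReal r •
      (ball (0 : ℂ) 1).indicator (fun z => ‖h z‖ₑ ^ 2 * w ‖z‖) (Complex.polarCoord.symm (r, θ)) =
      (Ioo (0 : ℝ) 1).indicator (fun r => ENNReal.ofReal Real.pi *
        ∑' n, ‖c n‖ₑ ^ 2 * (w r * ENNReal.ofReal (2 * r ^ (2 * n + 1)))) r := by
    intro r hr
    have hr0 : 0 < r := hr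
    by_cases hr1 : r < 1
    · rw [indicator_of_mem (show r ∈ Ioo (0 : ℝ) 1 from ⟨hr0, hr1⟩)]
      have e2 : ∀ θ : ℝ, ENNReal.ofReal r • (ball (0 : ℂ) 1).indicator
          (fun z => ‖h z‖ₑ ^ 2 * w ‖z‖) (Complex.polarCoord.symm (r, θ)) =
          (ENNReal.ofReal r * w r) * ‖h (Complex.polarCoord.symm (r, θ))‖ₑ ^ 2 := fun θ => by
        have hn : ‖Complex.polarCoord.symm (r, θ)‖ = r := by
          rw [Complex.norm_polarCoord_symm, abs_of_pos hr0]
        rw [indicator_of_mem (by rw [mem_ball_zero_iff, hn]; exact hr1), hn, smul_eq_mul]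
        ring
      simp_rw [e2]
      rw [lintegral_const_mul _ (by fun_prop), lintegral_angle (fun z => ‖h z‖ₑ ^ 2),
        hc.lintegral_circle hr0.le hr1, ← ENNReal.tsum_mul_left, ← ENNReal.tsum_mul_left,
        ← ENNReal.tsum_mul_left]
      refine tsum_congr fun n => ?_
      rw [ENNReal.ofReal_mul (by norm_num), ENNReal.ofReal_mul (by norm_num),
        ENNReal.ofReal_pow hr0.le]
      ring
    · rw [indicator_of_notMem (fun h => hr1 h.2)]
      rw [lintegral_eq_zero_iff' (by
        exact (Measurable.mul (by fun_prop)
          (hmG.comp (hmp.comp (by fun_prop)))).aemeasurable)]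
      refine Filter.Eventually.of_forall fun θ => ?_
      have hn : ‖Complex.polarCoord.symm (r, θ)‖ = r := by
        rw [Complex.norm_polarCoord_symm, abs_of_pos hr0]
      simp only [Pi.zero_apply]
      rw [indicator_of_notMem (by rw [mem_ball_zero_iff, hn]; exact hr1), smul_zero]
  rw [setLIntegral_congr_fun measurableSet_Ioi e1, lintegral_indicator measurableSet_Ioo,
    Measure.restrict_restrict measurableSet_Ioo,
    show Ioo (0 : ℝ) 1 ∩ Ioi 0 = Ioo 0 1 from inter_eq_left.2 fun x hx => hx.1,
    lintegral_const_mul _ (by fun_prop), ← mul_assoc, ENNReal.inv_mul_cancel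
      (by simpa using Real.pi_pos) (by simp), one_mul, lintegral_tsum fun n => by fun_prop]
  exact tsum_congr fun n => lintegral_const_mul _ (by fun_prop)

theorem lintegral_diskArea_congr {F G : ℂ → ℝ≥0∞} (h : ∀ z ∈ ball (0 : ℂ) 1, F z = G z) :
    ∫⁻ z, F z ∂diskArea = ∫⁻ z, G z ∂diskArea := by
  rw [lintegral_diskArea, lintegral_diskArea, setLIntegral_congr_fun measurableSet_ball h]

/-- Integration of `|h|²` against a radial weight in terms of Taylor coefficients. -/
theorem HasTaylor.lintegral_radial {h : ℂ → ℂ} {c : ℕ → ℂ} (hc : HasTaylor h c)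
    {w : ℝ → ℝ≥0∞} (hw : Measurable w) :
    ∫⁻ z, ‖h z‖ₑ ^ 2 * w ‖z‖ ∂diskArea =
      ∑' n, ‖c n‖ₑ ^ 2 * ∫⁻ r in Ioo (0 : ℝ) 1, w r * ENNReal.ofReal (2 * r ^ (2 * n + 1)) := by
  classical
  have hm : Measurable ((ball (0 : ℂ) 1).piecewise h 0) :=
    hc.differentiableOn.continuousOn.measurable_piecewise continuousOn_const measurableSet_ball
  have he : EqOn ((ball (0 : ℂ) 1).piecewise h 0) h (ball 0 1) := piecewise_eqOn _ _ _
  rw [← lintegral_radial_of_measurable (hc.congr he) hm hw]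
  refine lintegral_diskArea_congr fun z hz => ?_
  rw [he hz]

/-- A nonnegative derivative of a function continuous up to the endpoints is automatically
integrable, which permits the logarithmic singularity at `0` in the moments below. -/
theorem lintegral_ofReal_deriv {F F' : ℝ → ℝ} (hF : ContinuousOn F (Icc 0 1))
    (hd : ∀ x ∈ Ioo (0 : ℝ) 1, HasDerivAt F (F' x) x) (h0 : ∀ x ∈ Ioo (0 : ℝ) 1, 0 ≤ F' x) :
    ∫⁻ x in Ioo (0 : ℝ) 1, ENNReal.ofReal (F' x) = ENNReal.ofReal (F 1 - F 0) := by
  have hi := intervalIntegral.integrableOn_deriv_of_nonneg hF hd h0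
  have e := intervalIntegral.integral_eq_sub_of_hasDerivAt_of_le zero_le_one hF hd
    ((intervalIntegrable_iff_integrableOn_Ioc_of_le zero_le_one).2 hi)
  rw [← e, intervalIntegral.integral_of_le zero_le_one, ← integral_Ioc_eq_integral_Ioo.symm,
    ofReal_integral_eq_lintegral_ofReal (hi.mono_set Ioo_subset_Ioc_self)]
  exact (ae_restrict_iff' measurableSet_Ioo).2 (Filter.Eventually.of_forall h0)

theorem lintegral_one_sub_sq_mul_pow (n : ℕ) :
    ∫⁻ r in Ioo (0 : ℝ) 1, ENNReal.ofReal (1 - r ^ 2) * ENNReal.ofReal (2 * r ^ (2 * n + 1)) =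
      ENNReal.ofReal (1 / ((n + 1) * (n + 2))) := by
  have hd : ∀ x ∈ Ioo (0 : ℝ) 1, HasDerivAt
      (fun x : ℝ => x ^ (2 * n + 2) / (n + 1) - x ^ (2 * n + 4) / (n + 2))
      ((1 - x ^ 2) * (2 * x ^ (2 * n + 1))) x := fun x _ => by
    have h1 := ((hasDerivAt_pow (2 * n + 2) x).div_const (n + 1 : ℝ)).sub
      ((hasDerivAt_pow (2 * n + 4) x).div_const (n + 2 : ℝ))
    refine h1.congr_deriv ?_
    have : (n + 1 : ℝ) ≠ 0 := by positivity
    have : (n + 2 : ℝ) ≠ 0 := by positivity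
    simp only [Nat.add_succ_sub_one]
    push_cast
    field_simp
    ring
  have := lintegral_ofReal_deriv (by fun_prop) hd fun x hx => mul_nonneg
    (by nlinarith [hx.1, hx.2]) (by have := hx.1; positivity)
  rw [setLIntegral_congr_fun measurableSet_Ioo (fun x hx => ENNReal.ofReal_mul
    (by nlinarith [hx.1, hx.2]))] at this
  rw [this]
  congr 1
  have : (n + 1 : ℝ) ≠ 0 := by positivity
  have : (n + 2 : ℝ) ≠ 0 := by positivity
  simp
  field_simp
  ring

theorem lintegral_neg_log_mul_pow (n : ℕ) :
    ∫⁻ r in Ioo (0 : ℝ) 1, ENNReal.ofReal (2 * -Real.log r) *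
      ENNReal.ofReal (2 * r ^ (2 * n + 1)) = ENNReal.ofReal (1 / (n + 1) ^ 2) := by
  have hn : (n + 1 : ℝ) ≠ 0 := by positivity
  -- The antiderivative groups the logarithm as `x * log x`, which is continuous at `0`.
  have hd : ∀ x ∈ Ioo (0 : ℝ) 1, HasDerivAt
      (fun x : ℝ => x ^ (2 * n + 2) / (n + 1) ^ 2 - 2 * (x ^ (2 * n + 1) * (x * Real.log x)) / (n + 1))
      ((2 * -Real.log x) * (2 * x ^ (2 * n + 1))) x := fun x hx => by
    have hx0 : x ≠ 0 := hx.1.ne'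
    have h1 := ((hasDerivAt_pow (2 * n + 2) x).div_const ((n + 1) ^ 2 : ℝ)).sub
      ((((hasDerivAt_pow (2 * n + 1) x).mul
        ((hasDerivAt_id x).mul (Real.hasDerivAt_log hx0))).const_mul 2).div_const (n + 1 : ℝ))
    refine h1.congr_deriv ?_
    simp only [Nat.add_succ_sub_one, id, Nat.add_sub_cancel, Pi.mul_apply]
    push_cast
    field_simp
    ring
  have hc : ContinuousOn (fun x : ℝ => x ^ (2 * n + 2) / (n + 1) ^ 2 -
      2 * (x ^ (2 * n + 1) * (x * Real.log x)) / (n + 1)) (Icc 0 1) := by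
    have := Real.continuous_mul_log
    fun_prop
  have hl : ∀ x ∈ Ioo (0 : ℝ) 1, 0 ≤ 2 * -Real.log x := fun x hx => by
    have := Real.log_nonpos hx.1.le hx.2.le
    linarith
  have := lintegral_ofReal_deriv hc hd fun x hx => mul_nonneg (hl x hx)
    (by have := hx.1; positivity)
  rw [setLIntegral_congr_fun measurableSet_Ioo (fun x hx => ENNReal.ofReal_mul (hl x hx))] at this
  rw [this]
  congr 1
  simp

/-! ### The local Dirichlet integral at a boundary point -/

/-- For `ζ = 1` and `f = a + (z - 1) g` one has `f' / (z - 1) = g' - g / (1 - z)`, whose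
coefficients are `(n + 1) g_{n+1} - s_n` with `s` the partial sums of the coefficients of `g`. The
weights `1 / ((n + 1)(n + 2))` are the moments of `1 - r²`, and with them the difference of the two
sums of squares telescopes to a single remainder. -/
theorem sum_norm_sq_eq_add {g s h : ℕ → ℂ} (hs0 : s 0 = g 0) (hs : ∀ n, s (n + 1) = s n + g (n + 1))
    (hh : ∀ n : ℕ, h n = (n + 1) * g (n + 1) - s n) (N : ℕ) :
    ∑ n ∈ Finset.range (N + 1), ‖g n‖ ^ 2 =
      ∑ n ∈ Finset.range N, ‖h n‖ ^ 2 * (1 / ((n + 1) * (n + 2))) + ‖s N‖ ^ 2 / (N + 1) := by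
  induction N with
  | zero => simp [hs0]
  | succ N ih =>
    rw [Finset.sum_range_succ, ih, Finset.sum_range_succ _ N, hh, hs]
    have h1 : (N + 1 : ℝ) ≠ 0 := by positivity
    have h2 : (N + 2 : ℝ) ≠ 0 := by positivity
    have h3 : (N + 1 + 1 : ℝ) ≠ 0 := by positivity
    have e : ‖((N : ℂ) + 1) * g (N + 1) - s N‖ ^ 2 =
        ((N + 1) * (g (N + 1)).re - (s N).re) ^ 2 + ((N + 1) * (g (N + 1)).im - (s N).im) ^ 2 := by
      rw [← Complex.normSq_eq_norm_sq, Complex.normSq_apply]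
      simp
      ring
    rw [e]
    simp only [← Complex.normSq_eq_norm_sq, Complex.normSq_apply, Complex.add_re, Complex.add_im]
    push_cast
    field_simp
    ring

/-- Cauchy-Schwarz on the terms after index `K` bounds `|s_{K+m} - s_K|²` by `m` times the
square-summable tail; the fixed initial part disappears after division by `N + 1`. -/
theorem tendsto_norm_sum_sq_div {g s : ℕ → ℂ}
    (hs : ∀ n, s (n + 1) = s n + g (n + 1)) (hg : Summable fun n => ‖g n‖ ^ 2) :
    Filter.Tendsto (fun N : ℕ => ‖s N‖ ^ 2 / (N + 1)) Filter.atTop (nhds 0) := by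
  have hb : ∀ K N : ℕ, ‖s (K + N) - s K‖ ^ 2 ≤ N * ∑' n, ‖g (n + (K + 1))‖ ^ 2 := fun K N => by
    have e : s (K + N) - s K = ∑ n ∈ Finset.range N, g (n + (K + 1)) := by
      induction N with
      | zero => simp
      | succ N ih =>
        rw [Finset.sum_range_succ, ← ih, ← add_assoc, hs]
        rw [show K + N + 1 = N + (K + 1) by omega]
        ring
    rw [e]
    calc ‖∑ n ∈ Finset.range N, g (n + (K + 1))‖ ^ 2
        ≤ (∑ n ∈ Finset.range N, ‖g (n + (K + 1))‖) ^ 2 := by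
          gcongr
          exact norm_sum_le _ _
      _ ≤ N * ∑ n ∈ Finset.range N, ‖g (n + (K + 1))‖ ^ 2 := by
          simpa using sq_sum_le_card_mul_sum_sq (s := Finset.range N)
            (f := fun n => ‖g (n + (K + 1))‖)
      _ ≤ _ := by
          gcongr
          exact ((summable_nat_add_iff (K + 1)).2 hg).sum_le_tsum _ fun _ _ => by positivity
  rw [Metric.tendsto_atTop]
  intro ε hε
  obtain ⟨K, hK⟩ := ((tendsto_sum_nat_add fun n => ‖g n‖ ^ 2).comp
    (Filter.tendsto_add_atTop_nat 1)).eventually (gt_mem_nhds (show (0 : ℝ) < ε / 4 by positivity))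
    |>.exists
  obtain ⟨M, hM⟩ := exists_nat_gt (4 * ‖s K‖ ^ 2 / ε)
  refine ⟨K + M, fun N hN => ?_⟩
  obtain ⟨m, rfl⟩ := Nat.exists_eq_add_of_le (le_trans (Nat.le_add_right K M) hN)
  rw [dist_zero_right, Real.norm_of_nonneg (by positivity), div_lt_iff₀ (by positivity)]
  have h1 := hb K m
  have h2 : ‖s (K + m)‖ ^ 2 ≤ 2 * ‖s (K + m) - s K‖ ^ 2 + 2 * ‖s K‖ ^ 2 := by
    have : ‖s (K + m)‖ ≤ ‖s (K + m) - s K‖ + ‖s K‖ := by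
      simpa using norm_add_le (s (K + m) - s K) (s K)
    nlinarith [sq_nonneg (‖s (K + m) - s K‖ - ‖s K‖), norm_nonneg (s (K + m))]
  simp only [Function.comp] at hK
  have h3 : (m : ℝ) * ∑' n, ‖g (n + (K + 1))‖ ^ 2 ≤ m * (ε / 4) := by gcongr
  rw [div_lt_iff₀ hε] at hM
  have h4 : (M : ℝ) ≤ m := by exact_mod_cast (by omega : M ≤ m)
  push_cast
  nlinarith [Nat.cast_nonneg (α := ℝ) K, Nat.cast_nonneg (α := ℝ) m]

theorem hasSum_norm_sq_of_summable {g s h : ℕ → ℂ} (hs0 : s 0 = g 0)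
    (hs : ∀ n, s (n + 1) = s n + g (n + 1)) (hh : ∀ n : ℕ, h n = (n + 1) * g (n + 1) - s n)
    (hg : Summable fun n => ‖g n‖ ^ 2) :
    HasSum (fun n : ℕ => ‖h n‖ ^ 2 * (1 / ((n + 1) * (n + 2)))) (∑' n, ‖g n‖ ^ 2) := by
  rw [hasSum_iff_tendsto_nat_of_nonneg (fun n => by positivity)]
  have h1 := (hg.hasSum.tendsto_sum_nat.comp (Filter.tendsto_add_atTop_nat 1)).sub
    (tendsto_norm_sum_sq_div hs hg)
  rw [sub_zero] at h1
  refine h1.congr fun N => ?_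
  simp only [Function.comp]
  rw [sum_norm_sq_eq_add hs0 hs hh N]
  ring

theorem hasSum_one_div_mul_succ (N : ℕ) :
    HasSum (fun k : ℕ => (1 / ((k + N : ℕ) + 1) / ((k + N : ℕ) + 2) : ℝ)) (1 / (N + 1)) := by
  rw [hasSum_iff_tendsto_nat_of_nonneg (fun n => by positivity)]
  have h1 : Filter.Tendsto (fun M : ℕ => (1 / (N + 1) - 1 / ((M + N : ℕ) + 1) : ℝ)) Filter.atTop
      (nhds (1 / (N + 1) - 0)) :=
    tendsto_const_nhds.sub ((tendsto_one_div_add_atTop_nhds_zero_nat (𝕜 := ℝ)).comp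
      (Filter.tendsto_add_atTop_nat N))
  rw [sub_zero] at h1
  refine h1.congr fun M => ?_
  induction M with
  | zero => simp
  | succ M ih =>
    rw [Finset.sum_range_succ, ← ih]
    push_cast
    have h1 : (N + 1 : ℝ) ≠ 0 := by positivity
    have h2 : (M + N + 1 : ℝ) ≠ 0 := by positivity
    have h3 : (M + N + 2 : ℝ) ≠ 0 := by positivity
    have h4 : (M + 1 + N + 1 : ℝ) ≠ 0 := by positivity
    field_simp
    ring

/-- The recursion is solved by normalizing: for `σ_n = s_n / (n + 1)` it reads `σ_{n+1} - σ_n = h_n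
/ ((n + 1)(n + 2))`. The solution tending to `0` is minus the tail sum. Its decay like `(N +
1)^{-1/2}` keeps the remainder in `sum_norm_sq_eq_add` bounded, which forces `g` to be square
summable. -/
theorem exists_summable_norm_sq {h : ℕ → ℂ}
    (hh : Summable fun n : ℕ => ‖h n‖ ^ 2 * (1 / ((n + 1) * (n + 2)) : ℝ)) :
    ∃ g s : ℕ → ℂ, s 0 = g 0 ∧ (∀ n, s (n + 1) = s n + g (n + 1)) ∧
      (∀ n : ℕ, h n = (n + 1) * g (n + 1) - s n) ∧ Summable fun n => ‖g n‖ ^ 2 := by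
  set q : ℕ → ℝ := fun n : ℕ => ‖h n‖ ^ 2 * (1 / ((n + 1) * (n + 2)) : ℝ) with hq
  let τ : ℕ → ℂ := fun n => h n / ((n + 1) * (n + 2))
  have hτn : ∀ n : ℕ, ‖τ n‖ = ‖h n‖ / ((n + 1) * (n + 2)) := fun n => by
    simp only [τ, norm_div, norm_mul]
    norm_cast
  -- Arithmetic-geometric mean inequality with a free parameter `t`: the value `t = 1` gives
  -- summability, and `t = (N + 1)^{-1/2}` balances the two tails from `N` on.
  have hτ : ∀ (n : ℕ) (t : ℝ), 0 < t →
      ‖τ n‖ ≤ (t * q n + t⁻¹ * (1 / (n + 1) / (n + 2) : ℝ)) / 2 := fun n t ht => by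
    rw [hτn]
    have : 0 ≤ (t * ‖h n‖ - 1) ^ 2 / (2 * t * ((n + 1) * (n + 2))) := by positivity
    have e : (t * ‖h n‖ - 1) ^ 2 / (2 * t * ((n + 1) * (n + 2))) =
      (t * q n + t⁻¹ * (1 / (n + 1) / (n + 2) : ℝ)) / 2 - ‖h n‖ / ((n + 1) * (n + 2)) := by
      have h1 : (n + 1 : ℝ) ≠ 0 := by positivity
      have h2 : (n + 2 : ℝ) ≠ 0 := by positivity
      simp only [hq]
      field_simp
      ring
    linarith
  have hs0 := hasSum_one_div_mul_succ
  have hτs : Summable fun n => ‖τ n‖ := by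
    refine Summable.of_nonneg_of_le (fun n => norm_nonneg _) (fun n => hτ n 1 one_pos) ?_
    exact ((hh.mul_left 1).add ((by simpa using (hs0 0).summable : Summable
      fun n : ℕ => (1 / (n + 1) / (n + 2) : ℝ)).mul_left _)).div_const 2
  let σ : ℕ → ℂ := fun n => -∑' k, τ (k + n)
  have hσ : ∀ n, σ (n + 1) = σ n + τ n := fun n => by
    have := ((summable_nat_add_iff n).2 hτs.of_norm).tsum_eq_zero_add
    simp only [σ]
    rw [this, zero_add]
    simp_rw [add_right_comm, add_assoc]
    ring
  let g : ℕ → ℂ := fun n => (n + 1) * σ n - n * σ (n - 1)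
  refine ⟨g, fun n => (n + 1) * σ n, by simp [g], fun n => ?_, fun n => ?_, ?_⟩
  · simp only [g, Nat.add_sub_cancel]
    push_cast
    ring
  · simp only [g, Nat.add_sub_cancel, hσ, τ]
    have h1 : (n + 1 : ℂ) ≠ 0 := by exact_mod_cast n.succ_ne_zero
    have h2 : (n + 2 : ℂ) ≠ 0 := by exact_mod_cast (by omega : n + 2 ≠ 0)
    push_cast
    field_simp
    ring
  · have hb : ∀ N : ℕ, ‖(N + 1) * σ N‖ ^ 2 / (N + 1) ≤ ((∑' n, q n + 1) / 2) ^ 2 := fun N => by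
      set t : ℝ := (Real.sqrt (N + 1))⁻¹ with ht
      have hN : (0 : ℝ) < N + 1 := by positivity
      have ht0 : 0 < t := by positivity
      have ht2 : t ^ 2 = (N + 1 : ℝ)⁻¹ := by rw [ht, inv_pow, Real.sq_sqrt hN.le]
      have hqN : Summable fun k => q (k + N) := (summable_nat_add_iff N).2 hh
      have h1 : ‖σ N‖ ≤ (t * (∑' k, q (k + N)) + t⁻¹ * (1 / (N + 1))) / 2 := by
        simp only [σ, norm_neg]
        have hd : HasSum (fun k : ℕ => (t * q (k + N) +
          t⁻¹ * (1 / ((k + N : ℕ) + 1) / ((k + N : ℕ) + 2) : ℝ)) / 2)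
          ((t * (∑' k, q (k + N)) + t⁻¹ * (1 / (N + 1))) / 2) :=
          ((hqN.hasSum.mul_left t).add ((hs0 N).mul_left t⁻¹)).div_const 2
        exact tsum_of_norm_bounded hd fun k => hτ _ t ht0
      have h2 : ∑' k, q (k + N) ≤ ∑' n, q n := by
        rw [← hh.sum_add_tsum_nat_add N]
        have : 0 ≤ ∑ n ∈ Finset.range N, q n := Finset.sum_nonneg fun n _ => by
          simp only [hq]; positivity
        linarith
      have h3 : ‖σ N‖ ≤ t * ((∑' n, q n + 1) / 2) := by
        refine h1.trans ?_
        rw [one_div, ← ht2, show t⁻¹ * t ^ 2 = t by field_simp]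
        nlinarith
      have h4 : ‖(N + 1 : ℂ)‖ = N + 1 := by norm_cast
      rw [norm_mul, h4, mul_pow, div_le_iff₀ hN]
      calc ((N : ℝ) + 1) ^ 2 * ‖σ N‖ ^ 2 ≤ ((N : ℝ) + 1) ^ 2 * (t * ((∑' n, q n + 1) / 2)) ^ 2 := by
            gcongr
        _ = _ := by
            rw [mul_pow, ht2]
            field_simp
    refine summable_of_sum_range_le (c := ∑' n, q n + ((∑' n, q n + 1) / 2) ^ 2)
      (fun n => by positivity) fun N => ?_
    refine (Finset.sum_le_sum_of_subset_of_nonneg (Finset.range_subset_range.2 N.le_succ)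
      fun _ _ _ => by positivity).trans ?_
    rw [Nat.succ_eq_add_one, sum_norm_sq_eq_add (g := g) (s := fun n => (n + 1) * σ n) (h := h)]
    · exact add_le_add (hh.sum_le_tsum _ fun n _ => by positivity) (hb N)
    · simp [g]
    · intro n
      simp only [g, Nat.add_sub_cancel]
      push_cast
      ring
    · intro n
      simp only [g, Nat.add_sub_cancel, hσ, τ]
      have h1 : (n + 1 : ℂ) ≠ 0 := by exact_mod_cast n.succ_ne_zero
      have h2 : (n + 2 : ℂ) ≠ 0 := by exact_mod_cast (by omega : n + 2 ≠ 0)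
      push_cast
      field_simp
      ring

theorem summable_norm_sq_iff {c : ℕ → ℂ} :
    (∑' n, ‖c n‖ₑ ^ 2 < ∞) ↔ Summable fun n => ‖c n‖ ^ 2 := by
  simp_rw [← ofReal_norm_sq]
  constructor
  · intro h
    have := ENNReal.summable_toReal h.ne
    simpa [ENNReal.toReal_ofReal] using this
  · intro h
    exact h.tsum_ofReal_lt_top

theorem hasTaylor_of_summable_sq {c : ℕ → ℂ} (hc : Summable fun n => ‖c n‖ ^ 2) :
    HasTaylor (fun z => ∑' n, c n * z ^ n) c := fun z hz => by
  refine Summable.hasSum ?_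
  have h1 : ‖z‖ < 1 := by simpa using hz
  have h2 : Summable fun n => ‖z‖ ^ (2 * n) := by
    simp_rw [pow_mul]
    exact summable_geometric_of_lt_one (by positivity) (by nlinarith [norm_nonneg z])
  refine Summable.of_norm_bounded (hc.add h2) fun n => ?_
  rw [norm_mul, norm_pow, pow_mul']
  nlinarith [sq_nonneg (‖c n‖ - ‖z‖ ^ n), norm_nonneg (c n), pow_nonneg (norm_nonneg z) n]

theorem hasTaylor_const_add_mul {g : ℂ → ℂ} {c : ℕ → ℂ} (hg : HasTaylor g c) (a ζ : ℂ) :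
    HasTaylor (fun z => a + (z - ζ) * g z) fun n =>
      if n = 0 then a - ζ * c 0 else c (n - 1) - ζ * c n := by
  have h := ((HasTaylor.const a).add hg.id_mul).sub (hg.const_mul ζ)
  have e : (fun z => a + (z - ζ) * g z) = fun z => a + z * g z - ζ * g z := by
    funext z; ring
  rw [e]
  convert! h using 1
  funext n
  rcases n with _ | n <;> simp

theorem ne_of_mem_ball {ζ z : ℂ} (hζ : ‖ζ‖ = 1) (hz : z ∈ ball (0 : ℂ) 1) : z - ζ ≠ 0 := fun h => by
  rw [sub_eq_zero] at h
  rw [h, mem_ball_zero_iff, hζ] at hz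
  exact lt_irrefl _ hz

/-- The Taylor coefficients of `f' / (z - ζ)` for a boundary point `ζ` determine the local
Dirichlet integral of `f` at `ζ`. -/
theorem dirichletIntegral_boundary {f : ℂ → ℂ} {c : ℕ → ℂ} (hf : HasTaylor f c) {ζ : ℂ}
    (hζ : ‖ζ‖ = 1) : ∃ h : ℕ → ℂ,
      dirichletIntegral (superharmonicKernel ζ) f =
        ∑' n : ℕ, ‖h n‖ₑ ^ 2 * ENNReal.ofReal (1 / ((n + 1) * (n + 2))) ∧
      c 1 = - ζ * h 0 ∧ ∀ n : ℕ, (n + 2) * c (n + 2) = h n - ζ * h (n + 1) := by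
  have hd : DifferentiableOn ℂ (fun z => deriv f z / (z - ζ)) (ball 0 1) :=
    hf.deriv.differentiableOn.div (by fun_prop) fun z hz => ne_of_mem_ball hζ hz
  obtain ⟨h, hh⟩ := HasTaylor.exists_of_differentiableOn hd
  have he := (hasTaylor_const_add_mul hh 0 ζ).congr (g := deriv f) fun z hz => by
    simp only [zero_add]
    rw [mul_div_cancel₀ _ (ne_of_mem_ball hζ hz)]
  have hu := he.unique hf.deriv
  refine ⟨h, ?_, ?_, fun n => ?_⟩
  · simp_rw [← lintegral_one_sub_sq_mul_pow]
    rw [← hh.lintegral_radial (w := fun r => ENNReal.ofReal (1 - r ^ 2)) (by fun_prop)]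
    refine lintegral_diskArea_congr fun z hz => ?_
    have h0 := ne_of_mem_ball hζ hz
    have hz1 : ‖z‖ < 1 := by simpa using hz
    rw [superharmonicKernel, if_neg (by rw [hζ]; exact lt_irrefl _), ← ofReal_norm_sq,
      ← ofReal_norm_sq, ← ENNReal.ofReal_mul (by positivity), ← ENNReal.ofReal_mul (by positivity),
      norm_div, norm_sub_rev z ζ]
    congr 1
    have : ‖ζ - z‖ ≠ 0 := by rwa [norm_sub_rev, norm_ne_zero_iff]
    field_simp
  · have := congrFun hu 0
    simp at this
    rw [← this]; ring
  · have := congrFun hu (n + 1)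
    simp at this
    rw [this]; ring

theorem tsum_mul_ofReal_eq_tsum {h : ℕ → ℂ} {w : ℕ → ℝ} :
    ∑' n, ‖h n‖ₑ ^ 2 * ENNReal.ofReal (w n) = ∑' n, ENNReal.ofReal (‖h n‖ ^ 2 * w n) :=
  tsum_congr fun n => by rw [← ofReal_norm_sq, ENNReal.ofReal_mul (by positivity)]

/-- Comparing coefficients in `f' = (z - ζ) h` yields only a first-order recursion for `h`; together
with the initial value it determines `h` as in `sum_norm_sq_eq_add`. -/
theorem boundary_recursion_unique {g h s : ℕ → ℂ} (hs0 : s 0 = g 0)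
    (hs : ∀ n, s (n + 1) = s n + g (n + 1))
    (h0 : h 0 = g 1 - g 0) (hh : ∀ n : ℕ, (n + 2) * (g (n + 1) - g (n + 2)) = h n - h (n + 1)) (n : ℕ) :
    h n = (n + 1) * g (n + 1) - s n := by
  induction n with
  | zero => simp [h0, hs0]
  | succ n ih =>
    have := hh n
    rw [ih] at this
    rw [hs]
    push_cast
    linear_combination this

/-- After rotation to `ζ = 1` this is the telescoping identity in the limit. Finiteness of the norm
of `g` is what makes the remainder vanish. -/
theorem local_douglas_boundary {ζ : ℂ} (hζ : ‖ζ‖ = 1) {f g : ℂ → ℂ} {a : ℂ}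
    (hg : DifferentiableOn ℂ g (ball 0 1)) (hfin : hardyNormSq g < ∞)
    (hf : ∀ z ∈ ball (0 : ℂ) 1, f z = a + (z - ζ) * g z) :
    dirichletIntegral (superharmonicKernel ζ) f = hardyNormSq g := by
  obtain ⟨c, hc⟩ := HasTaylor.exists_of_differentiableOn hg
  have hfc := (hasTaylor_const_add_mul hc a ζ).congr hf
  obtain ⟨h, hD, h0, hh⟩ := dirichletIntegral_boundary hfc hζ
  have hζ0 : ζ ≠ 0 := norm_ne_zero_iff.1 (by rw [hζ]; exact one_ne_zero)
  rw [hc.hardyNormSq_eq] at hfin ⊢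
  rw [summable_norm_sq_iff] at hfin
  rw [hD]
  have hn : ∀ n, ‖ζ ^ (n + 1) * c n‖ = ‖c n‖ := fun n => by simp [hζ]
  have hn' : ∀ n, ‖ζ ^ (n + 2) * h n‖ = ‖h n‖ := fun n => by simp [hζ]
  -- The unimodular factors `ζ^(n+1)` and `ζ^(n+2)` perform the rotation without changing any
  -- modulus.
  have key := hasSum_norm_sq_of_summable (g := fun n => ζ ^ (n + 1) * c n)
    (s := fun n => ∑ k ∈ Finset.range (n + 1), ζ ^ (k + 1) * c k)
    (h := fun n => ζ ^ (n + 2) * h n) (by simp) (fun n => Finset.sum_range_succ _ _) (fun n =>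
      boundary_recursion_unique (g := fun n => ζ ^ (n + 1) * c n)
    (s := fun n => ∑ k ∈ Finset.range (n + 1), ζ ^ (k + 1) * c k)
    (h := fun n => ζ ^ (n + 2) * h n) (by simp) (fun n => Finset.sum_range_succ _ _)
      (by
        simp at h0 ⊢
        linear_combination ζ * h0)
      (fun n => by
        have := hh n
        simp at this
        linear_combination ζ ^ (n + 2) * this) n)
    (by simpa only [hn] using hfin)
  simp only [hn, hn'] at key
  rw [tsum_mul_ofReal_eq_tsum,
    ← ENNReal.ofReal_tsum_of_nonneg (fun n => by positivity) key.summable, key.tsum_eq,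
    ENNReal.ofReal_tsum_of_nonneg (fun n => by positivity) hfin]
  simp_rw [ofReal_norm_sq]

/-- There is no value `f ζ` to subtract a priori. The quotient `g` is instead built from the
coefficients of `f' / (z - ζ)`, and the constant `a` comes out of the construction. -/
theorem exists_of_local_lt_top_boundary {ζ : ℂ} (hζ : ‖ζ‖ = 1) {f : ℂ → ℂ}
    (hf : DifferentiableOn ℂ f (ball 0 1))
    (hfin : dirichletIntegral (superharmonicKernel ζ) f < ∞) :
    ∃ (a : ℂ) (g : ℂ → ℂ), DifferentiableOn ℂ g (ball 0 1) ∧ hardyNormSq g < ∞ ∧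
      ∀ z ∈ ball (0 : ℂ) 1, f z = a + (z - ζ) * g z := by
  obtain ⟨c, hc⟩ := HasTaylor.exists_of_differentiableOn hf
  obtain ⟨h, hD, h0, hh⟩ := dirichletIntegral_boundary hc hζ
  have hζ0 : ζ ≠ 0 := norm_ne_zero_iff.1 (by rw [hζ]; exact one_ne_zero)
  have hn' : ∀ n, ‖ζ ^ (n + 2) * h n‖ = ‖h n‖ := fun n => by simp [hζ]
  rw [hD, tsum_mul_ofReal_eq_tsum] at hfin
  have hs : Summable fun n : ℕ => ‖h n‖ ^ 2 * (1 / ((n + 1) * (n + 2)) : ℝ) := by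
    have := ENNReal.summable_toReal hfin.ne
    refine this.congr fun n => ENNReal.toReal_ofReal (by positivity)
  obtain ⟨g, s, hs0, hs1, hg, hgs⟩ := exists_summable_norm_sq (h := fun n => ζ ^ (n + 2) * h n)
    (by simpa only [hn'] using hs)
  have hn : ∀ n, ‖ζ⁻¹ ^ (n + 1) * g n‖ = ‖g n‖ := fun n => by simp [hζ]
  have hgs' : Summable fun n => ‖ζ⁻¹ ^ (n + 1) * g n‖ ^ 2 := by simpa only [hn] using hgs
  have hG := hasTaylor_of_summable_sq hgs'
  -- With the rotation undone, the constant coefficient of `a + (z - ζ) G` is `a - ζ ζ⁻¹ g_0`, so `a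
  -- = c_0 + g_0` is forced.
  refine ⟨c 0 + g 0, _, hG.differentiableOn, ?_, ?_⟩
  · rw [hG.hardyNormSq_eq]
    exact summable_norm_sq_iff.2 hgs'
  · have h2 := hasTaylor_const_add_mul hG (c 0 + g 0) ζ
    refine HasTaylor.eqOn (c := c) hc ?_
    convert! h2 using 1
    have hp : ∀ n, ζ ^ n * ζ⁻¹ ^ n = 1 := fun n => by
      rw [← mul_pow, mul_inv_cancel₀ hζ0, one_pow]
    funext n
    rcases n with _ | _ | n
    · simp [hζ0]
    · have e := hg 0
      simp only [hs0] at e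
      simp at e ⊢
      rw [h0]
      field_simp
      linear_combination -e
    · have e := hh n
      have e1 := hg n
      have e2 := hg (n + 1)
      simp only [hs1] at e2
      have h3 : (n + 2 : ℂ) ≠ 0 := by exact_mod_cast (by omega : n + 2 ≠ 0)
      simp only [Nat.add_eq_zero_iff, one_ne_zero, and_false, and_self, if_false,
        Nat.add_sub_cancel]
      refine mul_left_cancel₀ h3 ?_
      refine mul_left_cancel₀ (pow_ne_zero (n + 2) hζ0) ?_
      push_cast at e2
      have p1 := hp (n + 2)
      have p2 : ζ * ζ⁻¹ = 1 := mul_inv_cancel₀ hζ0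
      have e4 : ζ * ζ⁻¹ ^ (n + 1 + 1 + 1) = ζ⁻¹ ^ (n + 2) := by
        rw [show n + 1 + 1 + 1 = (n + 2) + 1 by ring, pow_succ' ζ⁻¹ (n + 2), ← mul_assoc, p2, one_mul]
      rw [show n + 1 + 1 = n + 2 by ring] at *
      rw [← mul_assoc ζ, e4]
      linear_combination (ζ ^ (n + 2)) * e + e1 - e2 - (n + 2) * (g (n + 1) - g (n + 2)) * p1

/-! ### Integrals over the circle -/

theorem continuous_circlePt : Continuous circlePt := (fourier 1).continuous

theorem norm_circlePt (t : UnitAddCircle) : ‖circlePt t‖ = 1 := norm_fourier_one t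

theorem integral_circlePt {E : Type*} [NormedAddCommGroup E] [NormedSpace ℝ E] (F : ℂ → E) :
    ∫ t : UnitAddCircle, F (circlePt t) ∂AddCircle.haarAddCircle = Real.circleAverage F 0 1 := by
  have h := UnitAddCircle.intervalIntegral_preimage 0 (fun t : UnitAddCircle => F (circlePt t))
  have hv : (volume : Measure UnitAddCircle) = AddCircle.haarAddCircle := by
    rw [AddCircle.volume_eq_smul_haarAddCircle, ENNReal.ofReal_one, one_smul]
  rw [hv] at h
  rw [← h, Real.circleAverage_def]
  have e := intervalIntegral.smul_integral_comp_mul_left (a := 0) (b := 1)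
    (fun θ => F (circleMap 0 1 θ)) (2 * Real.pi)
  rw [mul_zero, mul_one] at e
  rw [← e, smul_smul, inv_mul_cancel₀ Real.two_pi_pos.ne', one_smul, zero_add]
  refine intervalIntegral.integral_congr fun x _ => ?_
  simp only [circlePt, fourier_coe_apply, circleMap]
  congr 1
  push_cast
  simp
  congr 1
  ring

theorem integral_poissonKernel {k : ℂ → ℂ} (hk : DiffContOnCl ℂ k (ball 0 1)) {ζ : ℂ}
    (hζ : ζ ∈ ball (0 : ℂ) 1) :
    ∫ t : UnitAddCircle, ((1 - ‖ζ‖ ^ 2) / ‖circlePt t - ζ‖ ^ 2) • k (circlePt t)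
      ∂AddCircle.haarAddCircle = k ζ := by
  rw [← hk.circleAverage_poissonKernel_smul' hζ, ← integral_circlePt]
  refine integral_congr_ae (Filter.Eventually.of_forall fun t => ?_)
  simp [norm_circlePt]

/-- Parseval at radius `ρ` for the dilate `k (z / ρ)` is Parseval on the unit circle for `k`, so no
boundary limits are involved. -/
theorem hardyNormSq_eq_lintegral {k : ℂ → ℂ} {ρ : ℝ} (h0 : 0 < ρ) (h1 : ρ < 1)
    (hk : DifferentiableOn ℂ k (ball 0 ρ⁻¹)) :
    hardyNormSq k = ∫⁻ t, ‖k (circlePt t)‖ₑ ^ 2 ∂AddCircle.haarAddCircle := by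
  have hm : ∀ z ∈ ball (0 : ℂ) 1, ((ρ⁻¹ : ℝ) : ℂ) * z ∈ ball (0 : ℂ) ρ⁻¹ := fun z hz => by
    rw [mem_ball_zero_iff] at hz ⊢
    rw [norm_mul, Complex.norm_real, Real.norm_of_nonneg (by positivity)]
    have : 0 < ρ⁻¹ := by positivity
    nlinarith
  have hd : DifferentiableOn ℂ (fun z => k (((ρ⁻¹ : ℝ) : ℂ) * z)) (ball 0 1) :=
    hk.comp (by fun_prop) hm
  obtain ⟨c, hc⟩ := HasTaylor.exists_of_differentiableOn hd
  have hc' : HasTaylor k fun n => c n * (ρ : ℂ) ^ n := fun z hz => by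
    have := hc ((ρ : ℂ) * z) (by
      rw [mem_ball_zero_iff] at hz ⊢
      rw [norm_mul, Complex.norm_real, Real.norm_of_nonneg h0.le]
      nlinarith [norm_nonneg z])
    change HasSum _ (k (((ρ⁻¹ : ℝ) : ℂ) * ((ρ : ℂ) * z))) at this
    rw [← mul_assoc] at this
    have e : ((ρ⁻¹ : ℝ) : ℂ) * (ρ : ℂ) = 1 := by
      rw [← Complex.ofReal_mul, inv_mul_cancel₀ h0.ne', Complex.ofReal_one]
    rw [e, one_mul] at this
    simpa [mul_pow, mul_assoc] using this
  rw [hc'.hardyNormSq_eq]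
  have := hc.lintegral_circle (T := 1) h0.le h1
  have e : ∀ t : UnitAddCircle, ((ρ⁻¹ : ℝ) : ℂ) * (ρ * fourier 1 t) = circlePt t := fun t => by
    rw [← mul_assoc, ← Complex.ofReal_mul, inv_mul_cancel₀ h0.ne', Complex.ofReal_one, one_mul]
    rfl
  simp_rw [e] at this
  rw [this]
  refine tsum_congr fun n => ?_
  rw [enorm_mul, mul_pow, enorm_pow, ← ofReal_norm (ρ : ℂ), Complex.norm_real,
    Real.norm_of_nonneg h0.le, ← pow_mul, mul_comm n 2]

/-! ### Disk automorphisms -/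

/-- The involutive automorphism of the disk exchanging `0` and `ζ`. -/
def diskAut (ζ w : ℂ) : ℂ := (ζ - w) / (1 - conj ζ * w)

section

variable {ζ w : ℂ}

theorem one_sub_conj_mul_ne_zero (h : ‖ζ‖ * ‖w‖ < 1) : 1 - conj ζ * w ≠ 0 := fun h0 => by
  rw [sub_eq_zero] at h0
  have := congrArg norm h0
  rw [norm_mul, RCLike.norm_conj, norm_one] at this
  linarith

theorem norm_mul_lt (hζ : ‖ζ‖ < 1) (hw : w ∈ ball (0 : ℂ) 1) : ‖ζ‖ * ‖w‖ < 1 := by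
  have : ‖w‖ < 1 := by simpa using hw
  nlinarith [norm_nonneg ζ, norm_nonneg w]

theorem conj_mul_self_eq (ζ : ℂ) : conj ζ * ζ = ((‖ζ‖ ^ 2 : ℝ) : ℂ) := by
  rw [mul_comm, Complex.mul_conj, Complex.normSq_eq_norm_sq]

theorem one_sub_norm_sq_pos (hζ : ‖ζ‖ < 1) : 0 < 1 - ‖ζ‖ ^ 2 := by nlinarith [norm_nonneg ζ]

theorem one_sub_conj_mul_self_ne_zero (hζ : ‖ζ‖ < 1) : 1 - conj ζ * ζ ≠ 0 :=
  one_sub_conj_mul_ne_zero (by nlinarith [norm_nonneg ζ])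

theorem normSq_one_sub_sub (ζ w : ℂ) :
    ‖1 - conj ζ * w‖ ^ 2 - ‖ζ - w‖ ^ 2 = (1 - ‖ζ‖ ^ 2) * (1 - ‖w‖ ^ 2) := by
  simp only [← Complex.normSq_eq_norm_sq, Complex.normSq_apply]
  simp
  ring

theorem diskAut_mem_ball (hζ : ‖ζ‖ < 1) (hw : w ∈ ball (0 : ℂ) 1) :
    diskAut ζ w ∈ ball (0 : ℂ) 1 := by
  have h := one_sub_conj_mul_ne_zero (norm_mul_lt hζ hw)
  have hw' : ‖w‖ < 1 := by simpa using hw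
  rw [mem_ball_zero_iff, diskAut, norm_div, div_lt_one (norm_pos_iff.2 h)]
  have := normSq_one_sub_sub ζ w
  have h2 := mul_pos (one_sub_norm_sq_pos hζ) (one_sub_norm_sq_pos hw')
  exact lt_of_pow_lt_pow_left₀ 2 (norm_nonneg _) (by linarith)

theorem norm_diskAut_of_norm_eq_one (hζ : ‖ζ‖ < 1) (hw : ‖w‖ = 1) : ‖diskAut ζ w‖ = 1 := by
  have h := one_sub_conj_mul_ne_zero (ζ := ζ) (w := w) (by rw [hw, mul_one]; exact hζ)
  have := normSq_one_sub_sub ζ w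
  rw [hw] at this
  rw [diskAut, norm_div, div_eq_one_iff_eq (norm_ne_zero_iff.2 h)]
  exact (pow_left_inj₀ (norm_nonneg _) (norm_nonneg _) two_ne_zero).1 (by linarith)

theorem one_sub_conj_mul_diskAut (h : 1 - conj ζ * w ≠ 0) :
    1 - conj ζ * diskAut ζ w = (1 - conj ζ * ζ) / (1 - conj ζ * w) := by
  rw [diskAut]
  field_simp
  ring

theorem diskAut_sub (h : 1 - conj ζ * w ≠ 0) :
    diskAut ζ w - ζ = -(1 - conj ζ * ζ) * w / (1 - conj ζ * w) := by
  rw [diskAut]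
  rw [div_sub' h, div_left_inj' h]
  ring

theorem diskAut_diskAut (hζ : ‖ζ‖ < 1) (h : 1 - conj ζ * w ≠ 0) : diskAut ζ (diskAut ζ w) = w := by
  have h2 := one_sub_conj_mul_self_ne_zero hζ
  conv_lhs => rw [diskAut]
  rw [one_sub_conj_mul_diskAut h, ← neg_sub, diskAut_sub h, ← neg_div, neg_mul, neg_neg,
    div_div_div_cancel_right₀ h, mul_div_cancel_left₀ _ h2]

theorem hasDerivAt_diskAut (h : 1 - conj ζ * w ≠ 0) :
    HasDerivAt (diskAut ζ) (-(1 - conj ζ * ζ) / (1 - conj ζ * w) ^ 2) w := by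
  have h1 : HasDerivAt (fun w => ζ - w) (-1) w := by simpa using (hasDerivAt_id w).const_sub ζ
  have h2 : HasDerivAt (fun w => 1 - conj ζ * w) (-(conj ζ)) w := by
    simpa using ((hasDerivAt_id w).const_mul (conj ζ)).const_sub 1
  refine (h1.div h2 h).congr_deriv ?_
  congr 1
  ring

theorem image_diskAut (hζ : ‖ζ‖ < 1) : diskAut ζ '' ball 0 1 = ball 0 1 := by
  apply Subset.antisymm
  · rintro _ ⟨w, hw, rfl⟩
    exact diskAut_mem_ball hζ hw
  · exact fun w hw => ⟨diskAut ζ w, diskAut_mem_ball hζ hw,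
      diskAut_diskAut hζ (one_sub_conj_mul_ne_zero (norm_mul_lt hζ hw))⟩

theorem injOn_diskAut (hζ : ‖ζ‖ < 1) : InjOn (diskAut ζ) (ball 0 1) := fun w hw v hv h => by
  rw [← diskAut_diskAut hζ (one_sub_conj_mul_ne_zero (norm_mul_lt hζ hw)), h,
    diskAut_diskAut hζ (one_sub_conj_mul_ne_zero (norm_mul_lt hζ hv))]

/-- The real determinant of multiplication by `a` is the algebra norm of `a` for `ℂ` over `ℝ`; this
supplies the Jacobian of a holomorphic map. -/
theorem det_restrictScalars_toSpanSingleton (a : ℂ) :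
    ((ContinuousLinearMap.toSpanSingleton ℂ a).restrictScalars ℝ).det = ‖a‖ ^ 2 := by
  rw [ContinuousLinearMap.det, ← Complex.normSq_eq_norm_sq, ← Algebra.norm_complex_apply,
    Algebra.norm_apply]
  congr 1
  ext
  simp [mul_comm]

/-- Change of variables in area integrals under a disk automorphism. -/
theorem lintegral_diskAut (hζ : ‖ζ‖ < 1) (G : ℂ → ℝ≥0∞) :
    ∫⁻ z, G z ∂diskArea =
      ∫⁻ w, ‖-(1 - conj ζ * ζ) / (1 - conj ζ * w) ^ 2‖ₑ ^ 2 * G (diskAut ζ w) ∂diskArea := by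
  rw [lintegral_diskArea, lintegral_diskArea]
  congr 1
  conv_lhs => rw [← image_diskAut hζ]
  rw [lintegral_image_eq_lintegral_abs_det_fderiv_mul volume measurableSet_ball
    (f' := fun w => (ContinuousLinearMap.toSpanSingleton ℂ
      (-(1 - conj ζ * ζ) / (1 - conj ζ * w) ^ 2)).restrictScalars ℝ) ?_ (injOn_diskAut hζ)]
  · refine lintegral_congr fun w => ?_
    rw [det_restrictScalars_toSpanSingleton, abs_of_nonneg (by positivity), ofReal_norm_sq]
  · intro w hw
    exact ((hasDerivAt_diskAut (one_sub_conj_mul_ne_zero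
      (norm_mul_lt hζ hw))).hasFDerivAt.restrictScalars ℝ).hasFDerivWithinAt

theorem differentiableOn_diskAut (hζ : ‖ζ‖ < 1) : DifferentiableOn ℂ (diskAut ζ) (ball 0 1) :=
  fun _ hw => (hasDerivAt_diskAut (one_sub_conj_mul_ne_zero
    (norm_mul_lt hζ hw))).differentiableAt.differentiableWithinAt

/-- The local Dirichlet integral at an interior point by conformal invariance. -/
theorem dirichletIntegral_interior (hζ : ‖ζ‖ < 1) {f : ℂ → ℂ}
    (hf : DifferentiableOn ℂ f (ball 0 1)) {c : ℕ → ℂ}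
    (hc : HasTaylor (fun w => f (diskAut ζ w)) c) :
    dirichletIntegral (superharmonicKernel ζ) f =
      ENNReal.ofReal (1 / (1 - ‖ζ‖ ^ 2)) * ∑' n, ‖c (n + 1)‖ₑ ^ 2 := by
  have hp := one_sub_norm_sq_pos hζ
  -- The moment `1 / (n + 1)²` of the weight `-2 log r` cancels the factor produced by
  -- differentiation: this is the Littlewood-Paley identity for `f ∘ diskAut ζ`.
  have e : ∀ n : ℕ, ‖c (n + 1)‖ₑ ^ 2 = ‖(n + 1) * c (n + 1)‖ₑ ^ 2 *
      ENNReal.ofReal (1 / (n + 1) ^ 2) := fun n => by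
    rw [← ofReal_norm_sq, ← ofReal_norm_sq, ← ENNReal.ofReal_mul (by positivity), norm_mul, mul_pow]
    congr 1
    have : ‖(n + 1 : ℂ)‖ = n + 1 := by norm_cast
    rw [this]
    have : (n + 1 : ℝ) ≠ 0 := by positivity
    field_simp
  simp_rw [e, ← lintegral_neg_log_mul_pow]
  rw [← hc.deriv.lintegral_radial (w := fun r => ENNReal.ofReal (2 * -Real.log r)) (by fun_prop),
    dirichletIntegral, lintegral_diskAut hζ, ← lintegral_const_mul' _ _ ENNReal.ofReal_ne_top]
  rw [lintegral_diskArea, lintegral_diskArea]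
  congr 1
  refine setLIntegral_congr_fun_ae measurableSet_ball ?_
  -- The point `w = 0` corresponds to `z = ζ`, where the kernel is `∞` but the convention `log 0 =
  -- 0` makes the radial weight `0`; it is a null set.
  have h0 : ∀ᵐ w : ℂ, w ≠ 0 := by
    simp [ae_iff]
  filter_upwards [h0] with w hw0 hw
  have h1 := one_sub_conj_mul_ne_zero (norm_mul_lt hζ hw)
  have hφ := diskAut_mem_ball hζ hw
  have hd : deriv (fun w => f (diskAut ζ w)) w =
      deriv f (diskAut ζ w) * (-(1 - conj ζ * ζ) / (1 - conj ζ * w) ^ 2) :=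
    ((hf.differentiableAt (isOpen_ball.mem_nhds hφ)).hasDerivAt.comp w (hasDerivAt_diskAut h1)).deriv
  have hne : diskAut ζ w ≠ ζ := fun h => by
    have := diskAut_sub h1
    rw [h, sub_self, eq_comm, div_eq_zero_iff, mul_eq_zero, neg_eq_zero] at this
    rcases this with (h | h) | h
    · exact one_sub_conj_mul_self_ne_zero hζ h
    · exact hw0 h
    · exact h1 h
  have hk : superharmonicKernel ζ (diskAut ζ w) =
      ENNReal.ofReal (1 / (1 - ‖ζ‖ ^ 2)) * ENNReal.ofReal (2 * -Real.log ‖w‖) := by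
    rw [superharmonicKernel, if_pos hζ, if_neg hne, ← ENNReal.ofReal_mul (by positivity)]
    have : (1 - conj ζ * diskAut ζ w) / (ζ - diskAut ζ w) = w⁻¹ := by
      rw [← inv_inj, inv_div, inv_inv]
      exact diskAut_diskAut hζ h1
    rw [this, norm_inv, Real.log_inv]
    congr 1
    ring
  rw [hd, hk, enorm_mul, mul_pow]
  ring

/-! ### The unitary weighted composition operator on the Hardy space -/

/-- Composition with the disk automorphism, multiplied by `1 / (1 - ζ̄ w)`. -/
def weightedComp (ζ : ℂ) (g : ℂ → ℂ) (w : ℂ) : ℂ := g (diskAut ζ w) / (1 - conj ζ * w)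

theorem differentiableOn_weightedComp (hζ : ‖ζ‖ < 1) {g : ℂ → ℂ}
    (hg : DifferentiableOn ℂ g (ball 0 1)) :
    DifferentiableOn ℂ (weightedComp ζ g) (ball 0 1) :=
  (hg.comp (differentiableOn_diskAut hζ) fun _ hw => diskAut_mem_ball hζ hw).div (by fun_prop)
    fun _ hw => one_sub_conj_mul_ne_zero (norm_mul_lt hζ hw)

theorem weightedComp_weightedComp (hζ : ‖ζ‖ < 1) (g : ℂ → ℂ) (hw : w ∈ ball (0 : ℂ) 1) :
    weightedComp ζ (weightedComp ζ g) w = (1 - conj ζ * ζ)⁻¹ * g w := by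
  have h1 := one_sub_conj_mul_ne_zero (norm_mul_lt hζ hw)
  have h2 := one_sub_conj_mul_self_ne_zero hζ
  rw [weightedComp, weightedComp, diskAut_diskAut hζ h1, one_sub_conj_mul_diskAut h1]
  field_simp

/-- The powers of `diskAut ζ` are orthonormal for the harmonic measure at `ζ`. The induction peels
off the constant term: since `|diskAut ζ| = 1` on the circle, `|c_0 + φ q|² = |q|² + Re (|c_0|² + 2
c̄_0 φ q)` with `φ = diskAut ζ`, and the Poisson integral evaluates the holomorphic function at `ζ`,
where `φ` vanishes. -/
theorem integral_poissonKernel_mul_sum (hζ : ‖ζ‖ < 1) (N : ℕ) (c : ℕ → ℂ) :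
    ∫ t : UnitAddCircle, ((1 - ‖ζ‖ ^ 2) / ‖circlePt t - ζ‖ ^ 2) *
      ‖∑ n ∈ Finset.range N, c n * diskAut ζ (circlePt t) ^ n‖ ^ 2 ∂AddCircle.haarAddCircle =
      ∑ n ∈ Finset.range N, ‖c n‖ ^ 2 := by
  have hne : ∀ t : UnitAddCircle, ‖circlePt t - ζ‖ ^ 2 ≠ 0 := fun t h => by
    have : circlePt t = ζ := by simpa [sub_eq_zero] using h
    rw [← this, norm_circlePt] at hζ
    exact lt_irrefl _ hζ
  have hne' : ∀ t : UnitAddCircle, 1 - conj ζ * circlePt t ≠ 0 := fun t =>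
    one_sub_conj_mul_ne_zero (by rwa [norm_circlePt, mul_one])
  have hP : Continuous fun t : UnitAddCircle => (1 - ‖ζ‖ ^ 2) / ‖circlePt t - ζ‖ ^ 2 :=
    continuous_const.div (by have := continuous_circlePt; fun_prop) hne
  have hφ : Continuous fun t : UnitAddCircle => diskAut ζ (circlePt t) := by
    have := continuous_circlePt
    exact Continuous.div (by fun_prop) (by fun_prop) hne'
  have hζm : ζ ∈ ball (0 : ℂ) 1 := by simpa using hζ
  have hcl : DiffContOnCl ℂ (diskAut ζ) (ball 0 1) := by
    refine DifferentiableOn.diffContOnCl fun w hw => ?_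
    rw [closure_ball _ one_ne_zero, mem_closedBall_zero_iff] at hw
    refine (hasDerivAt_diskAut (one_sub_conj_mul_ne_zero ?_)).differentiableAt.differentiableWithinAt
    nlinarith [norm_nonneg ζ, norm_nonneg w]
  have hi : ∀ {E : Type} [NormedAddCommGroup E] {F : UnitAddCircle → E}, Continuous F →
      Integrable F AddCircle.haarAddCircle := fun hF =>
    hF.integrable_of_hasCompactSupport (HasCompactSupport.of_compactSpace _)
  induction N generalizing c with
  | zero => simp
  | succ N ih =>
    set q : ℂ → ℂ := fun w => ∑ n ∈ Finset.range N, c (n + 1) * diskAut ζ w ^ n with hq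
    have hqc : Continuous fun t : UnitAddCircle => q (circlePt t) := by
      simp only [hq]; fun_prop
    have e : ∀ t : UnitAddCircle, ((1 - ‖ζ‖ ^ 2) / ‖circlePt t - ζ‖ ^ 2) *
        ‖∑ n ∈ Finset.range (N + 1), c n * diskAut ζ (circlePt t) ^ n‖ ^ 2 =
        ((1 - ‖ζ‖ ^ 2) / ‖circlePt t - ζ‖ ^ 2) * ‖q (circlePt t)‖ ^ 2 +
        (((1 - ‖ζ‖ ^ 2) / ‖circlePt t - ζ‖ ^ 2) • ((‖c 0‖ ^ 2 : ℝ) + 2 * conj (c 0) *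
          (diskAut ζ (circlePt t) * q (circlePt t)) : ℂ)).re := fun t => by
      have e1 : ∑ n ∈ Finset.range (N + 1), c n * diskAut ζ (circlePt t) ^ n =
          c 0 + diskAut ζ (circlePt t) * q (circlePt t) := by
        rw [Finset.sum_range_succ', hq, Finset.mul_sum, add_comm]
        simp only [pow_zero, mul_one]
        congr 1
        exact Finset.sum_congr rfl fun n _ => by ring
      have e2 : ‖c 0 + diskAut ζ (circlePt t) * q (circlePt t)‖ ^ 2 = ‖q (circlePt t)‖ ^ 2 +
          ((‖c 0‖ ^ 2 : ℝ) + 2 * conj (c 0) *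
          (diskAut ζ (circlePt t) * q (circlePt t)) : ℂ).re := by
        have e3 : ‖q (circlePt t)‖ = ‖diskAut ζ (circlePt t) * q (circlePt t)‖ := by
          rw [norm_mul, norm_diskAut_of_norm_eq_one hζ (norm_circlePt t), one_mul]
        rw [e3]
        simp only [← Complex.normSq_eq_norm_sq, Complex.normSq_apply, Complex.add_re,
          Complex.add_im]
        simp
        ring
      rw [e1, e2, Complex.smul_re, smul_eq_mul]
      ring
    have hk : DiffContOnCl ℂ (fun w => ((‖c 0‖ ^ 2 : ℝ) + 2 * conj (c 0) *
          (diskAut ζ w * q w) : ℂ)) (ball 0 1) := by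
      constructor
      · have := hcl.differentiableOn
        simp only [hq]; fun_prop
      · have := hcl.continuousOn
        simp only [hq]; fun_prop
    have hS : Continuous fun t : UnitAddCircle => ((1 - ‖ζ‖ ^ 2) / ‖circlePt t - ζ‖ ^ 2) •
        ((‖c 0‖ ^ 2 : ℝ) + 2 * conj (c 0) * (diskAut ζ (circlePt t) * q (circlePt t)) : ℂ) :=
      hP.smul (continuous_const.add (continuous_const.mul (hφ.mul hqc)))
    simp_rw [e]
    have h1 : Continuous fun t : UnitAddCircle =>
        ((1 - ‖ζ‖ ^ 2) / ‖circlePt t - ζ‖ ^ 2) * ‖q (circlePt t)‖ ^ 2 := hP.mul (hqc.norm.pow 2)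
    have h2 : Continuous fun t : UnitAddCircle => (((1 - ‖ζ‖ ^ 2) / ‖circlePt t - ζ‖ ^ 2) •
        ((‖c 0‖ ^ 2 : ℝ) + 2 * conj (c 0) * (diskAut ζ (circlePt t) * q (circlePt t)) : ℂ)).re :=
      Complex.continuous_re.comp hS
    rw [integral_add (hi h1) (hi h2), ih (fun n => c (n + 1))]
    have e4 := integral_poissonKernel hk hζm
    have e5 := integral_re (μ := AddCircle.haarAddCircle) (𝕜 := ℂ)
      (f := fun t : UnitAddCircle => ((1 - ‖ζ‖ ^ 2) / ‖circlePt t - ζ‖ ^ 2) •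
        ((‖c 0‖ ^ 2 : ℝ) + 2 * conj (c 0) * (diskAut ζ (circlePt t) * q (circlePt t)) : ℂ))
      (hi hS)
    simp only [RCLike.re_to_complex] at e5
    rw [e5, e4, Finset.sum_range_succ']
    have : diskAut ζ ζ = 0 := by simp [diskAut]
    rw [this, zero_mul, mul_zero, add_zero, Complex.ofReal_re]

/-- On the circle `|1 - ζ̄ w| = |w - ζ|`, so the factor `1 / (1 - ζ̄ w)` contributes exactly the
Poisson kernel once multiplied by `1 - |ζ|²`. -/
theorem hardyNormSq_weightedComp_sum (hζ : ‖ζ‖ < 1) (N : ℕ) (c : ℕ → ℂ) :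
    ENNReal.ofReal (1 - ‖ζ‖ ^ 2) *
      hardyNormSq (weightedComp ζ fun z => ∑ n ∈ Finset.range N, c n * z ^ n) =
      ∑ n ∈ Finset.range N, ‖c n‖ₑ ^ 2 := by
  have hp := one_sub_norm_sq_pos hζ
  have hne : ∀ t : UnitAddCircle, ‖circlePt t - ζ‖ ^ 2 ≠ 0 := fun t h => by
    have : circlePt t = ζ := by simpa [sub_eq_zero] using h
    rw [← this, norm_circlePt] at hζ
    exact lt_irrefl _ hζ
  have hne' : ∀ t : UnitAddCircle, 1 - conj ζ * circlePt t ≠ 0 := fun t =>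
    one_sub_conj_mul_ne_zero (by rwa [norm_circlePt, mul_one])
  -- The radius `2 / (1 + |ζ|)` exceeds `1` and stays inside the zero `1 / ζ̄` of the denominator.
  have hρ : ∀ w ∈ ball (0 : ℂ) ((1 + ‖ζ‖) / 2)⁻¹, 1 - conj ζ * w ≠ 0 := fun w hw => by
    refine one_sub_conj_mul_ne_zero ?_
    rw [mem_ball_zero_iff, inv_div, lt_div_iff₀ (by positivity)] at hw
    nlinarith [norm_nonneg ζ, norm_nonneg w]
  rw [hardyNormSq_eq_lintegral (ρ := (1 + ‖ζ‖) / 2) (by positivity) (by linarith),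
    ← lintegral_const_mul']
  · simp_rw [← ofReal_norm_sq]
    rw [← ENNReal.ofReal_sum_of_nonneg fun _ _ => by positivity,
      ← integral_poissonKernel_mul_sum hζ N c, ofReal_integral_eq_lintegral_ofReal]
    · refine lintegral_congr fun t => ?_
      rw [← ENNReal.ofReal_mul hp.le, weightedComp, norm_div, div_pow]
      congr 1
      have h1 := normSq_one_sub_sub ζ (circlePt t)
      rw [norm_circlePt, norm_sub_rev ζ] at h1
      rw [show ‖1 - conj ζ * circlePt t‖ ^ 2 = ‖circlePt t - ζ‖ ^ 2 by linarith]
      ring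
    · refine Continuous.integrable_of_hasCompactSupport ?_ (HasCompactSupport.of_compactSpace _)
      have := continuous_circlePt
      refine (continuous_const.div (by fun_prop) hne).mul ?_
      have : Continuous fun t : UnitAddCircle => diskAut ζ (circlePt t) :=
        Continuous.div (by fun_prop) (by fun_prop) hne'
      fun_prop
    · exact Filter.Eventually.of_forall fun t => by positivity
  · exact ENNReal.ofReal_ne_top
  · have : DifferentiableOn ℂ (diskAut ζ) (ball (0 : ℂ) ((1 + ‖ζ‖) / 2)⁻¹) := fun w hw =>
      (hasDerivAt_diskAut (hρ w hw)).differentiableAt.differentiableWithinAt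
    unfold weightedComp
    exact DifferentiableOn.div (by fun_prop) (by fun_prop) hρ

theorem hardyNormSq_weightedComp_le (hζ : ‖ζ‖ < 1) {g : ℂ → ℂ}
    (hg : DifferentiableOn ℂ g (ball 0 1)) :
    ENNReal.ofReal (1 - ‖ζ‖ ^ 2) * hardyNormSq (weightedComp ζ g) ≤ hardyNormSq g := by
  have hp := one_sub_norm_sq_pos hζ
  obtain ⟨c, hc⟩ := HasTaylor.exists_of_differentiableOn hg
  rw [hc.hardyNormSq_eq]
  conv_lhs => rw [hardyNormSq]
  simp_rw [ENNReal.mul_iSup]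
  refine iSup₂_le fun r hr => ?_
  let F : ℕ → ℂ → ℂ := fun N => weightedComp ζ fun z => ∑ n ∈ Finset.range N, c n * z ^ n
  have hm : ∀ t : UnitAddCircle, (r : ℂ) * circlePt t ∈ ball (0 : ℂ) 1 := fun t => by
    rw [mem_ball_zero_iff, norm_mul, norm_circlePt, mul_one, Complex.norm_real,
      Real.norm_of_nonneg hr.1]
    exact hr.2
  have hlim : ∀ t : UnitAddCircle, Filter.Tendsto (fun N => ‖F N (r * circlePt t)‖ₑ ^ 2)
      Filter.atTop (nhds (‖weightedComp ζ g (r * circlePt t)‖ₑ ^ 2)) := fun t => by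
    have h1 := (hc _ (diskAut_mem_ball hζ (hm t))).tendsto_sum_nat.div_const
      (1 - conj ζ * (r * circlePt t))
    exact ((ENNReal.continuous_pow 2).tendsto _).comp (continuous_enorm.tendsto _ |>.comp h1)
  have hmeas : ∀ N, Measurable fun t : UnitAddCircle => ‖F N (r * circlePt t)‖ₑ ^ 2 := fun N => by
    have := continuous_circlePt.measurable
    simp only [F, weightedComp, diskAut]
    fun_prop
  -- Fatou passes from Taylor polynomials to `g` on a fixed circle; this gives only an upper bound
  -- for the composed function.
  have hfatou := lintegral_liminf_le (u := Filter.atTop) (μ := AddCircle.haarAddCircle) hmeas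
  simp_rw [(hlim _).liminf_eq] at hfatou
  have hb : ∀ N, ENNReal.ofReal (1 - ‖ζ‖ ^ 2) * ∫⁻ t : UnitAddCircle, ‖F N (r * circlePt t)‖ₑ ^ 2
      ∂AddCircle.haarAddCircle ≤ ∑' n, ‖c n‖ₑ ^ 2 := fun N => by
    refine le_trans ?_ (ENNReal.sum_le_tsum (Finset.range N))
    rw [← hardyNormSq_weightedComp_sum hζ N c]
    gcongr
    exact le_iSup₂_of_le (f := fun (r : ℝ) (_ : r ∈ Ico (0 : ℝ) 1) =>
      ∫⁻ t : UnitAddCircle, ‖F N (r * circlePt t)‖ₑ ^ 2 ∂AddCircle.haarAddCircle) r hr le_rfl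
  have hne : ENNReal.ofReal (1 - ‖ζ‖ ^ 2) ≠ 0 := by simpa using hp
  calc _ ≤ ENNReal.ofReal (1 - ‖ζ‖ ^ 2) * Filter.liminf (fun N => ∫⁻ t : UnitAddCircle,
        ‖F N (r * circlePt t)‖ₑ ^ 2 ∂AddCircle.haarAddCircle) Filter.atTop := by gcongr
    _ ≤ ENNReal.ofReal (1 - ‖ζ‖ ^ 2) *
        ((∑' n, ‖c n‖ₑ ^ 2) / ENNReal.ofReal (1 - ‖ζ‖ ^ 2)) := by
      gcongr
      refine Filter.liminf_le_of_le (by isBoundedDefault) fun b hb' => ?_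
      obtain ⟨N, hN⟩ := hb'.exists
      refine hN.trans ?_
      rw [ENNReal.le_div_iff_mul_le (Or.inl hne) (Or.inl ENNReal.ofReal_ne_top), mul_comm]
      exact hb N
    _ = _ := ENNReal.mul_div_cancel hne ENNReal.ofReal_ne_top

theorem hardyNormSq_const_mul {g : ℂ → ℂ} (hg : DifferentiableOn ℂ g (ball 0 1)) (a : ℂ) :
    hardyNormSq (fun z => a * g z) = ‖a‖ₑ ^ 2 * hardyNormSq g := by
  obtain ⟨c, hc⟩ := HasTaylor.exists_of_differentiableOn hg
  rw [hc.hardyNormSq_eq, (hc.const_mul a).hardyNormSq_eq, ← ENNReal.tsum_mul_left]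
  simp_rw [enorm_mul, mul_pow]

theorem hardyNormSq_congr {f g : ℂ → ℂ} (h : EqOn f g (ball 0 1)) :
    hardyNormSq f = hardyNormSq g := by
  refine iSup_congr fun r => iSup_congr fun hr => lintegral_congr fun t => ?_
  rw [h]
  rw [mem_ball_zero_iff, norm_mul, norm_circlePt, mul_one, Complex.norm_real,
    Real.norm_of_nonneg hr.1]
  exact hr.2

/-- The operator is an involution up to the factor `(1 - |ζ|²)⁻¹`, so the inequality from Fatou
applied to `weightedComp ζ g` is the reverse inequality. -/
theorem hardyNormSq_weightedComp (hζ : ‖ζ‖ < 1) {g : ℂ → ℂ}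
    (hg : DifferentiableOn ℂ g (ball 0 1)) :
    ENNReal.ofReal (1 - ‖ζ‖ ^ 2) * hardyNormSq (weightedComp ζ g) = hardyNormSq g := by
  have hp := one_sub_norm_sq_pos hζ
  have hne : ENNReal.ofReal (1 - ‖ζ‖ ^ 2) ≠ 0 := by simpa using hp
  refine le_antisymm (hardyNormSq_weightedComp_le hζ hg) ?_
  have h := hardyNormSq_weightedComp_le hζ (differentiableOn_weightedComp hζ hg)
  rw [hardyNormSq_congr fun w hw => weightedComp_weightedComp hζ g hw,
    hardyNormSq_const_mul hg] at h
  have e : ‖(1 - conj ζ * ζ)⁻¹‖ₑ ^ 2 = (ENNReal.ofReal (1 - ‖ζ‖ ^ 2))⁻¹ ^ 2 := by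
    rw [conj_mul_self_eq, ← Complex.ofReal_one, ← Complex.ofReal_sub, ← Complex.ofReal_inv,
      ← ofReal_norm, Complex.norm_real, Real.norm_of_nonneg (by positivity),
      ENNReal.ofReal_inv_of_pos hp]
  rw [e] at h
  calc hardyNormSq g = ENNReal.ofReal (1 - ‖ζ‖ ^ 2) * (ENNReal.ofReal (1 - ‖ζ‖ ^ 2) *
        ((ENNReal.ofReal (1 - ‖ζ‖ ^ 2))⁻¹ ^ 2 * hardyNormSq g)) := by
        rw [show ∀ x y : ℝ≥0∞, x * (x * (x⁻¹ ^ 2 * y)) = (x * x⁻¹) * (x * x⁻¹) * y from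
            fun x y => by ring, ENNReal.mul_inv_cancel hne ENNReal.ofReal_ne_top, one_mul, one_mul]
    _ ≤ _ := by gcongr

/-! ### The local Douglas formula at interior and arbitrary points -/

/-- Since `diskAut ζ w - ζ = -(1 - |ζ|²) w / (1 - ζ̄ w)`, composing `f` with the automorphism gives
`a - (1 - |ζ|²) w · weightedComp ζ g`. Conformal invariance and the isometry property of
`weightedComp` do the rest; both sides may be infinite. -/
theorem local_douglas_interior (hζ : ‖ζ‖ < 1) {f g : ℂ → ℂ} {a : ℂ}
    (hg : DifferentiableOn ℂ g (ball 0 1))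
    (hf : ∀ z ∈ ball (0 : ℂ) 1, f z = a + (z - ζ) * g z) :
    dirichletIntegral (superharmonicKernel ζ) f = hardyNormSq g := by
  have hp := one_sub_norm_sq_pos hζ
  have hfd : DifferentiableOn ℂ f (ball 0 1) :=
    DifferentiableOn.congr (f := fun z => a + (z - ζ) * g z) (by fun_prop) hf
  obtain ⟨d, hd⟩ := HasTaylor.exists_of_differentiableOn (differentiableOn_weightedComp hζ hg)
  have hF : HasTaylor (fun w => f (diskAut ζ w)) _ :=
    ((HasTaylor.const a).add (hd.const_mul (-(1 - conj ζ * ζ))).id_mul).congr fun w hw => by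
      have h1 := one_sub_conj_mul_ne_zero (norm_mul_lt hζ hw)
      simp only
      rw [hf _ (diskAut_mem_ball hζ hw), diskAut_sub h1, weightedComp]
      field_simp
  rw [dirichletIntegral_interior hζ hfd hF, ← hardyNormSq_weightedComp hζ hg, hd.hardyNormSq_eq,
    ← ENNReal.tsum_mul_left, ← ENNReal.tsum_mul_left]
  refine tsum_congr fun n => ?_
  simp only [Nat.add_eq_zero_iff, one_ne_zero, and_false, if_false, zero_add, Nat.add_sub_cancel]
  rw [conj_mul_self_eq, ← Complex.ofReal_one, ← Complex.ofReal_sub, ← ofReal_norm_sq,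
    ← ofReal_norm_sq, ← ENNReal.ofReal_mul (by positivity), ← ENNReal.ofReal_mul (by positivity),
    norm_mul, norm_neg, Complex.norm_real, Real.norm_of_nonneg hp.le]
  congr 1
  field_simp

/-- The local Douglas formula. -/
theorem local_douglas (hζ : ‖ζ‖ ≤ 1) {f g : ℂ → ℂ} {a : ℂ}
    (hg : DifferentiableOn ℂ g (ball 0 1)) (hfin : hardyNormSq g < ∞)
    (hf : ∀ z ∈ ball (0 : ℂ) 1, f z = a + (z - ζ) * g z) :
    dirichletIntegral (superharmonicKernel ζ) f = hardyNormSq g := by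
  rcases hζ.lt_or_eq with h | h
  · exact local_douglas_interior h hg hf
  · exact local_douglas_boundary h hg hfin hf

theorem exists_of_local_lt_top (hζ : ‖ζ‖ ≤ 1) {f : ℂ → ℂ}
    (hf : DifferentiableOn ℂ f (ball 0 1))
    (hfin : dirichletIntegral (superharmonicKernel ζ) f < ∞) :
    ∃ (a : ℂ) (g : ℂ → ℂ), DifferentiableOn ℂ g (ball 0 1) ∧ hardyNormSq g < ∞ ∧
      ∀ z ∈ ball (0 : ℂ) 1, f z = a + (z - ζ) * g z := by
  rcases hζ.lt_or_eq with h | h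
  · have hm : ζ ∈ ball (0 : ℂ) 1 := by simpa using h
    have hg : DifferentiableOn ℂ (dslope f ζ) (ball 0 1) :=
      (Complex.differentiableOn_dslope (isOpen_ball.mem_nhds hm)).2 hf
    have he : ∀ z ∈ ball (0 : ℂ) 1, f z = f ζ + (z - ζ) * dslope f ζ z := fun z _ => by
      rw [← smul_eq_mul, sub_smul_dslope]
      ring
    exact ⟨f ζ, _, hg, (local_douglas_interior h hg he).symm.trans_lt hfin, he⟩
  · exact exists_of_local_lt_top_boundary h hf hfin

end

/-! ### Operator ranges -/

section OperatorRange

open ContinuousLinearMap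

variable {E F G : Type*} [NormedAddCommGroup E] [InnerProductSpace ℂ E] [CompleteSpace E]
  [NormedAddCommGroup F] [InnerProductSpace ℂ F] [CompleteSpace F]
  [NormedAddCommGroup G] [InnerProductSpace ℂ G] [CompleteSpace G]

/-- Operators with `T T* = S S*` have the same range, with the same quotient norm. -/
theorem exists_eq_of_comp_adjoint_eq {T : E →L[ℂ] F} {S : G →L[ℂ] F}
    (h : T ∘L adjoint T = S ∘L adjoint S) (k : E) :
    ∃ g ∈ (LinearMap.ker (S : G →ₗ[ℂ] F))ᗮ, S g = T k ∧ ‖g‖ ≤ ‖k‖ := by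
  have hn : ∀ x, ‖adjoint T x‖ = ‖adjoint S x‖ := fun x => by
    have e := congrArg (fun R : F →L[ℂ] F => inner ℂ x (R x)) h
    simp only [coe_comp, Function.comp_apply] at e
    rw [← adjoint_inner_left T, ← adjoint_inner_left S, inner_self_eq_norm_sq_to_K,
      inner_self_eq_norm_sq_to_K] at e
    have : ‖adjoint T x‖ ^ 2 = ‖adjoint S x‖ ^ 2 := by exact_mod_cast e
    exact (pow_left_inj₀ (norm_nonneg _) (norm_nonneg _) two_ne_zero).1 this
  -- Equality of `‖T* x‖` and `‖S* x‖` makes `S* x ↦ T* x` well defined and isometric, so it extends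
  -- to a contraction `W` on the closure of the range of `S*`. From `W S* = T*` follows `S W* = T`,
  -- and the required preimage is `W* k`.
  let K : Submodule ℂ G := (LinearMap.range (adjoint S : F →ₗ[ℂ] G)).topologicalClosure
  have hK : IsClosed (K : Set G) := Submodule.isClosed_topologicalClosure _
  have : CompleteSpace K := hK.completeSpace_coe
  let e : F →ₗ[ℂ] K := (adjoint S : F →ₗ[ℂ] G).codRestrict K fun x =>
    Submodule.le_topologicalClosure _ ⟨x, rfl⟩
  have hd : DenseRange e := by
    intro y
    rw [closure_subtype, ← range_comp]
    exact y.2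
  have hb : ∀ x, ‖(adjoint T : F →ₗ[ℂ] E) x‖ ≤ 1 * ‖e x‖ := fun x => by
    rw [one_mul]
    exact (hn x).le
  let W : K →L[ℂ] E := (adjoint T : F →ₗ[ℂ] E).extendOfNorm e
  have hW : ∀ x, W (e x) = adjoint T x := LinearMap.extendOfNorm_eq hd ⟨1, hb⟩
  refine ⟨adjoint W k, ?_, ?_, ?_⟩
  · have hle : K ≤ (LinearMap.ker (S : G →ₗ[ℂ] F))ᗮ := by
      refine Submodule.topologicalClosure_minimal _ ?_ (Submodule.isClosed_orthogonal _)
      rintro _ ⟨x, rfl⟩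
      rw [Submodule.mem_orthogonal]
      intro u hu
      change inner ℂ u (adjoint S x) = 0
      rw [adjoint_inner_right, show S u = 0 from hu, inner_zero_left]
    exact hle (adjoint W k).2
  · refine ext_inner_right ℂ fun x => ?_
    rw [← adjoint_inner_right S, ← adjoint_inner_right T, ← hW, ← adjoint_inner_left W,
      Submodule.coe_inner]
    rfl
  · have h1 : ‖W‖ ≤ 1 := LinearMap.opNorm_extendOfNorm_le hd zero_le_one hb
    calc ‖((adjoint W k : K) : G)‖ = ‖adjoint W k‖ := rfl
      _ ≤ ‖adjoint W‖ * ‖k‖ := le_opNorm _ _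
      _ ≤ 1 * ‖k‖ := by
        gcongr
        rwa [LinearIsometryEquiv.norm_map]
      _ = ‖k‖ := one_mul _

/-! ### Pairs with their mates, and the range of the defect operator -/

variable {A C : E →L[ℂ] E}

/-- The pairs `(f, h)` with `A* f = C h`. -/
def mateSpace (A C : E →L[ℂ] E) : Submodule ℂ (WithLp 2 (E × E)) :=
  LinearMap.ker ((adjoint A ∘L WithLp.fstL 2 ℂ E E - C ∘L WithLp.sndL 2 ℂ E E :
    WithLp 2 (E × E) →L[ℂ] E) : WithLp 2 (E × E) →ₗ[ℂ] E)

theorem mem_mateSpace {p : WithLp 2 (E × E)} :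
    p ∈ mateSpace A C ↔ adjoint A p.fst = C p.snd := by
  change adjoint A p.fst - C p.snd = 0 ↔ _
  rw [sub_eq_zero]

instance : CompleteSpace (mateSpace A C) :=
  (ContinuousLinearMap.isClosed_ker _).completeSpace_coe

/-- The first coordinate on `mateSpace A C`. -/
def mateFst (A C : E →L[ℂ] E) : mateSpace A C →L[ℂ] E :=
  WithLp.fstL 2 ℂ E E ∘L (mateSpace A C).subtypeL

/-- The adjoint is explicit: `x ↦ (x - A A* x, C* A* x)`. The relation `A* A + C C* = 1` places this
pair in `mateSpace A C`. In the application `A = T_b` and `C = T_a*`. -/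
theorem mateFst_comp_adjoint (h : adjoint A ∘L A + C ∘L adjoint C = 1) :
    mateFst A C ∘L adjoint (mateFst A C) = 1 - A ∘L adjoint A := by
  ext x
  have hA : ∀ y, adjoint A (A y) = y - C (adjoint C y) := fun y => by
    have := congrArg (fun R : E →L[ℂ] E => R y) h
    simp only [add_apply, coe_comp, Function.comp_apply, one_apply_eq_self] at this
    rw [eq_sub_iff_add_eq, this]
  let p : mateSpace A C := ⟨WithLp.toLp 2 (x - A (adjoint A x), adjoint C (adjoint A x)), by
    rw [mem_mateSpace]
    simp [hA]⟩
  have hp : adjoint (mateFst A C) x = p := by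
    refine ext_inner_left ℂ fun q => ?_
    have hq := mem_mateSpace.1 q.2
    rw [adjoint_inner_right, Submodule.coe_inner, WithLp.prod_inner_apply]
    change inner ℂ (q : WithLp 2 (E × E)).fst x = inner ℂ (q : WithLp 2 (E × E)).fst
      (x - A (adjoint A x)) + inner ℂ (q : WithLp 2 (E × E)).snd (adjoint C (adjoint A x))
    rw [inner_sub_right, adjoint_inner_right C, ← adjoint_inner_left A, hq]
    ring
  simp only [coe_comp, Function.comp_apply, hp]
  rfl

theorem opSqrt_comp_adjoint {T : E →L[ℂ] E} (hT : 0 ≤ T) :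
    opSqrt T ∘L adjoint (opSqrt T) = T := by
  have h : IsSelfAdjoint (opSqrt T) := (CFC.sqrt_nonneg T).isSelfAdjoint
  rw [isSelfAdjoint_iff'.1 h]
  exact CFC.sqrt_mul_sqrt_self T hT

theorem injective_mateFst (hC : Function.Injective C) : Function.Injective (mateFst A C) := by
  rw [injective_iff_map_eq_zero]
  intro p hp
  have h1 : (p : WithLp 2 (E × E)).fst = 0 := hp
  have h2 := mem_mateSpace.1 p.2
  rw [h1, map_zero] at h2
  have h3 : (p : WithLp 2 (E × E)).snd = 0 := hC (by rw [← h2, map_zero])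
  ext1
  exact WithLp.ofLp_injective 2 (Prod.ext h1 h3)

/-- The factorization through `mateFst` also supplies the positivity that makes the square root
meaningful. -/
theorem opSqrt_one_sub_comp_adjoint (h : adjoint A ∘L A + C ∘L adjoint C = 1) :
    opSqrt (1 - A ∘L adjoint A) ∘L adjoint (opSqrt (1 - A ∘L adjoint A)) =
      1 - A ∘L adjoint A := by
  refine opSqrt_comp_adjoint ?_
  rw [← mateFst_comp_adjoint h, nonneg_iff_isPositive]
  exact isPositive_self_comp_adjoint _

variable {D : E →L[ℂ] E}

theorem exists_mate (h : adjoint A ∘L A + C ∘L adjoint C = 1)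
    (hD : D ∘L adjoint D = 1 - A ∘L adjoint A) (g : E) : ∃ k, adjoint A (D g) = C k := by
  obtain ⟨p, -, hp, -⟩ := exists_eq_of_comp_adjoint_eq (hD.trans (mateFst_comp_adjoint h).symm) g
  refine ⟨(p : WithLp 2 (E × E)).snd, ?_⟩
  rw [← hp]
  exact mem_mateSpace.1 p.2

/-- The range comparison is used in both directions, each without increasing the norm. Injectivity
of `C` identifies the pair that comes back with the original one, so the norms are equal. -/
theorem exists_eq_of_mate (h : adjoint A ∘L A + C ∘L adjoint C = 1)
    (hD : D ∘L adjoint D = 1 - A ∘L adjoint A) (hC : Function.Injective C)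
    {f k : E} (hf : adjoint A f = C k) :
    ∃ g ∈ (LinearMap.ker (D : E →ₗ[ℂ] E))ᗮ, D g = f ∧ ‖g‖ ^ 2 = ‖f‖ ^ 2 + ‖k‖ ^ 2 := by
  have hD' := hD.trans (mateFst_comp_adjoint h).symm
  let p : mateSpace A C := ⟨WithLp.toLp 2 (f, k), mem_mateSpace.2 hf⟩
  obtain ⟨g, hg, hgf, hgn⟩ := exists_eq_of_comp_adjoint_eq hD'.symm p
  obtain ⟨q, -, hq, hqn⟩ := exists_eq_of_comp_adjoint_eq hD' g
  obtain rfl : q = p := injective_mateFst hC (hq.trans hgf)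
  refine ⟨g, hg, hgf, ?_⟩
  rw [le_antisymm hgn hqn]
  exact WithLp.prod_norm_sq_eq_of_L2 (p : WithLp 2 (E × E))

end OperatorRange

/-! ### Coefficients of functions in `H²` -/

open ContinuousLinearMap

/-- The Taylor coefficients of a function in `H²`. -/
def coeff (F : H2) (n : ℕ) : ℂ := fourierCoeff ((F : LpCircle 2) : UnitAddCircle → ℂ) n

theorem fourierCoeff_eq_inner (F : LpCircle 2) (n : ℤ) :
    fourierCoeff (F : UnitAddCircle → ℂ) n = inner ℂ (fourierLp 2 n : LpCircle 2) F := by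
  rw [← fourierBasis_repr, HilbertBasis.repr_apply_apply, coe_fourierBasis]

theorem fourierCoeff_of_neg (F : H2) {n : ℤ} (hn : n < 0) :
    fourierCoeff ((F : LpCircle 2) : UnitAddCircle → ℂ) n = 0 := F.2 n hn

/-- The monomial `z ^ n` as an element of `H²`. -/
def monom (n : ℕ) : H2 := ⟨fourierLp 2 n, fun m hm => by
  rw [fourierCoeff_eq_inner, orthonormal_iff_ite.1 orthonormal_fourier, if_neg (by omega)]⟩

theorem coeff_eq_inner (F : H2) (n : ℕ) : coeff F n = inner ℂ (monom n) F :=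
  fourierCoeff_eq_inner _ _

theorem coeff_monom (n m : ℕ) : coeff (monom n) m = if m = n then 1 else 0 := by
  rw [coeff, fourierCoeff_eq_inner]
  change inner ℂ (fourierLp 2 (m : ℤ) : LpCircle 2) (fourierLp 2 (n : ℤ)) = _
  rw [orthonormal_iff_ite.1 orthonormal_fourier]
  simp

theorem coeff_add (F G : H2) (n : ℕ) : coeff (F + G) n = coeff F n + coeff G n := by
  simp [coeff_eq_inner]

theorem coeff_sub (F G : H2) (n : ℕ) : coeff (F - G) n = coeff F n - coeff G n := by
  simp [coeff_eq_inner]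

theorem coeff_smul (a : ℂ) (F : H2) (n : ℕ) : coeff (a • F) n = a * coeff F n := by
  simp [coeff_eq_inner]

theorem H2_ext {F G : H2} (h : ∀ n, coeff F n = coeff G n) : F = G := by
  ext1
  refine fourierBasis.repr.injective ?_
  ext n
  rw [fourierBasis_repr, fourierBasis_repr]
  rcases lt_or_ge n 0 with hn | hn
  · rw [fourierCoeff_of_neg F hn, fourierCoeff_of_neg G hn]
  · lift n to ℕ using hn
    exact h n

theorem H2_enorm_sq (F : H2) : ‖F‖ₑ ^ 2 = ∑' n, ‖coeff F n‖ₑ ^ 2 := by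
  have h : ‖F‖ₑ = ‖(F : LpCircle 2)‖ₑ := rfl
  rw [h, ← tsum_enorm_fourierCoeff, tsum_int_of_nonneg]
  · rfl
  · intro n hn
    simp [fourierCoeff_of_neg F hn]

theorem summable_coeff (F : H2) : Summable fun n => ‖coeff F n‖ ^ 2 := by
  rw [← summable_norm_sq_iff, ← H2_enorm_sq]
  exact ENNReal.pow_lt_top enorm_lt_top

theorem exists_coeff_eq {c : ℕ → ℂ} (hc : Summable fun n => ‖c n‖ ^ 2) :
    ∃ F : H2, ∀ n, coeff F n = c n := by
  let d : ℤ → ℂ := fun n => if 0 ≤ n then c n.toNat else 0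
  have hd : Memℓp d 2 := by
    rw [memℓp_gen_iff (by simp)]
    simp only [ENNReal.toReal_ofNat, Real.rpow_ofNat]
    have hs : ∀ n ∉ range ((↑) : ℕ → ℤ), ‖d n‖ ^ 2 = 0 := fun n hn => by
      have : ¬ 0 ≤ n := fun h => hn ⟨n.toNat, by simpa using h⟩
      simp [d, this]
    rw [← Function.Injective.summable_iff Nat.cast_injective hs]
    refine hc.congr fun n => ?_
    simp [d]
  let F : LpCircle 2 := fourierBasis.repr.symm ⟨d, hd⟩
  have hF : ∀ n, fourierCoeff (F : UnitAddCircle → ℂ) n = d n := fun n => by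
    rw [← fourierBasis_repr, LinearIsometryEquiv.apply_symm_apply]
  refine ⟨⟨F, fun n hn => ?_⟩, fun n => ?_⟩
  · rw [hF]
    simp [d, hn]
  · rw [coeff, hF]
    simp [d]

theorem hasTaylor_diskExt (F : H2) : HasTaylor (diskExt (F : LpCircle 2)) (coeff F) :=
  hasTaylor_of_summable_sq (summable_coeff F)

theorem eq_of_eqOn_diskExt {F G : H2}
    (h : EqOn (diskExt (F : LpCircle 2)) (diskExt (G : LpCircle 2)) (ball 0 1)) : F = G :=
  H2_ext fun n => congrFun ((hasTaylor_diskExt F).unique ((hasTaylor_diskExt G).congr h)) n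

theorem hardyNormSq_diskExt (F : H2) : hardyNormSq (diskExt (F : LpCircle 2)) = ‖F‖ₑ ^ 2 := by
  rw [(hasTaylor_diskExt F).hardyNormSq_eq, H2_enorm_sq]

theorem HasTaylor.exists_H2 {f : ℂ → ℂ} {c : ℕ → ℂ} (h : HasTaylor f c)
    (hf : hardyNormSq f < ∞) :
    ∃ F : H2, (∀ n, coeff F n = c n) ∧ EqOn f (diskExt (F : LpCircle 2)) (ball 0 1) := by
  rw [h.hardyNormSq_eq, summable_norm_sq_iff] at hf
  obtain ⟨F, hF⟩ := exists_coeff_eq hf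
  refine ⟨F, hF, h.eqOn ?_⟩
  convert! hasTaylor_diskExt F using 1
  exact (funext hF).symm

/-! ### Toeplitz operators -/

theorem coeFn_mulOp (ψ : LpCircle ∞) (F : LpCircle 2) :
    mulOp ψ F =ᵐ[AddCircle.haarAddCircle] fun t => ψ t * F t := by
  have := (ContinuousLinearMap.mul ℂ ℂ).coeFn_holder (r := 2) ψ F
  simpa [mulOp] using this

theorem inner_mulOp_left (ψ : LpCircle ∞) (F G : LpCircle 2) :
    inner ℂ (mulOp (star ψ) F) G = inner ℂ F (mulOp ψ G) := by
  rw [L2.inner_def, L2.inner_def]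
  refine integral_congr_ae ?_
  filter_upwards [coeFn_mulOp (star ψ) F, coeFn_mulOp ψ G, Lp.coeFn_star ψ] with t h1 h2 h3
  rw [h1, h2, h3]
  simp
  ring

theorem toeplitz_star (ψ : LpCircle ∞) : toeplitz (star ψ) = adjoint (toeplitz ψ) := by
  rw [eq_adjoint_iff]
  intro F G
  simp only [toeplitz, coe_comp, Function.comp_apply, Submodule.subtypeL_apply]
  rw [Submodule.inner_orthogonalProjectionOnto_eq_of_mem_left, ← inner_mulOp_left,
    Submodule.inner_orthogonalProjectionOnto_eq_of_mem_right]

theorem fourierCoeff_star_mul (ψ : UnitAddCircle → ℂ) (n k : ℤ) :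
    fourierCoeff (fun t => conj (ψ t) * fourier n t) k = conj (fourierCoeff ψ (n - k)) := by
  rw [fourierCoeff, fourierCoeff, ← integral_conj]
  refine integral_congr_ae (Filter.Eventually.of_forall fun t => ?_)
  simp only [smul_eq_mul, map_mul]
  rw [← fourier_neg, neg_neg, sub_eq_add_neg, fourier_add]
  ring

/-- Parseval's identity for the inner product of `ψ̄ e_n` with `F`; convolution of the coefficients
thus holds in `L²` with unconditional convergence. -/
theorem hasSum_fourierCoeff_mulOp (ψ : LpCircle ∞) (F : LpCircle 2) (n : ℤ) :
    HasSum (fun k : ℤ => fourierCoeff (ψ : UnitAddCircle → ℂ) (n - k) *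
      fourierCoeff (F : UnitAddCircle → ℂ) k)
      (fourierCoeff (mulOp ψ F : UnitAddCircle → ℂ) n) := by
  rw [fourierCoeff_eq_inner, ← inner_mulOp_left]
  have h := fourierBasis.hasSum_inner_mul_inner
    (mulOp (star ψ) (fourierLp 2 n : LpCircle 2)) F
  convert! h using 2 with k
  rw [coe_fourierBasis, ← fourierCoeff_eq_inner, ← inner_conj_symm _ (fourierLp 2 k),
    ← fourierCoeff_eq_inner]
  congr 1
  rw [← Complex.conj_conj (fourierCoeff (ψ : UnitAddCircle → ℂ) (n - k)), ← fourierCoeff_star_mul]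
  congr 1
  refine congrFun (fourierCoeff_congr_ae ?_) k
  filter_upwards [coeFn_mulOp (star ψ) (fourierLp 2 n), Lp.coeFn_star ψ, coeFn_fourierLp 2 n]
    with t h1 h2 h3
  rw [h1, h2, h3]
  simp

theorem mulOp_mem_H2 {ψ : LpCircle ∞} (hψ : IsHInf ψ) (F : H2) : mulOp ψ F ∈ H2 := fun n hn => by
  have h : ∀ k : ℤ, fourierCoeff (ψ : UnitAddCircle → ℂ) (n - k) *
      fourierCoeff ((F : LpCircle 2) : UnitAddCircle → ℂ) k = 0 := fun k => by
    rcases lt_or_ge k 0 with hk | hk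
    · rw [fourierCoeff_of_neg F hk, mul_zero]
    · rw [hψ _ (by omega), zero_mul]
  have hs := hasSum_fourierCoeff_mulOp ψ F n
  simp only [h] at hs
  exact hs.unique hasSum_zero

theorem coe_toeplitz {ψ : LpCircle ∞} (hψ : IsHInf ψ) (F : H2) :
    (toeplitz ψ F : LpCircle 2) = mulOp ψ F :=
  congrArg Subtype.val (H2.orthogonalProjectionOnto_mem_subspace_eq_self ⟨_, mulOp_mem_H2 hψ F⟩)

theorem coeff_toeplitz {ψ : LpCircle ∞} (hψ : IsHInf ψ) (F : H2) (n : ℕ) :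
    coeff (toeplitz ψ F) n = ∑ k ∈ Finset.range (n + 1),
      fourierCoeff (ψ : UnitAddCircle → ℂ) k * coeff F (n - k) := by
  rw [coeff, coe_toeplitz hψ]
  refine (hasSum_fourierCoeff_mulOp ψ F n).unique ?_
  have h : ∑ k ∈ Finset.range (n + 1),
      fourierCoeff (ψ : UnitAddCircle → ℂ) k * coeff F (n - k) =
      ∑ k ∈ (Finset.range (n + 1)).map Nat.castEmbedding, fourierCoeff (ψ : UnitAddCircle → ℂ) (n - k) *
      fourierCoeff ((F : LpCircle 2) : UnitAddCircle → ℂ) k := by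
    rw [Finset.sum_map, ← Finset.sum_range_reflect]
    refine Finset.sum_congr rfl fun k hk => ?_
    have hk' : k ≤ n := by simpa [Nat.lt_succ_iff] using hk
    simp only [Nat.add_sub_cancel, Nat.castEmbedding_apply]
    rw [Nat.sub_sub_self hk', Nat.cast_sub hk']
    rfl
  rw [h]
  refine hasSum_sum_of_ne_finset_zero fun k hk => ?_
  rcases lt_or_ge k 0 with hk0 | hk0
  · rw [fourierCoeff_of_neg F hk0, mul_zero]
  · rw [hψ, zero_mul]
    by_contra! h
    refine hk (Finset.mem_map.2 ⟨k.toNat, ?_, ?_⟩)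
    · rw [Finset.mem_range]; omega
    · simpa using hk0

theorem coeff_toeplitz_monom_zero {ψ : LpCircle ∞} (hψ : IsHInf ψ) (n : ℕ) :
    coeff (toeplitz ψ (monom 0)) n = fourierCoeff (ψ : UnitAddCircle → ℂ) n := by
  rw [coeff_toeplitz hψ, Finset.sum_eq_single n]
  · simp [coeff_monom]
  · intro k hk hkn
    rw [coeff_monom, if_neg (by have := Finset.mem_range.1 hk; omega), mul_zero]
  · simp

/-- The symbol is its own product with the constant `1`, so its coefficients are those of an element
of `H²`. -/
theorem IsHInf.hasTaylor {ψ : LpCircle ∞} (hψ : IsHInf ψ) :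
    HasTaylor (diskExt ψ) fun n => fourierCoeff (ψ : UnitAddCircle → ℂ) (n : ℤ) :=
  hasTaylor_of_summable_sq (by
    simpa only [coeff_toeplitz_monom_zero hψ] using summable_coeff (toeplitz ψ (monom 0)))

theorem diskExt_toeplitz {ψ : LpCircle ∞} (hψ : IsHInf ψ) (F : H2) {z : ℂ}
    (hz : z ∈ ball (0 : ℂ) 1) :
    diskExt (toeplitz ψ F : LpCircle 2) z = diskExt ψ z * diskExt (F : LpCircle 2) z := by
  refine (hasTaylor_diskExt (toeplitz ψ F)).eqOn (g := fun z => diskExt ψ z *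
    diskExt (F : LpCircle 2) z) ?_ hz
  convert! hψ.hasTaylor.mul (hasTaylor_diskExt F) using 1
  exact funext fun n => coeff_toeplitz hψ F n

/-- For analytic symbols the projection in the Toeplitz operator does nothing, so the identity `|a|²
+ |b|² = 1` can be integrated against `F` and `G` directly. -/
theorem adjoint_toeplitz_comp_add {b a : LpCircle ∞} (h : IsPair b a) :
    adjoint (toeplitz b) ∘L toeplitz b + adjoint (toeplitz a) ∘L adjoint (adjoint (toeplitz a)) =
      1 := by
  ext F : 1
  refine ext_inner_left ℂ fun G => ?_
  simp only [add_apply, coe_comp, Function.comp_apply, adjoint_adjoint, one_apply_eq_self, inner_add_right]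
  rw [adjoint_inner_right, adjoint_inner_right, Submodule.coe_inner, Submodule.coe_inner,
    Submodule.coe_inner, coe_toeplitz h.isHInf, coe_toeplitz h.isHInf,
    coe_toeplitz h.isOuter.isHInf, coe_toeplitz h.isOuter.isHInf]
  rw [L2.inner_def, L2.inner_def, L2.inner_def, ← integral_add
    (L2.integrable_inner _ _) (L2.integrable_inner _ _)]
  refine integral_congr_ae ?_
  filter_upwards [coeFn_mulOp b F, coeFn_mulOp b G, coeFn_mulOp a F, coeFn_mulOp a G,
    h.sq_add_sq] with t h1 h2 h3 h4 h5
  rw [h1, h2, h3, h4]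
  have h6 : conj (a t) * a t + conj (b t) * b t = 1 := by
    rw [conj_mul_self_eq, conj_mul_self_eq, ← Complex.ofReal_add, h5, Complex.ofReal_one]
  simp only [RCLike.inner_apply, map_mul]
  linear_combination (F : LpCircle 2) t * conj ((G : LpCircle 2) t) * h6

theorem defect_comp_adjoint {b a : LpCircle ∞} (h : IsPair b a) :
    defect b ∘L adjoint (defect b) = 1 - toeplitz b ∘L adjoint (toeplitz b) := by
  rw [defect, toeplitz_star]
  exact opSqrt_one_sub_comp_adjoint (adjoint_toeplitz_comp_add h)

/-- The space `ℋ(b)` consists of the functions `F` with `T_b* F` in the range of `T_a*`. -/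
theorem mem_dbrSpace_iff {b a : LpCircle ∞} (h : IsPair b a)
    (ha : Function.Injective (adjoint (toeplitz a))) {f : ℂ → ℂ} :
    f ∈ dbrSpace b ↔ ∃ F G : H2, EqOn f (diskExt (F : LpCircle 2)) (ball 0 1) ∧
      adjoint (toeplitz b) F = adjoint (toeplitz a) G := by
  have hD := defect_comp_adjoint h
  constructor
  · rintro ⟨g, hg⟩
    obtain ⟨G, hG⟩ := exists_mate (adjoint_toeplitz_comp_add h) hD g
    exact ⟨_, G, hg, hG⟩
  · rintro ⟨F, G, hF, hG⟩
    obtain ⟨g, -, hg, -⟩ := exists_eq_of_mate (adjoint_toeplitz_comp_add h) hD ha hG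
    exact ⟨g, by rwa [hg]⟩

theorem dbrNormSq_eq {b a : LpCircle ∞} (h : IsPair b a)
    (ha : Function.Injective (adjoint (toeplitz a))) {f : ℂ → ℂ} {F G : H2}
    (hF : EqOn f (diskExt (F : LpCircle 2)) (ball 0 1))
    (hG : adjoint (toeplitz b) F = adjoint (toeplitz a) G) :
    dbrNormSq b f = ‖F‖ₑ ^ 2 + ‖G‖ₑ ^ 2 := by
  have hD := defect_comp_adjoint h
  obtain ⟨g, hg, hgF, hgn⟩ := exists_eq_of_mate (adjoint_toeplitz_comp_add h) hD ha hG
  have e : ∀ x : H2, ENNReal.ofReal (‖x‖ ^ 2) = ‖x‖ₑ ^ 2 := fun x => by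
    rw [ENNReal.ofReal_pow (norm_nonneg _), ofReal_norm]
  have hn : ‖g‖ₑ ^ 2 = ‖F‖ₑ ^ 2 + ‖G‖ₑ ^ 2 := by
    rw [← e, ← e, ← e, hgn, ENNReal.ofReal_add (by positivity) (by positivity)]
  rw [← hn]
  refine le_antisymm ?_ ?_
  · refine iInf_le_of_le g (iInf_le_of_le hg (iInf_le_of_le ?_ le_rfl))
    rwa [hgF]
  -- Two competitors differ by an element of the kernel that is also orthogonal to it, so the
  -- infimum runs over one vector.
  · refine le_iInf fun g' => le_iInf fun hg' => le_iInf fun hf => ?_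
    have h1 : defect b g' = F := eq_of_eqOn_diskExt (hf.symm.trans hF)
    have h2 : g' - g ∈ LinearMap.ker (defect b : H2 →ₗ[ℂ] H2) := by
      change defect b (g' - g) = 0
      rw [map_sub, h1, hgF, sub_self]
    have h3 : g' - g = 0 := by
      have := Submodule.inner_right_of_mem_orthogonal h2 (Submodule.sub_mem _ hg' hg)
      exact inner_self_eq_zero.1 this
    rw [sub_eq_zero.1 h3]

/-! ### Herglotz integrals and outer functions -/

/-- The Herglotz integral of a function on the circle. -/
def herglotz (v : UnitAddCircle → ℝ) (z : ℂ) : ℂ :=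
  ∫ t : UnitAddCircle, (circlePt t + z) / (circlePt t - z) * (v t : ℂ) ∂AddCircle.haarAddCircle

theorem one_sub_norm_le_norm_sub (z : ℂ) (t : UnitAddCircle) : 1 - ‖z‖ ≤ ‖circlePt t - z‖ := by
  have := norm_sub_norm_le (circlePt t) z
  rwa [norm_circlePt] at this

theorem circlePt_sub_ne_zero {z : ℂ} (hz : z ∈ ball (0 : ℂ) 1) (t : UnitAddCircle) :
    circlePt t - z ≠ 0 := by
  rw [mem_ball_zero_iff] at hz
  rw [← norm_pos_iff]
  linarith [one_sub_norm_le_norm_sub z t]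

theorem measurable_herglotzKernel (z : ℂ) :
    Measurable fun t : UnitAddCircle => (circlePt t + z) / (circlePt t - z) := by
  have := continuous_circlePt.measurable
  fun_prop

theorem integrable_herglotz {v : UnitAddCircle → ℝ} (hv : Integrable v AddCircle.haarAddCircle)
    {z : ℂ} (hz : z ∈ ball (0 : ℂ) 1) :
    Integrable (fun t : UnitAddCircle => (circlePt t + z) / (circlePt t - z) * (v t : ℂ))
      AddCircle.haarAddCircle := by
  have hz' : ‖z‖ < 1 := by simpa using hz
  refine Integrable.bdd_mul (c := 2 / (1 - ‖z‖)) hv.ofReal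
    (measurable_herglotzKernel z).aestronglyMeasurable (Filter.Eventually.of_forall fun t => ?_)
  rw [norm_div]
  have h1 := one_sub_norm_le_norm_sub z t
  have h2 : ‖circlePt t + z‖ ≤ 2 := by
    have := norm_add_le (circlePt t) z
    rw [norm_circlePt] at this
    linarith
  have : 0 < 1 - ‖z‖ := by linarith
  gcongr

theorem differentiableOn_herglotz {v : UnitAddCircle → ℝ}
    (hv : Integrable v AddCircle.haarAddCircle) :
    DifferentiableOn ℂ (herglotz v) (ball 0 1) := by
  intro z hz
  have hz' : ‖z‖ < 1 := by simpa using hz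
  set d := (1 - ‖z‖) / 2 with hd
  have hd0 : 0 < d := by simp only [hd]; linarith
  have hsub : ∀ x ∈ ball z d, d ≤ 1 - ‖x‖ := fun x hx => by
    have := norm_sub_norm_le x z
    rw [mem_ball, dist_eq_norm] at hx
    simp only [hd] at hx ⊢
    linarith
  have hm : ∀ x ∈ ball z d, x ∈ ball (0 : ℂ) 1 := fun x hx => by
    rw [mem_ball_zero_iff]
    linarith [hsub x hx]
  have hmeas : AEStronglyMeasurable (fun t => (v t : ℂ)) AddCircle.haarAddCircle :=
    hv.ofReal.aestronglyMeasurable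
  have key := hasDerivAt_integral_of_dominated_loc_of_deriv_le (μ := AddCircle.haarAddCircle)
    (F := fun x (t : UnitAddCircle) => (circlePt t + x) / (circlePt t - x) * (v t : ℂ))
    (F' := fun x t => 2 * circlePt t / (circlePt t - x) ^ 2 * (v t : ℂ))
    (bound := fun t => 2 / d ^ 2 * |v t|) (ball_mem_nhds z hd0)
    (Filter.Eventually.of_forall fun x =>
      (measurable_herglotzKernel x).aestronglyMeasurable.mul hmeas)
    (integrable_herglotz hv hz)
    (by
      refine AEStronglyMeasurable.mul (Measurable.aestronglyMeasurable ?_) hmeas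
      have := continuous_circlePt.measurable
      fun_prop)
    (Filter.Eventually.of_forall fun t x hx => by
      rw [norm_mul, norm_div, norm_mul, norm_circlePt, norm_pow, Complex.norm_real, mul_one,
        Real.norm_eq_abs, Complex.norm_ofNat]
      gcongr
      exact (hsub x hx).trans (one_sub_norm_le_norm_sub x t))
    (hv.abs.const_mul _)
    (Filter.Eventually.of_forall fun t x hx => by
      have h1 := circlePt_sub_ne_zero (hm x hx) t
      have h2 : HasDerivAt (fun x => (circlePt t + x) / (circlePt t - x))
          (2 * circlePt t / (circlePt t - x) ^ 2) x := by
        have h3 := ((hasDerivAt_id' x).const_add (circlePt t)).div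
          ((hasDerivAt_id' x).const_sub (circlePt t)) h1
        refine h3.congr_deriv ?_
        congr 1
        ring
      exact h2.mul_const _)
  exact key.2.differentiableAt.differentiableWithinAt

theorem herglotz_zero (v : UnitAddCircle → ℝ) :
    herglotz v 0 = ((∫ t, v t ∂AddCircle.haarAddCircle : ℝ) : ℂ) := by
  rw [herglotz, ← integral_complex_ofReal]
  refine integral_congr_ae (Filter.Eventually.of_forall fun t => ?_)
  have : circlePt t ≠ 0 := norm_ne_zero_iff.1 (by rw [norm_circlePt]; exact one_ne_zero)
  simp [this]

theorem herglotz_sub {v w : UnitAddCircle → ℝ} (hv : Integrable v AddCircle.haarAddCircle)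
    (hw : Integrable w AddCircle.haarAddCircle) {z : ℂ} (hz : z ∈ ball (0 : ℂ) 1) :
    herglotz (fun t => v t - w t) z = herglotz v z - herglotz w z := by
  rw [herglotz, herglotz, herglotz,
    ← integral_sub (integrable_herglotz hv hz) (integrable_herglotz hw hz)]
  refine integral_congr_ae (Filter.Eventually.of_forall fun t => ?_)
  push_cast
  ring

theorem re_herglotzKernel (z : ℂ) (t : UnitAddCircle) :
    ((circlePt t + z) / (circlePt t - z)).re = (1 - ‖z‖ ^ 2) / ‖circlePt t - z‖ ^ 2 := by
  have := congrFun (poissonKernel_eq_re_herglotzRieszKernel (c := 0) (w := z)) (circlePt t)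
  simpa [poissonKernel_def, herglotzRieszKernel_def, norm_circlePt] using this.symm

theorem re_herglotz_le {v : UnitAddCircle → ℝ} (hv : Integrable v AddCircle.haarAddCircle)
    {M : ℝ} (hM : ∀ t, v t ≤ M) {z : ℂ} (hz : z ∈ ball (0 : ℂ) 1) : (herglotz v z).re ≤ M := by
  have hz' : ‖z‖ < 1 := by simpa using hz
  have hP : ∫ t : UnitAddCircle, (1 - ‖z‖ ^ 2) / ‖circlePt t - z‖ ^ 2 ∂AddCircle.haarAddCircle =
      1 := by
    have h := integral_poissonKernel (k := fun _ => 1) diffContOnCl_const hz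
    simp only [Complex.real_smul, mul_one] at h
    rw [integral_complex_ofReal] at h
    exact_mod_cast h
  have hPi : Integrable (fun t : UnitAddCircle => (1 - ‖z‖ ^ 2) / ‖circlePt t - z‖ ^ 2)
      AddCircle.haarAddCircle := by
    -- A non-integrable function has Bochner integral `0` by convention, which contradicts the value
    -- `1`.
    by_contra h
    rw [integral_undef h] at hP
    exact zero_ne_one hP
  have hi := integrable_herglotz hv hz
  have h1 : (herglotz v z).re = ∫ t : UnitAddCircle,
      (1 - ‖z‖ ^ 2) / ‖circlePt t - z‖ ^ 2 * v t ∂AddCircle.haarAddCircle := by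
    have e := integral_re (𝕜 := ℂ) hi
    simp only [RCLike.re_to_complex] at e
    rw [herglotz, ← e]
    refine integral_congr_ae (Filter.Eventually.of_forall fun t => ?_)
    simp only [Complex.re_mul_ofReal, re_herglotzKernel]
  rw [h1]
  calc _ ≤ ∫ t : UnitAddCircle, (1 - ‖z‖ ^ 2) / ‖circlePt t - z‖ ^ 2 * M
        ∂AddCircle.haarAddCircle := by
        refine integral_mono ?_ (hPi.mul_const M) fun t => ?_
        · refine hi.re.congr (Filter.Eventually.of_forall fun t => ?_)
          simp only [RCLike.re_to_complex, Complex.re_mul_ofReal, re_herglotzKernel]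
        · have : 0 ≤ (1 - ‖z‖ ^ 2) / ‖circlePt t - z‖ ^ 2 :=
            div_nonneg (one_sub_norm_sq_pos hz').le (by positivity)
          exact mul_le_mul_of_nonneg_left (hM t) this
    _ = M := by rw [integral_mul_const, hP, one_mul]

theorem norm_exp_herglotz_le {v : UnitAddCircle → ℝ} (hv : Integrable v AddCircle.haarAddCircle)
    {M : ℝ} (hM : ∀ t, v t ≤ M) {z : ℂ} (hz : z ∈ ball (0 : ℂ) 1) :
    ‖Complex.exp (herglotz v z)‖ ≤ Real.exp M := by
  rw [Complex.norm_exp]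
  exact Real.exp_le_exp.2 (re_herglotz_le hv hM hz)

theorem hardyNormSq_le {f : ℂ → ℂ} {M : ℝ} (h : ∀ z ∈ ball (0 : ℂ) 1, ‖f z‖ ≤ M) :
    hardyNormSq f ≤ ENNReal.ofReal M ^ 2 := by
  refine iSup₂_le fun r hr => ?_
  calc _ ≤ ∫⁻ _ : UnitAddCircle, ENNReal.ofReal M ^ 2 ∂AddCircle.haarAddCircle := by
        refine lintegral_mono fun t => ?_
        have := h (r * circlePt t) (by
          rw [mem_ball_zero_iff, norm_mul, norm_circlePt, mul_one, Complex.norm_real,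
            Real.norm_of_nonneg hr.1]
          exact hr.2)
        rw [← ofReal_norm]
        gcongr
    _ = _ := by simp

theorem HasTaylor.pow_mul {f : ℂ → ℂ} {c : ℕ → ℂ} (h : HasTaylor f c) (k : ℕ) :
    HasTaylor (fun z => z ^ k * f z) fun n => if n < k then 0 else c (n - k) := fun z hz => by
  rw [← hasSum_nat_add_iff' k, Finset.sum_eq_zero, sub_zero]
  · convert! (h z hz).mul_left (z ^ k) using 1
    funext n
    simp [pow_add]
    ring
  · intro n hn
    simp [Finset.mem_range.1 hn]

/-- For an outer function `a`, there are multiples of `a` in `H²` approximating `z ^ k`. -/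
theorem IsOuter.exists_toeplitz {a : LpCircle ∞} (ha : IsOuter a) :
    ∃ c : ℂ, ‖c‖ = 1 ∧ ∃ E : ℕ → ℝ, Filter.Tendsto E Filter.atTop (nhds 1) ∧
      ∀ k N : ℕ, ∃ X : H2, ‖toeplitz a X‖ ≤ 1 ∧ coeff (toeplitz a X) k = c * E N := by
  obtain ⟨c, hc, hac⟩ := ha.eq_exp
  set v : UnitAddCircle → ℝ := fun t => Real.log ‖a t‖ with hv
  have hvi : Integrable v AddCircle.haarAddCircle := ha.integrable_log
  -- Truncating `log |a|` from below at `-N` makes `exp (-herglotz u_N)` bounded by `exp N`, while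
  -- `v - u_N ≤ 0` tends to `0` in `L¹`. The product of `a` with this bounded function is a
  -- unimodular constant times `exp (herglotz (v - u_N))`, of modulus at most `1`.
  let u : ℕ → UnitAddCircle → ℝ := fun N t => max (v t) (-N)
  have hui : ∀ N, Integrable (u N) AddCircle.haarAddCircle := fun N =>
    hvi.sup (integrable_const _)
  have hlim : Filter.Tendsto (fun N => ∫ t, (v t - u N t) ∂AddCircle.haarAddCircle)
      Filter.atTop (nhds 0) := by
    have := tendsto_integral_of_dominated_convergence (μ := AddCircle.haarAddCircle)
      (F := fun N t => v t - u N t) (f := fun _ => 0) (fun t => |v t|)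
      (fun N => (hvi.sub (hui N)).aestronglyMeasurable) hvi.abs
      (fun N => Filter.Eventually.of_forall fun t => by
        simp only [u, Real.norm_eq_abs]
        rcases max_cases (v t) (-(N : ℝ)) with ⟨h, h'⟩ | ⟨h, h'⟩
        · rw [h, sub_self, abs_zero]; exact abs_nonneg _
        · have : (0 : ℝ) ≤ N := N.cast_nonneg
          rw [h, abs_of_nonpos (by linarith), abs_of_nonpos (by linarith)]
          linarith)
      (Filter.Eventually.of_forall fun t => by
        obtain ⟨M, hM⟩ := exists_nat_ge (-v t)
        refine tendsto_const_nhds.congr' ?_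
        filter_upwards [Filter.eventually_ge_atTop M] with N hN
        have : (M : ℝ) ≤ N := by exact_mod_cast hN
        simp only [u]
        rw [max_eq_left (by linarith), sub_self])
    simpa using this
  refine ⟨c, hc, fun N => Real.exp (∫ t, (v t - u N t) ∂AddCircle.haarAddCircle), ?_,
    fun k N => ?_⟩
  · have := (Real.continuous_exp.tendsto 0).comp hlim
    rwa [Real.exp_zero] at this
  · have hd : DifferentiableOn ℂ (fun z => z ^ k * Complex.exp (herglotz (fun t => -u N t) z))
        (ball 0 1) := by
      have := differentiableOn_herglotz (hui N).neg
      exact DifferentiableOn.mul (by fun_prop) this.cexp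
    obtain ⟨x, hx⟩ := HasTaylor.exists_of_differentiableOn hd
    have hpow : ∀ z ∈ ball (0 : ℂ) 1, ‖z ^ k‖ ≤ 1 := fun z hz => by
      rw [norm_pow]
      exact pow_le_one₀ (norm_nonneg _) (mem_ball_zero_iff.1 hz).le
    obtain ⟨X, -, hX⟩ := hx.exists_H2 ((hardyNormSq_le (M := Real.exp N) fun z hz => by
      rw [norm_mul]
      exact (mul_le_of_le_one_left (norm_nonneg _) (hpow z hz)).trans
        (norm_exp_herglotz_le (hui N).neg (fun t => neg_le.1 (le_max_right _ _)) hz)).trans_lt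
        (ENNReal.pow_lt_top ENNReal.ofReal_lt_top))
    have hvu := hvi.sub (hui N)
    have hY : EqOn (diskExt (toeplitz a X : LpCircle 2))
        (fun z => z ^ k * (c * Complex.exp (herglotz (fun t => v t - u N t) z))) (ball 0 1) := by
      intro z hz
      have h0 : herglotz (fun t => -u N t) z = - herglotz (u N) z := by
        rw [herglotz, herglotz, ← integral_neg]
        simp
      rw [diskExt_toeplitz ha.isHInf X hz, ← hX hz, hac z hz]
      simp only
      rw [herglotz_sub hvi (hui N) hz, sub_eq_add_neg, Complex.exp_add, ← h0]
      change c * Complex.exp (herglotz v z) * _ = _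
      ring
    refine ⟨X, ?_, ?_⟩
    · have h1 : hardyNormSq (diskExt (toeplitz a X : LpCircle 2)) ≤ ENNReal.ofReal 1 ^ 2 :=
        hardyNormSq_le fun z hz => by
          rw [hY hz]
          simp only
          rw [norm_mul, norm_mul, hc, one_mul]
          refine mul_le_one₀ (hpow z hz) (norm_nonneg _) ?_
          have := norm_exp_herglotz_le (M := 0) hvu (fun t => by
            simp only [Pi.sub_apply, u]
            linarith [le_max_left (v t) (-(N : ℝ))]) hz
          rwa [Real.exp_zero] at this
      rw [hardyNormSq_diskExt, ENNReal.ofReal_one, one_pow, pow_le_one_iff two_ne_zero,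
        ← ofReal_norm, ENNReal.ofReal_le_one] at h1
      exact h1
    · have hd2 : DifferentiableOn ℂ (fun z => c * Complex.exp (herglotz (fun t => v t - u N t) z))
          (ball 0 1) := by
        have := differentiableOn_herglotz hvu
        exact this.cexp.const_mul c
      obtain ⟨y, hy⟩ := HasTaylor.exists_of_differentiableOn hd2
      rw [congrFun ((hasTaylor_diskExt _).unique ((hy.pow_mul k).congr hY)) k]
      have h0 := hy.coeff_eq 0
      simp only [Nat.factorial_zero, iteratedDeriv_zero] at h0
      simp only [lt_irrefl, if_false, Nat.sub_self]
      rw [h0, herglotz_zero]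
      simp

theorem inner_smul_monom (c : ℂ) (k : ℕ) (F : H2) :
    inner ℂ (c • monom k) F = conj c * coeff F k := by
  rw [coeff_eq_inner]
  exact inner_smul_left (𝕜 := ℂ) (monom k) F c

/-- The kernel of `T_a*` is orthogonal to the range of `T_a`. Contractive vectors `a X` whose `k`-th
coefficient tends to `c` converge to `c z^k`, because `‖c z^k - a X‖² ≤ 2 - 2 E_N`; hence every
coefficient of a kernel element vanishes. -/
theorem IsOuter.injective_adjoint_toeplitz {a : LpCircle ∞} (ha : IsOuter a) :
    Function.Injective (ContinuousLinearMap.adjoint (toeplitz a)) := by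
  rw [injective_iff_map_eq_zero]
  intro F hF
  obtain ⟨c, hc, E, hE, h⟩ := ha.exists_toeplitz
  refine H2_ext fun k => ?_
  have hb : ∀ N, ‖coeff F k‖ ^ 2 ≤ ‖F‖ ^ 2 * (2 - 2 * E N) := fun N => by
    obtain ⟨X, hX1, hX2⟩ := h k N
    have h1 : inner ℂ (toeplitz a X) F = 0 := by
      rw [← ContinuousLinearMap.adjoint_inner_right, hF, inner_zero_right]
    have h2 := norm_inner_le_norm (𝕜 := ℂ) (c • monom k - toeplitz a X) F
    rw [inner_sub_left, h1, sub_zero, inner_smul_monom, norm_mul, RCLike.norm_conj,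
      hc, one_mul] at h2
    have hmk : ‖c • monom k‖ = 1 := by
      have h1 : ‖monom k‖ = 1 := (orthonormal_fourier (T := 1)).1 k
      refine (norm_smul c (monom k)).trans ?_
      rw [hc, h1, one_mul]
    have h3 : ‖c • monom k - toeplitz a X‖ ^ 2 ≤ 2 - 2 * E N := by
      rw [@norm_sub_sq ℂ, hmk, inner_smul_monom, hX2, ← mul_assoc,
        conj_mul_self_eq, hc, one_pow, Complex.ofReal_one, one_mul, RCLike.re_to_complex,
        Complex.ofReal_re]
      nlinarith [norm_nonneg (toeplitz a X)]
    calc ‖coeff F k‖ ^ 2 ≤ (‖c • monom k - toeplitz a X‖ * ‖F‖) ^ 2 := by gcongr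
      _ ≤ _ := by
        rw [mul_pow, mul_comm]
        gcongr
  have hlim : Filter.Tendsto (fun N => ‖F‖ ^ 2 * (2 - 2 * E N)) Filter.atTop
      (nhds (‖F‖ ^ 2 * (2 - 2 * 1))) := (tendsto_const_nhds.sub (hE.const_mul 2)).const_mul _
  have := ge_of_tendsto' hlim hb
  have h0 : coeff F k = 0 := by
    rw [← norm_eq_zero, ← sq_eq_zero_iff]
    exact le_antisymm (by simpa using this) (by positivity)
  rw [h0]
  simp [coeff_eq_inner]

/-! ### The shift -/

theorem fourierCoeff_fourierLp (p : ℝ≥0∞) [Fact (1 ≤ p)] (m n : ℤ) :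
    fourierCoeff (fourierLp p m : LpCircle p) n = if n = m then 1 else 0 := by
  rw [congrFun (fourierCoeff_congr_ae (coeFn_fourierLp p m)) n, fourierCoeff_fourier]
  simp [Pi.single_apply]

theorem isHInf_fourierLp_one : IsHInf (fourierLp ∞ 1) := fun n hn => by
  rw [fourierCoeff_fourierLp, if_neg (by omega)]

/-- The shift operator on `H²`. -/
def shift : H2 →L[ℂ] H2 := toeplitz (fourierLp ∞ 1)

theorem diskExt_shift (F : H2) {z : ℂ} (hz : z ∈ ball (0 : ℂ) 1) :
    diskExt (shift F : LpCircle 2) z = z * diskExt (F : LpCircle 2) z := by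
  rw [shift, diskExt_toeplitz isHInf_fourierLp_one F hz]
  congr 1
  rw [diskExt, tsum_eq_single 1]
  · rw [Nat.cast_one, fourierCoeff_fourierLp, if_pos rfl, one_mul, pow_one]
  · intro n hn
    rw [fourierCoeff_fourierLp, if_neg (by exact_mod_cast hn), zero_mul]

theorem coeff_shift (F : H2) (n : ℕ) :
    coeff (shift F) n = if n = 0 then 0 else coeff F (n - 1) :=
  congrFun ((hasTaylor_diskExt (shift F)).unique ((hasTaylor_diskExt F).id_mul.congr
    fun _ hz => diskExt_shift F hz)) n

theorem coeff_adjoint_shift (F : H2) (n : ℕ) : coeff (adjoint shift F) n = coeff F (n + 1) := by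
  rw [coeff_eq_inner, adjoint_inner_right, coeff_eq_inner]
  congr 1
  refine H2_ext fun m => ?_
  rw [coeff_shift, coeff_monom, coeff_monom]
  rcases m with _ | m <;> simp

theorem toeplitz_shift {ψ : LpCircle ∞} (hψ : IsHInf ψ) (F : H2) :
    toeplitz ψ (shift F) = shift (toeplitz ψ F) := eq_of_eqOn_diskExt fun z hz => by
  rw [diskExt_toeplitz hψ _ hz, diskExt_shift _ hz, diskExt_shift _ hz, diskExt_toeplitz hψ _ hz]
  ring

theorem adjoint_toeplitz_adjoint_shift {ψ : LpCircle ∞} (hψ : IsHInf ψ) (F : H2) :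
    adjoint (toeplitz ψ) (adjoint shift F) = adjoint shift (adjoint (toeplitz ψ) F) := by
  refine ext_inner_left ℂ fun G => ?_
  rw [adjoint_inner_right, adjoint_inner_right, adjoint_inner_right, adjoint_inner_right,
    toeplitz_shift hψ]

theorem diskExt_add (F G : H2) {z : ℂ} (hz : z ∈ ball (0 : ℂ) 1) :
    diskExt ((F + G : H2) : LpCircle 2) z = diskExt (F : LpCircle 2) z + diskExt (G : LpCircle 2) z := by
  refine (hasTaylor_diskExt (F + G)).eqOn (g := fun z => diskExt (F : LpCircle 2) z +
    diskExt (G : LpCircle 2) z) ?_ hz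
  convert! (hasTaylor_diskExt F).add (hasTaylor_diskExt G) using 1
  exact funext fun n => coeff_add F G n

theorem diskExt_smul (c : ℂ) (F : H2) {z : ℂ} (hz : z ∈ ball (0 : ℂ) 1) :
    diskExt ((c • F : H2) : LpCircle 2) z = c * diskExt (F : LpCircle 2) z := by
  refine (hasTaylor_diskExt (c • F)).eqOn (g := fun z => c * diskExt (F : LpCircle 2) z) ?_ hz
  convert! (hasTaylor_diskExt F).const_mul c using 1
  exact funext fun n => coeff_smul c F n

theorem diskExt_monom (n : ℕ) {z : ℂ} (hz : z ∈ ball (0 : ℂ) 1) :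
    diskExt (monom n : LpCircle 2) z = z ^ n := by
  refine ((hasTaylor_diskExt (monom n)) z hz).unique ?_
  convert! hasSum_ite_eq n (z ^ n) using 2 with k
  rw [coeff_monom]
  split_ifs with h <;> simp [h]

/-- The relation makes `|coeff F n|` nondecreasing in `n`, while square summability sends it to `0`.
This covers `|ζ| = 1`, where a Neumann series fails. -/
theorem one_sub_smul_adjoint_shift_injective {ζ : ℂ} (hζ : ‖ζ‖ ≤ 1) {F : H2}
    (h : ζ • adjoint shift F = F) : F = 0 := by
  have hn : ∀ n, coeff F n = ζ * coeff F (n + 1) := fun n => by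
    conv_lhs => rw [← h]
    rw [coeff_smul, coeff_adjoint_shift]
  have hm : Monotone fun n => ‖coeff F n‖ ^ 2 := monotone_nat_of_le_succ fun n => by
    rw [hn n, norm_mul, mul_pow]
    exact mul_le_of_le_one_left (by positivity) (pow_le_one₀ (norm_nonneg _) hζ)
  have h0 := (summable_coeff F).tendsto_atTop_zero
  refine H2_ext fun n => ?_
  have h1 : ‖coeff F n‖ ^ 2 ≤ 0 := hm.ge_of_tendsto h0 n
  have h2 : coeff F n = 0 := by
    rw [← norm_eq_zero, ← sq_eq_zero_iff]
    exact le_antisymm h1 (by positivity)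
  rw [h2]
  simp [coeff_eq_inner]

/-! ### Rational symbols -/

theorem IsOuter.diskExt_ne_zero {a : LpCircle ∞} (ha : IsOuter a) {z : ℂ}
    (hz : z ∈ ball (0 : ℂ) 1) : diskExt a z ≠ 0 := by
  obtain ⟨c, hc, h⟩ := ha.eq_exp
  rw [h z hz]
  exact mul_ne_zero (norm_ne_zero_iff.1 (by rw [hc]; exact one_ne_zero)) (Complex.exp_ne_zero _)

-- Clearing denominators, `b = ζ̄ z b + α z a`; taking adjoints, `(1 - ζ S*) T_b* F = T_a* (ᾱ S*
-- F)`. As `S*` commutes with `T_a*`, one direction cancels the injective `T_a*` and the other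
-- cancels the injective `1 - ζ S*`.
set_option maxHeartbeats 800000 in
theorem adjoint_toeplitz_eq_iff {b a : LpCircle ∞} (hba : IsPair b a) {ζ α : ℂ} (hζ : ‖ζ‖ ≤ 1)
    (hφ : ∀ z ∈ ball (0 : ℂ) 1, diskExt b z / diskExt a z = α * z / (1 - conj ζ * z)) (F G : H2) :
    adjoint (toeplitz b) F = adjoint (toeplitz a) G ↔
      ∀ n, conj α * coeff F (n + 1) = coeff G n - ζ * coeff G (n + 1) := by
  have ha := hba.isOuter
  have hne : ∀ z ∈ ball (0 : ℂ) 1, 1 - conj ζ * z ≠ 0 := fun z hz => by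
    refine one_sub_conj_mul_ne_zero ?_
    have : ‖z‖ < 1 := by simpa using hz
    nlinarith [norm_nonneg ζ, norm_nonneg z]
  have hT : ∀ X : H2, toeplitz b X =
      conj ζ • shift (toeplitz b X) + α • shift (toeplitz a X) := fun X =>
    eq_of_eqOn_diskExt fun z hz => by
      rw [diskExt_add _ _ hz, diskExt_smul _ _ hz, diskExt_smul _ _ hz, diskExt_shift _ hz,
        diskExt_shift _ hz, diskExt_toeplitz hba.isHInf X hz, diskExt_toeplitz ha.isHInf X hz]
      have h1 := hφ z hz
      rw [div_eq_div_iff (ha.diskExt_ne_zero hz) (hne z hz)] at h1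
      linear_combination (diskExt (X : LpCircle 2) z) * h1
  have hadj : adjoint (toeplitz b) F - ζ • adjoint shift (adjoint (toeplitz b) F) =
      adjoint (toeplitz a) (conj α • adjoint shift F) := by
    refine ext_inner_left ℂ fun X => ?_
    have hX := congrArg (fun Y => inner ℂ Y F) (hT X)
    simp only [inner_add_left] at hX
    have e1 : inner ℂ (conj ζ • shift (toeplitz b X)) F = ζ * inner ℂ (shift (toeplitz b X)) F := by
      refine (inner_smul_left (𝕜 := ℂ) (shift (toeplitz b X)) F (conj ζ)).trans ?_
      rw [Complex.conj_conj]
    have e2 : inner ℂ (α • shift (toeplitz a X)) F = conj α * inner ℂ (shift (toeplitz a X)) F :=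
      inner_smul_left (𝕜 := ℂ) (shift (toeplitz a X)) F α
    rw [e1, e2] at hX
    rw [inner_sub_right, adjoint_inner_right, adjoint_inner_right (toeplitz a)]
    have e3 : inner ℂ X (ζ • adjoint shift (adjoint (toeplitz b) F)) =
        ζ * inner ℂ (shift (toeplitz b X)) F := by
      refine (inner_smul_right (𝕜 := ℂ) X (adjoint shift (adjoint (toeplitz b) F)) ζ).trans ?_
      rw [adjoint_inner_right, adjoint_inner_right, toeplitz_shift hba.isHInf]
    have e4 : inner ℂ (toeplitz a X) (conj α • adjoint shift F) =
        conj α * inner ℂ (shift (toeplitz a X)) F := by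
      refine (inner_smul_right (𝕜 := ℂ) (toeplitz a X) (adjoint shift F) (conj α)).trans ?_
      rw [adjoint_inner_right]
    rw [e3, e4, hX]
    ring
  obtain ⟨w, hw⟩ : ∃ w, w = conj α • adjoint shift F := ⟨_, rfl⟩
  rw [← hw] at hadj
  have hcomm : adjoint (toeplitz a) G - ζ • adjoint shift (adjoint (toeplitz a) G) =
      adjoint (toeplitz a) (G - ζ • adjoint shift G) := by
    rw [map_sub, map_smul, adjoint_toeplitz_adjoint_shift ha.isHInf]
  have hR : (∀ n, conj α * coeff F (n + 1) = coeff G n - ζ * coeff G (n + 1)) ↔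
      w = G - ζ • adjoint shift G := by
    rw [hw]
    constructor
    · intro h
      refine H2_ext fun n => ?_
      rw [coeff_smul, coeff_sub, coeff_smul, coeff_adjoint_shift, coeff_adjoint_shift, h]
    · intro h n
      have := congrArg (fun X => coeff X n) h
      simpa only [coeff_smul, coeff_sub, coeff_adjoint_shift] using this
  rw [hR]
  constructor
  · intro h
    rw [h, hcomm] at hadj
    exact (ha.injective_adjoint_toeplitz hadj).symm
  · intro h
    subst h
    have hadj := hadj.trans hcomm.symm
    refine sub_eq_zero.1 ?_
    refine one_sub_smul_adjoint_shift_injective hζ ?_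
    have hab : ∀ u v w x : H2, u - v = w - x → v - x = u - w := fun u v w x h => by
      rw [sub_eq_sub_iff_add_eq_add] at h ⊢
      rw [add_comm v, add_comm u, ← h, add_comm]
    exact (congrArg (ζ • ·) (map_sub (adjoint shift) _ _)).trans ((smul_sub ζ _ _).trans
      (hab _ _ _ _ hadj))

/-! ### Weights -/

theorem measurable_superharmonicKernel :
    Measurable fun p : ℂ × ℂ => superharmonicKernel p.1 p.2 := by
  unfold superharmonicKernel
  refine Measurable.ite ?_ (Measurable.ite ?_ measurable_const ?_) ?_
  · exact measurableSet_lt (by fun_prop) measurable_const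
  · exact measurableSet_eq_fun measurable_snd measurable_fst
  · fun_prop
  · fun_prop

instance : IsFiniteMeasure diskArea := ⟨by
  rw [diskArea, Measure.smul_apply, smul_eq_mul]
  exact ENNReal.mul_lt_top (by simpa using Real.pi_pos) <| by
    rw [Measure.restrict_apply MeasurableSet.univ, univ_inter]
    exact measure_ball_lt_top⟩

theorem dirichletIntegral_weight (μ : Measure ClosedDisk) [IsFiniteMeasure μ] (f : ℂ → ℂ) :
    dirichletIntegral (weight μ) f =
      ∫⁻ ζ : ClosedDisk, dirichletIntegral (superharmonicKernel ζ) f ∂μ := by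
  unfold dirichletIntegral weight
  rw [lintegral_lintegral_swap]
  · refine lintegral_congr fun z => ?_
    rw [lintegral_const_mul' _ _ (by simp)]
  · refine Measurable.aemeasurable ?_
    have h1 : Measurable fun p : ClosedDisk × ℂ => ‖deriv f p.2‖ₑ ^ 2 :=
      (((measurable_deriv f).comp measurable_snd).enorm).pow_const 2
    have h2 : Measurable fun p : ClosedDisk × ℂ => superharmonicKernel p.1 p.2 :=
      measurable_superharmonicKernel.comp (f := fun p : ClosedDisk × ℂ => ((p.1 : ℂ), p.2))
        (by fun_prop)
    exact h1.mul h2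

theorem dirichletIntegral_weight_dirac (c : ℝ≥0∞) (ζ : ClosedDisk) (hc : c ≠ ∞)
    (f : ℂ → ℂ) : dirichletIntegral (weight (c • Measure.dirac ζ)) f =
      c * dirichletIntegral (superharmonicKernel ζ) f := by
  have : IsFiniteMeasure (c • Measure.dirac ζ) := ⟨by simpa using hc.lt_top⟩
  rw [dirichletIntegral_weight, lintegral_smul_measure, lintegral_dirac, smul_eq_mul]

theorem enorm_smul_sq (c : ℂ) (F : H2) : ‖c • F‖ₑ ^ 2 = ENNReal.ofReal (‖c‖ ^ 2) * ‖F‖ₑ ^ 2 := by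
  rw [H2_enorm_sq, H2_enorm_sq, ← ENNReal.tsum_mul_left]
  simp_rw [coeff_smul, enorm_mul, mul_pow, ofReal_norm_sq]

theorem dirichletSpace_eq_dbrSpace_of_dirac {b a : LpCircle ∞} (hba : IsPair b a)
    {ζ : ClosedDisk} {α : ℂ} (hα : α ≠ 0)
    (hφ : ∀ z ∈ ball (0 : ℂ) 1, diskExt b z / diskExt a z = α * z / (1 - conj (ζ : ℂ) * z)) :
    dirichletSpace (ENNReal.ofReal (‖α‖ ^ 2) • Measure.dirac ζ) = dbrSpace b ∧
      ∀ f ∈ dirichletSpace (ENNReal.ofReal (‖α‖ ^ 2) • Measure.dirac ζ),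
        dirichletNormSq (ENNReal.ofReal (‖α‖ ^ 2) • Measure.dirac ζ) f = dbrNormSq b f := by
  have hζ : ‖(ζ : ℂ)‖ ≤ 1 := mem_closedBall_zero_iff.1 ζ.2
  have hinj := hba.isOuter.injective_adjoint_toeplitz
  have hiff := adjoint_toeplitz_eq_iff hba hζ hφ
  have hαn : ENNReal.ofReal (‖α‖ ^ 2) ≠ 0 := by simpa using hα
  have key : ∀ f ∈ dirichletSpace (ENNReal.ofReal (‖α‖ ^ 2) • Measure.dirac ζ),
      f ∈ dbrSpace b ∧
      dirichletNormSq (ENNReal.ofReal (‖α‖ ^ 2) • Measure.dirac ζ) f = dbrNormSq b f := by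
    rintro f ⟨hf, hfin⟩
    rw [dirichletIntegral_weight_dirac _ _ ENNReal.ofReal_ne_top] at hfin
    have hfin' := ENNReal.lt_top_of_mul_ne_top_right hfin.ne hαn
    obtain ⟨c, g, hg, hgf, he⟩ := exists_of_local_lt_top hζ hf hfin'
    obtain ⟨x, hx⟩ := HasTaylor.exists_of_differentiableOn hg
    obtain ⟨G, -, hG⟩ := hx.exists_H2 hgf
    -- This is `c + (z - ζ) g` as a vector of `H²`; the mate is `ᾱ g`.
    let F : H2 := c • monom 0 + (shift G + (-(ζ : ℂ)) • G)
    have hF : EqOn f (diskExt (F : LpCircle 2)) (ball 0 1) := fun z hz => by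
      rw [he z hz, diskExt_add _ _ hz, diskExt_add _ _ hz, diskExt_smul _ _ hz, diskExt_smul _ _ hz,
        diskExt_shift _ hz, diskExt_monom _ hz, hG hz]
      ring
    have hm : adjoint (toeplitz b) F = adjoint (toeplitz a) (conj α • G) := by
      rw [hiff]
      intro n
      simp only [F, coeff_add, coeff_smul, coeff_shift, coeff_monom, Nat.add_sub_cancel]
      simp
      ring
    refine ⟨(mem_dbrSpace_iff hba hinj).2 ⟨F, _, hF, hm⟩, ?_⟩
    rw [dbrNormSq_eq hba hinj hF hm, dirichletNormSq,
      dirichletIntegral_weight_dirac _ _ ENNReal.ofReal_ne_top, local_douglas hζ hg hgf he,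
      hardyNormSq_congr hF, hardyNormSq_congr hG, hardyNormSq_diskExt, hardyNormSq_diskExt,
      enorm_smul_sq, RCLike.norm_conj]
  refine ⟨Subset.antisymm (fun f hf => (key f hf).1) fun f hf => ?_, fun f hf => (key f hf).2⟩
  obtain ⟨F, G, hF, hm⟩ := (mem_dbrSpace_iff hba hinj).1 hf
  rw [hiff] at hm
  have hc : conj α ≠ 0 := by simpa using hα
  let g := diskExt (((conj α)⁻¹ • G : H2) : LpCircle 2)
  have hg : HasTaylor g fun n => (conj α)⁻¹ * coeff G n := by
    convert! hasTaylor_diskExt ((conj α)⁻¹ • G) using 1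
    exact funext fun n => (coeff_smul _ _ _).symm
  have hgf : hardyNormSq g < ∞ := by
    rw [hardyNormSq_diskExt]
    exact ENNReal.pow_lt_top enorm_lt_top
  -- The coefficient relation fixes everything except the constant term, and the added constant is
  -- chosen to match it.
  have he : ∀ z ∈ ball (0 : ℂ) 1,
      f z = (coeff F 0 + ζ * ((conj α)⁻¹ * coeff G 0)) + (z - ζ) * g z := by
    intro z hz
    rw [hF hz]
    refine (hasTaylor_diskExt F).eqOn (g := fun z =>
      (coeff F 0 + ζ * ((conj α)⁻¹ * coeff G 0)) + (z - ζ) * g z) ?_ hz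
    convert! hasTaylor_const_add_mul hg _ _ using 1
    funext n
    rcases n with _ | n
    · simp
    · have := hm n
      simp only [Nat.add_eq_zero_iff, one_ne_zero, and_false, if_false, Nat.add_sub_cancel]
      field_simp
      linear_combination this
  refine ⟨(hasTaylor_diskExt F).differentiableOn.congr hF, ?_⟩
  rw [dirichletIntegral_weight_dirac _ _ ENNReal.ofReal_ne_top,
    local_douglas hζ hg.differentiableOn hgf he]
  exact ENNReal.mul_lt_top ENNReal.ofReal_lt_top hgf

/-! ### Polynomials -/

/-- The polynomial `∑_{i < n} s_{n-1-i} z^i`, as an element of `H²`. -/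
def hankelVec (n : ℕ) (s : ℕ → ℂ) : H2 := ∑ i ∈ Finset.range n, s (n - 1 - i) • monom i

theorem inner_hankelVec (X : H2) (n : ℕ) (s : ℕ → ℂ) :
    inner ℂ X (hankelVec n s) = ∑ i ∈ Finset.range n, s (n - 1 - i) * conj (coeff X i) := by
  rw [hankelVec, inner_sum]
  refine Finset.sum_congr rfl fun i _ => ?_
  refine (inner_smul_right (𝕜 := ℂ) X (monom i) _).trans ?_
  rw [coeff_eq_inner]
  exact congrArg _ (inner_conj_symm (𝕜 := ℂ) X (monom i)).symm

theorem coeff_hankelVec (n : ℕ) (s : ℕ → ℂ) (i : ℕ) :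
    coeff (hankelVec n s) i = if i < n then s (n - 1 - i) else 0 := by
  rw [coeff_eq_inner, inner_hankelVec]
  simp [coeff_monom]

theorem diskExt_hankelVec (n : ℕ) (s : ℕ → ℂ) {z : ℂ} (hz : z ∈ ball (0 : ℂ) 1) :
    diskExt (hankelVec n s : LpCircle 2) z = ∑ i ∈ Finset.range n, s (n - 1 - i) * z ^ i := by
  refine ((hasTaylor_diskExt (hankelVec n s)) z hz).unique ?_
  have h := hasSum_sum_of_ne_finset_zero (f := fun i => coeff (hankelVec n s) i * z ^ i)
    (s := Finset.range n) (L := .unconditional ℕ) fun i hi => by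
      rw [Finset.mem_range] at hi
      rw [coeff_hankelVec, if_neg hi, zero_mul]
  rwa [Finset.sum_congr rfl fun i hi => by
    rw [coeff_hankelVec, if_pos (Finset.mem_range.1 hi)]] at h

/-- The coefficient of the top power is `s 0`; once `φ(0) = 0` is known, this lowers the degree of
the mates by one. -/
theorem hankelVec_succ {s : ℕ → ℂ} (hs : s 0 = 0) (n : ℕ) :
    hankelVec (n + 1) s = hankelVec n fun k => s (k + 1) := H2_ext fun i => by
  rw [coeff_hankelVec, coeff_hankelVec]
  rcases lt_trichotomy i n with h | h | h
  · rw [if_pos (by omega), if_pos h]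
    congr 1
    omega
  · subst h
    simp [hs]
  · rw [if_neg (by omega), if_neg (by omega)]

/-- The two polynomials overlap only in the constant coefficient, so `c` enters through one square
and one multiple of `|c|²`. -/
theorem enorm_sq_hankelVec_add (s : ℕ → ℂ) (m : ℕ) (c : ℂ) :
    ‖hankelVec 1 s + c • hankelVec (m + 1) s‖ₑ ^ 2 = ENNReal.ofReal
      (‖s 0 + c * s m‖ ^ 2 + ‖c‖ ^ 2 * ∑ j ∈ Finset.range m, ‖s j‖ ^ 2) := by
  rw [H2_enorm_sq, tsum_eq_sum (s := Finset.range (m + 1)) fun i hi => by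
    rw [Finset.mem_range] at hi
    rw [coeff_add, coeff_smul, coeff_hankelVec, coeff_hankelVec, if_neg (by omega), if_neg hi]
    simp]
  have h : ∀ i, coeff (hankelVec 1 s + c • hankelVec (m + 1) s) (i + 1) =
      if i < m then c * s (m - 1 - i) else 0 := fun i => by
    rw [coeff_add, coeff_smul, coeff_hankelVec, coeff_hankelVec, if_neg (by omega), zero_add]
    by_cases hi : i < m
    · rw [if_pos (by omega), if_pos hi]
      congr 2
      omega
    · rw [if_neg (by omega), if_neg hi, mul_zero]
  rw [Finset.sum_range_succ', Finset.mul_sum, ← Finset.sum_range_reflect (fun j => ‖c‖ ^ 2 * ‖s j‖ ^ 2),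
    ENNReal.ofReal_add (by positivity) (by positivity),
    ENNReal.ofReal_sum_of_nonneg fun _ _ => by positivity, ofReal_norm_sq, add_comm]
  congr 1
  · rw [coeff_add, coeff_smul, coeff_hankelVec, coeff_hankelVec]
    simp
  · refine Finset.sum_congr rfl fun i hi => ?_
    rw [h, if_pos (Finset.mem_range.1 hi), ← ofReal_norm_sq, norm_mul, mul_pow]

/-- Pairing with `X` extracts the `n`-th coefficient of `b X = φ · a X`, a finite Cauchy product. No
boundedness of `φ` is needed. -/
theorem adjoint_toeplitz_monom {b a : LpCircle ∞} (hba : IsPair b a) {p : ℕ → ℂ}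
    (hp : HasTaylor (fun z => diskExt b z / diskExt a z) p) (n : ℕ) :
    adjoint (toeplitz b) (monom n) = adjoint (toeplitz a) (hankelVec (n + 1) fun k => conj (p k)) := by
  refine ext_inner_left ℂ fun X => ?_
  have hX : HasTaylor (diskExt (toeplitz b X : LpCircle 2)) _ :=
    ((hasTaylor_diskExt (toeplitz a X)).mul hp).congr fun z hz => by
      beta_reduce
      rw [diskExt_toeplitz hba.isHInf X hz, diskExt_toeplitz hba.isOuter.isHInf X hz]
      field_simp [hba.isOuter.diskExt_ne_zero hz]
  have hc := congrFun ((hasTaylor_diskExt (toeplitz b X)).unique hX) n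
  rw [adjoint_inner_right, adjoint_inner_right, inner_hankelVec, ← inner_conj_symm,
    ← coeff_eq_inner, hc, map_sum]
  refine Finset.sum_congr rfl fun k _ => ?_
  rw [map_mul, mul_comm, Nat.add_sub_cancel]

/-- The quotient `(z^n - ζ^n) / (z - ζ)` is the geometric sum `∑_{i<n} ζ^{n-1-i} z^i`, and the local
Douglas formula applies to it. -/
theorem dirichletIntegral_superharmonicKernel_monom_add {ζ : ℂ} (hζ : ‖ζ‖ ≤ 1) (n m : ℕ) (c : ℂ) :
    dirichletIntegral (superharmonicKernel ζ) (diskExt ((monom n + c • monom m : H2) : LpCircle 2)) =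
      ‖hankelVec n (fun k => ζ ^ k) + c • hankelVec m (fun k => ζ ^ k)‖ₑ ^ 2 := by
  rw [← hardyNormSq_diskExt]
  refine local_douglas (a := ζ ^ n + c * ζ ^ m) hζ (hasTaylor_diskExt _).differentiableOn ?_
    fun z hz => ?_
  · rw [hardyNormSq_diskExt]
    exact ENNReal.pow_lt_top enorm_lt_top
  · rw [diskExt_add _ _ hz, diskExt_add _ _ hz, diskExt_smul _ _ hz, diskExt_smul _ _ hz,
      diskExt_monom _ hz, diskExt_monom _ hz, diskExt_hankelVec _ _ hz, diskExt_hankelVec _ _ hz]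
    have h1 := geom_sum₂_mul z ζ n
    have h2 := geom_sum₂_mul z ζ m
    simp_rw [mul_comm (z ^ _) (ζ ^ _)] at h1 h2
    linear_combination -h1 - c * h2

/-! ### Measures on the closed disk -/

theorem _root_.Continuous.integrable_of_finite {X E : Type*} [TopologicalSpace X] [CompactSpace X]
    [MeasurableSpace X] [OpensMeasurableSpace X] [NormedAddCommGroup E] {μ : Measure X}
    [IsFiniteMeasure μ] {f : X → E} (hf : Continuous f) : Integrable f μ :=
  hf.integrable_of_hasCompactSupport (HasCompactSupport.of_compactSpace f)

/-- Both sides are real quadratic polynomials in `c` of the form constant plus `2 Re (c w)` plus a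
multiple of `|c|²`. The values at `c = 0, ±1, ±i` determine the three coefficients. -/
theorem integral_eq_of_polarization {X : Type*} [TopologicalSpace X] [CompactSpace X]
    [MeasurableSpace X] [OpensMeasurableSpace X] {μ : Measure X} [IsFiniteMeasure μ]
    {v : X → ℂ} {r : X → ℝ} (hv : Continuous v) (hr : Continuous r) {U V : ℂ} {R : ℝ}
    (h : ∀ c : ℂ, ∫ x, (‖1 + c * v x‖ ^ 2 + ‖c‖ ^ 2 * r x) ∂μ =
      ‖U + c * V‖ ^ 2 + ‖c‖ ^ 2 * R) :
    μ.real univ = ‖U‖ ^ 2 ∧ ∫ x, v x ∂μ = conj U * V ∧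
      ∫ x, (‖v x‖ ^ 2 + r x) ∂μ = ‖V‖ ^ 2 + R := by
  have hvi : Integrable v μ := hv.integrable_of_finite
  have hexp : ∀ U V c : ℂ, ‖U + c * V‖ ^ 2 =
      ‖U‖ ^ 2 + (2 * (c * (conj U * V)).re + ‖c‖ ^ 2 * ‖V‖ ^ 2) := fun U V c => by
    simp only [Complex.sq_norm, Complex.normSq_apply, Complex.add_re, Complex.add_im,
      Complex.mul_re, Complex.mul_im, Complex.conj_re, Complex.conj_im]
    ring
  have h' : ∀ c : ℂ, μ.real univ + (2 * (c * ∫ x, v x ∂μ).re +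
      ‖c‖ ^ 2 * ∫ x, (‖v x‖ ^ 2 + r x) ∂μ) =
      ‖U‖ ^ 2 + (2 * (c * (conj U * V)).re + ‖c‖ ^ 2 * (‖V‖ ^ 2 + R)) := fun c => by
    have e : ∫ x, (‖1 + c * v x‖ ^ 2 + ‖c‖ ^ 2 * r x) ∂μ =
        ∫ x, (1 + (2 * (c * v x).re + ‖c‖ ^ 2 * (‖v x‖ ^ 2 + r x))) ∂μ := by
      refine integral_congr_ae (.of_forall fun x => ?_)
      simp only [hexp 1 (v x) c, map_one, one_mul, norm_one]
      ring
    have := h c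
    rw [e, integral_add (integrable_const _) (Continuous.integrable_of_finite (by fun_prop)),
      integral_add (Continuous.integrable_of_finite (by fun_prop))
        (Continuous.integrable_of_finite (by fun_prop)), integral_const_mul, integral_const_mul,
      integral_const, smul_eq_mul, mul_one, hexp] at this
    have hre : ∫ x, (c * v x).re ∂μ = (c * ∫ x, v x ∂μ).re := by
      rw [← integral_const_mul]
      exact integral_re (hvi.const_mul c)
    rw [hre] at this
    linarith
  have h0 := h' 0
  have h1 := h' 1
  have h2 := h' (-1)
  have h3 := h' Complex.I
  have h4 := h' (-Complex.I)
  simp only [zero_mul, Complex.zero_re, norm_zero, norm_one, norm_neg, Complex.norm_I, neg_mul,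
    one_mul, Complex.neg_re, Complex.I_mul_re, one_pow, mul_zero, add_zero, ne_eq,
    OfNat.ofNat_ne_zero, not_false_eq_true, zero_pow] at h0 h1 h2 h3 h4
  refine ⟨h0, Complex.ext (by linarith) (by linarith), by linarith⟩

/-- A variance argument: the moments of order `0`, `1` and the second absolute moment satisfy the
equality case of Cauchy-Schwarz, so the identity function is `μ`-almost everywhere equal to `t_1 /
t_0`. That point lies in the closed disk because it is attained. -/
theorem exists_eq_smul_dirac {μ : Measure ClosedDisk} [IsFiniteMeasure μ] (hμ : μ ≠ 0)
    {t : ℕ → ℂ} (h0 : μ.real univ = ‖t 0‖ ^ 2)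
    (h1 : ∀ n, ∫ x : ClosedDisk, (x : ℂ) ^ n ∂μ = conj (t 0) * t n)
    (h2 : ∫ x : ClosedDisk, ‖(x : ℂ)‖ ^ 2 ∂μ = ‖t 1‖ ^ 2) :
    ∃ ζ : ClosedDisk, t 0 ≠ 0 ∧ μ = ENNReal.ofReal (‖t 0‖ ^ 2) • Measure.dirac ζ ∧
      ∀ n, t n = t 0 * (ζ : ℂ) ^ n := by
  have ht0 : t 0 ≠ 0 := by
    intro h
    rw [h, norm_zero, zero_pow two_ne_zero, measureReal_eq_zero_iff,
      Measure.measure_univ_eq_zero] at h0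
    exact hμ h0
  have hc0 : conj (t 0) ≠ 0 := by simpa using ht0
  have hu : μ univ = ENNReal.ofReal (‖t 0‖ ^ 2) := by
    rw [← h0, ofReal_measureReal]
  have hint : ∫ x : ClosedDisk, ‖(x : ℂ) - t 1 / t 0‖ ^ 2 ∂μ = 0 := by
    have e : ∀ x : ClosedDisk, ‖(x : ℂ) - t 1 / t 0‖ ^ 2 = ‖(x : ℂ)‖ ^ 2 +
        (-2 * (conj (t 1 / t 0) * (x : ℂ)).re + ‖t 1 / t 0‖ ^ 2) := fun x => by
      simp only [Complex.sq_norm, Complex.normSq_apply, Complex.sub_re, Complex.sub_im,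
        Complex.mul_re, Complex.conj_re, Complex.conj_im]
      ring
    simp_rw [e]
    rw [integral_add (Continuous.integrable_of_finite (by fun_prop))
      (Continuous.integrable_of_finite (by fun_prop)),
      integral_add (Continuous.integrable_of_finite (by fun_prop)) (integrable_const _),
      integral_const_mul, integral_const, h2, smul_eq_mul, h0]
    have hre : ∫ x : ClosedDisk, (conj (t 1 / t 0) * (x : ℂ)).re ∂μ =
        (conj (t 1 / t 0) * ∫ x : ClosedDisk, (x : ℂ) ∂μ).re := by
      rw [← integral_const_mul]
      exact integral_re (Continuous.integrable_of_finite
        (f := fun x : ClosedDisk => conj (t 1 / t 0) * (x : ℂ)) (by fun_prop))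
    have h11 := h1 1
    simp only [pow_one] at h11
    rw [hre, h11, map_div₀, div_mul_eq_mul_div, mul_left_comm, mul_div_cancel_left₀ _ hc0,
      ← Complex.normSq_eq_conj_mul_self, Complex.ofReal_re, norm_div, div_pow,
      mul_div_cancel₀ _ (by simpa using ht0), ← Complex.sq_norm]
    ring
  have hae : ∀ᵐ x : ClosedDisk ∂μ, (x : ℂ) = t 1 / t 0 := by
    rw [integral_eq_zero_iff_of_nonneg (fun _ => by positivity)
      (Continuous.integrable_of_finite (by fun_prop))] at hint
    filter_upwards [hint] with x hx
    simpa [sub_eq_zero] using hx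
  have : (ae μ).NeBot := ae_neBot.2 hμ
  obtain ⟨ζ, hζ⟩ := hae.exists
  -- The identity map agrees almost everywhere with a constant map, and pushing `μ` forward along
  -- each gives the two sides.
  have hμd : μ = ENNReal.ofReal (‖t 0‖ ^ 2) • Measure.dirac ζ := by
    rw [← hu, ← Measure.map_const]
    conv_lhs => rw [← Measure.map_id (μ := μ)]
    refine Measure.map_congr ?_
    filter_upwards [hae] with x hx
    exact Subtype.ext (hx.trans hζ.symm)
  refine ⟨ζ, ht0, hμd, fun n => ?_⟩
  have h := h1 n
  rw [integral_congr_ae (g := fun _ => (ζ : ℂ) ^ n) (by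
    filter_upwards [hae] with x hx
    rw [hx, hζ]), integral_const, h0, Complex.real_smul, Complex.sq_norm,
    Complex.normSq_eq_conj_mul_self, mul_assoc] at h
  exact (mul_left_cancel₀ hc0 h).symm

/-! ### Equality of the norms -/

/-- The `H²` parts of the two norms of `z^n + c z^m` are equal and finite, so they cancel and leave
the Dirichlet integral against the norm of the mate. -/
theorem lintegral_enorm_sq_hankelVec {μ : Measure ClosedDisk} [IsFiniteMeasure μ]
    {b a : LpCircle ∞} (hba : IsPair b a) (hsub : dirichletSpace μ = dbrSpace b)
    (hnorm : ∀ f ∈ dirichletSpace μ, dirichletNormSq μ f = dbrNormSq b f) {p : ℕ → ℂ}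
    (hp : HasTaylor (fun z => diskExt b z / diskExt a z) p) (n m : ℕ) (c : ℂ) :
    ∫⁻ ζ : ClosedDisk,
      ‖hankelVec n (fun k => (ζ : ℂ) ^ k) + c • hankelVec m (fun k => (ζ : ℂ) ^ k)‖ₑ ^ 2 ∂μ =
      ‖hankelVec (n + 1) (fun k => conj (p k)) + c • hankelVec (m + 1) (fun k => conj (p k))‖ₑ ^ 2 := by
  have hinj := hba.isOuter.injective_adjoint_toeplitz
  set F : H2 := monom n + c • monom m with hF
  have hm : adjoint (toeplitz b) F = adjoint (toeplitz a)
      (hankelVec (n + 1) (fun k => conj (p k)) + c • hankelVec (m + 1) (fun k => conj (p k))) := by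
    rw [hF, map_add, map_smul, map_add, map_smul, adjoint_toeplitz_monom hba hp,
      adjoint_toeplitz_monom hba hp]
  have hE : EqOn (diskExt (F : LpCircle 2)) (diskExt (F : LpCircle 2)) (ball 0 1) := fun _ _ => rfl
  have hmem : diskExt (F : LpCircle 2) ∈ dirichletSpace μ := by
    rw [hsub]
    exact (mem_dbrSpace_iff hba hinj).2 ⟨F, _, hE, hm⟩
  have h := hnorm _ hmem
  rw [dbrNormSq_eq hba hinj hE hm, dirichletNormSq, hardyNormSq_diskExt,
    ENNReal.add_right_inj (ENNReal.pow_lt_top enorm_lt_top).ne, dirichletIntegral_weight] at h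
  rw [← h]
  refine lintegral_congr fun ζ => ?_
  rw [hF, dirichletIntegral_superharmonicKernel_monom_add (mem_closedBall_zero_iff.1 ζ.2)]

theorem exists_dirac_of_dirichletSpace_eq {μ : Measure ClosedDisk} [IsFiniteMeasure μ]
    (hμ : μ ≠ 0) {b a : LpCircle ∞} (hba : IsPair b a) (hsub : dirichletSpace μ = dbrSpace b)
    (hnorm : ∀ f ∈ dirichletSpace μ, dirichletNormSq μ f = dbrNormSq b f) :
    ∃ (ζ : ClosedDisk) (α : ℂ), α ≠ 0 ∧
      μ = ENNReal.ofReal (‖α‖ ^ 2) • Measure.dirac ζ ∧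
      ∀ z ∈ ball (0 : ℂ) 1,
        diskExt b z / diskExt a z = α * z / (1 - conj (ζ : ℂ) * z) := by
  obtain ⟨p, hp⟩ := HasTaylor.exists_of_differentiableOn
    (f := fun z => diskExt b z / diskExt a z)
    (hba.isHInf.hasTaylor.differentiableOn.div hba.isOuter.isHInf.hasTaylor.differentiableOn
      fun z hz => hba.isOuter.diskExt_ne_zero hz)
  have hq := lintegral_enorm_sq_hankelVec hba hsub hnorm hp
  -- Constants have zero Dirichlet integral, so the mate `conj (p 0)` of `1` vanishes.
  have hp0 : conj (p 0) = 0 := by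
    have h := hq 0 0 0
    have h0 := enorm_sq_hankelVec_add (fun k => conj (p k)) 0 0
    rw [zero_add, ← h] at h0
    have e0 : ‖(0 : H2)‖ₑ = 0 := enorm_zero
    simpa [hankelVec, e0] using h0.symm
  set t : ℕ → ℂ := fun k => conj (p (k + 1)) with ht
  have hpol : ∀ (m : ℕ) (c : ℂ), ∫ x : ClosedDisk, (‖1 + c * (x : ℂ) ^ m‖ ^ 2 +
      ‖c‖ ^ 2 * ∑ j ∈ Finset.range m, ‖(x : ℂ) ^ j‖ ^ 2) ∂μ =
      ‖t 0 + c * t m‖ ^ 2 + ‖c‖ ^ 2 * ∑ j ∈ Finset.range m, ‖t j‖ ^ 2 := fun m c => by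
    -- Pairing `z` with `z^(m+1)` suffices: the quotient of `z` is the constant `1`, so the cross
    -- term is the moment of order `m`.
    have h := hq 1 (m + 1) c
    rw [hankelVec_succ (s := fun k => conj (p k)) hp0 1,
      hankelVec_succ (s := fun k => conj (p k)) hp0 (m + 1), enorm_sq_hankelVec_add] at h
    simp_rw [enorm_sq_hankelVec_add, pow_zero] at h
    rw [← ofReal_integral_eq_lintegral_ofReal (Continuous.integrable_of_finite (by fun_prop))
      (.of_forall fun _ => by positivity), ENNReal.ofReal_eq_ofReal_iff
      (integral_nonneg fun _ => by positivity) (by positivity)] at h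
    exact h
  have hm := fun m => integral_eq_of_polarization (by fun_prop) (by fun_prop) (hpol m)
  -- For `m = 1` the extra term is the total mass on one side and `|t_0|²` on the other; these are
  -- equal and cancel.
  have h2 : ∫ x : ClosedDisk, ‖(x : ℂ)‖ ^ 2 ∂μ = ‖t 1‖ ^ 2 := by
    have h := (hm 1).2.2
    simp only [pow_one, Finset.range_one, Finset.sum_singleton, pow_zero, norm_one, one_pow] at h
    rw [integral_add (Continuous.integrable_of_finite (by fun_prop)) (integrable_const _),
      integral_const, smul_eq_mul, mul_one, (hm 0).1] at h
    linarith
  obtain ⟨ζ, ht0, hμd, htn⟩ := exists_eq_smul_dirac hμ (hm 0).1 (fun m => (hm m).2.1) h2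
  refine ⟨ζ, p 1, by simpa [ht] using ht0, by simpa [ht] using hμd, fun z hz => ?_⟩
  have hz1 : ‖z‖ < 1 := by simpa using hz
  have hζ : ‖(ζ : ℂ)‖ ≤ 1 := mem_closedBall_zero_iff.1 ζ.2
  have hlt : ‖conj (ζ : ℂ) * z‖ < 1 := by
    rw [norm_mul, RCLike.norm_conj]
    nlinarith [norm_nonneg z, norm_nonneg (ζ : ℂ)]
  have hs := (hasSum_nat_add_iff' 1).2 (hp z hz)
  rw [Finset.sum_range_one, (map_eq_zero _).1 hp0, zero_mul, sub_zero] at hs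
  refine hs.unique ?_
  rw [div_eq_mul_inv]
  convert! (hasSum_geometric_of_norm_lt_one hlt).mul_left (p 1 * z) using 2 with n
  have : p (n + 1) = p 1 * conj (ζ : ℂ) ^ n := by
    have := congrArg conj (htn n)
    simpa [ht] using this
  rw [this]
  ring

end DBR

end

theorem theoremT (μ : MeasureTheory.Measure DBR.ClosedDisk) [MeasureTheory.IsFiniteMeasure μ]
    (hμ : μ ≠ 0) (b a : DBR.LpCircle ∞) (hba : DBR.IsPair b a) :
    (DBR.dirichletSpace μ = DBR.dbrSpace b ∧
      ∀ f ∈ DBR.dirichletSpace μ, DBR.dirichletNormSq μ f = DBR.dbrNormSq b f) ↔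
    ∃ (ζ : DBR.ClosedDisk) (α : ℂ), α ≠ 0 ∧
      μ = ENNReal.ofReal (‖α‖ ^ 2) • MeasureTheory.Measure.dirac ζ ∧
      ∀ z ∈ Metric.ball (0 : ℂ) 1,
        DBR.diskExt b z / DBR.diskExt a z = α * z / (1 - conj (ζ : ℂ) * z) := by
  constructor
  · rintro ⟨hsub, hnorm⟩
    exact DBR.exists_dirac_of_dirichletSpace_eq hμ hba hsub hnorm
  · rintro ⟨ζ, α, hα, rfl, hφ⟩
    exact DBR.dirichletSpace_eq_dbrSpace_of_dirac hba hα hφ
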